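/- Let $\mathcal{P}=\langle\Sigma\mid\mathcal{R}\rangle$ be an arboreal semigroup presentation: every relation has the form $u=v$ with $u\in\Sigma$ and $v\in\Sigma^+$, and two relations have the same left-hand side if and only if they have the same right-hand side. Let $w\in\Sigma^+$. Let $T(\mathcal{P},w)$ be the $\Sigma$-labelled planar rooted forest with $|w|$ roots, labelled from left to right by the letters of $w$, in which a vertex labelled by $u$ has $|v|$ children, labelled from left to right by the letters of $v$, if $u=v$ is a relation in $\mathcal{R}$, and no children if there is no such relation. A $(\mathcal{P},w)$-forest is a finite rooted subforest of $T(\mathcal{P},w)$ that contains all the roots and that contains all the children of a vertex as soon as it contains one of them. Its $\mathcal{P}$-leaves are the vertices that are leaves in it but not in $T(\mathcal{P},w)$; its other vertices are $\mathcal{P}$-interior. Vertices are ordered from left to right; a vertex is to the right of its leftmost child and of the descendants of that child, and to the left of its other descendants. Let $\mathscr{D}_{p,q}$ be a closed disc with $p$ punctures on a horizontal line in its interior and $q$ marked points on its boundary below this line. Let $\mathcal{B}_{p,q}$ be the group of the orientation-preserving homeomorphisms of $\mathscr{D}_{p,q}$ preserving setwise the punctures and the marked points, up to isotopy fixing pointwise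 the punctures and the marked points. An element of $\mathcal{B}_{p,q}$ is drawn as $p$ strands (traced by the punctures) and $q$ wires (traced by the marked points) in the cylinder $\mathscr{D}_{p,q}\times[0,1]$, by means of an isotopy of the disc from the identity to a representative. A braided strand diagram over $(\mathcal{P},w)$ is a triple $(A,\beta,B)$ where $A,B$ are $(\mathcal{P},w)$-forests with the same number $p$ of $\mathcal{P}$-interior vertices and the same number $q$ of $\mathcal{P}$-leaves, and where $\beta\in\mathcal{B}_{p,q}$ induces a label-preserving bijection from the $\mathcal{P}$-leaves of $A$ to those of $B$; here the punctures (resp. the marked points) are indexed from left to right by the $\mathcal{P}$-interior vertices (resp. the $\mathcal{P}$-leaves) of $A$ and of $B$. A strand $\mu$ is parallel to a wire $\nu$ if, in the cylinder minus the strands other than $\mu$, the wire $\nu$ is homotopic relative to its endpoints to the arc obtained by following the straight line from the start of $\nu$ to the start of $\mu$ in $\mathscr{D}_{p,q}\times\{0\}$, then $\mu$, then the straight line from the end of $\mu$ to the end of $\nu$ in $\mathscr{D}_{p,q}\times\{1\}$. A dipole of $(A,\beta,B)$ is a pair of $\mathcal{P}$-interior vertices $a\in A$, $b\in B$ that have children,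 such that all the children of $a$ and $b$ are $\mathcal{P}$-leaves, the wires starting from the children of $a$ end, from left to right, at the children of $b$, and the strand starting from $a$ ends at $b$ and is parallel to all these wires. Reducing the dipole means removing the children of $a$ and $b$ and replacing the strand connecting $a$ and $b$ and the wires connecting their children with a single wire. A diagram is reduced if it contains no dipole. Two diagrams are equipotent, written $\equiv$, if they are joined by a finite sequence of diagrams in which, of any two consecutive ones, one is obtained from the other by reducing a dipole. (1) Every braided strand diagram over $(\mathcal{P},w)$ is equipotent to a unique reduced diagram (its reduced form). (2) Assume that no vertex of $T(\mathcal{P},w)$ other than a root is a leaf of $T(\mathcal{P},w)$. Then, for all diagrams $\Delta_1,\Delta_2$ over $(\mathcal{P},w)$, there exist forests $A,B,C$ and braids $\beta_1,\beta_2$ such that $\Delta_1\equiv(A,\beta_1,B)$ and $\Delta_2\equiv(B,\beta_2,C)$, and the reduced form $\Delta_1\circ\Delta_2$ of $(A,\beta_2\beta_1,C)$ does not depend on these choices. Moreover, the concatenation $\circ$ is a group law on the set of reduced braided strand diagrams over $(\mathcal{P},w)$; the resulting group is the Chambord group $C(\mathcal{P},w)$. -/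

import Mathlib

namespace Chambord

/-! ### Arboreal semigroup presentations, the labelled planar forest `T(P, w)`, and forests -/

/-- A semigroup presentation over the alphabet `S`: a collection of relations `u = v` between
non-empty words. -/
structure SemigroupPresentation (S : Type*) where
  rels : Set (List S × List S)
  left_ne_nil : ∀ r ∈ rels, r.1 ≠ []
  right_ne_nil : ∀ r ∈ rels, r.2 ≠ []

variable {S : Type*}

/-- The left-hand sides are letters, and two relations have the same left-hand side exactly when
they have the same right-hand side. -/
def SemigroupPresentation.IsArboreal (P : SemigroupPresentation S) : Prop :=
  (∀ r ∈ P.rels, r.1.length = 1) ∧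
    ∀ r₁ ∈ P.rels, ∀ r₂ ∈ P.rels, r₁.1 = r₂.1 ↔ r₁.2 = r₂.2

/-- `IsVertex P w x s`: the address `x` is a vertex of `T(P, w)` and it is labelled by `s`.
The address `[i]` is the `i`-th root, labelled by the `i`-th letter of `w`. If `x` is labelled by
`u` and `u = v` is a relation, then `x ++ [i]` is the `i`-th child of `x`, labelled by the `i`-th
letter of `v` (indices start at `0`, from left to right). -/
inductive IsVertex (P : SemigroupPresentation S) (w : List S) : List ℕ → S → Prop
  | root (i : ℕ) (s : S) (h : w[i]? = some s) : IsVertex P w [i] s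
  | child (x : List ℕ) (u : S) (v : List S) (i : ℕ) (s : S) (hx : IsVertex P w x u)
      (huv : ([u], v) ∈ P.rels) (h : v[i]? = some s) : IsVertex P w (x ++ [i]) s

/-- The address `x` is a vertex of `T(P, w)`. -/
def HasVertex (P : SemigroupPresentation S) (w : List S) (x : List ℕ) : Prop :=
  ∃ s, IsVertex P w x s

/-- No vertex of `T(P, w)` other than a root is a leaf of `T(P, w)`
(the roots are the addresses of length one). -/
def NoNonRootLeaf (P : SemigroupPresentation S) (w : List S) : Prop :=
  ∀ x, HasVertex P w x → 2 ≤ x.length → ∃ i, HasVertex P w (x ++ [i])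

/-- The (strict) left-right order on addresses: `leftOf x y` says that `x` lies to the left of `y`.
Vertices in different subtrees are ordered like these subtrees; a vertex lies to the right of its
leftmost child and of the descendants of the latter, and to the left of its other descendants. -/
def leftOf : List ℕ → List ℕ → Prop
  | [], [] => False
  | [], j :: _ => j ≠ 0
  | i :: _, [] => i = 0
  | i :: x, j :: y => i < j ∨ (i = j ∧ leftOf x y)

open Classical in
/-- The number of elements of `F` that lie to the left of `x`. -/
noncomputable def rank (F : Finset (List ℕ)) (x : List ℕ) : ℕ :=
  (F.filter fun y => leftOf y x).card

/-- A `(P, w)`-forest, as a finite rooted subforest of `T(P, w)` that contains all the roots and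
that contains all the children of a vertex as soon as it contains one of them. -/
@[ext]
structure Forest (P : SemigroupPresentation S) (w : List S) where
  verts : Finset (List ℕ)
  hasVertex : ∀ x ∈ verts, HasVertex P w x
  roots : ∀ i, HasVertex P w [i] → [i] ∈ verts
  parent : ∀ x i, x ≠ [] → x ++ [i] ∈ verts → x ∈ verts
  siblings : ∀ x i j, x ++ [i] ∈ verts → HasVertex P w (x ++ [j]) → x ++ [j] ∈ verts

namespace Forest

variable {P : SemigroupPresentation S} {w : List S}

open Classical in
/-- The `P`-leaves: the vertices that are leaves in the forest but not in `T(P, w)`. -/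
noncomputable def pLeaves (A : Forest P w) : Finset (List ℕ) :=
  A.verts.filter fun x => (∀ i, x ++ [i] ∉ A.verts) ∧ ∃ i, HasVertex P w (x ++ [i])

/-- The `P`-interior vertices: the vertices that are not `P`-leaves. -/
noncomputable def interior (A : Forest P w) : Finset (List ℕ) :=
  A.verts \ A.pLeaves

end Forest

/-! ### Punctured discs and the groups `B_{p,q}` -/

/-- The closed disc, modelled by the square `[0,1] × [0,1]`. -/
abbrev Disc : Type := unitInterval × unitInterval

/-- The boundary of the disc. -/
def boundary : Set Disc := {z | z.1 = 0 ∨ z.1 = 1 ∨ z.2 = 0 ∨ z.2 = 1}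

/-- The number `(r + 1) / (n + 1)`, which lies in `[0,1]` whenever `r < n` (and is truncated to
`[0,1]` otherwise): the `r`-th of `n` points that are regularly spaced in the open interval. -/
noncomputable def gridPoint (n r : ℕ) : unitInterval :=
  Set.projIcc (0 : ℝ) 1 zero_le_one (((r : ℝ) + 1) / ((n : ℝ) + 1))

/-- The `r`-th puncture, `r = 0, …, p - 1`, from left to right on the horizontal middle line. -/
noncomputable def puncture (p r : ℕ) : Disc := (gridPoint p r, ⟨1 / 2, by norm_num, by norm_num⟩)

/-- The `r`-th marked point, `r = 0, …, q - 1`, from left to right on the bottom side. -/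
noncomputable def mark (q r : ℕ) : Disc := (gridPoint q r, 0)

/-- The set of the `p` punctures. -/
def punctures (p : ℕ) : Set Disc := {z | ∃ r < p, z = puncture p r}

/-- The set of the `q` marked points. -/
def marks (q : ℕ) : Set Disc := {z | ∃ r < q, z = mark q r}

/-- An isotopy of the disc from the identity to `f`, through homeomorphisms of the disc, that
fixes each point of `Z`. (That homeomorphisms of the disc preserve its boundary, which is
automatic by invariance of domain, is recorded as a part of the data.) -/
structure Isotopy (Z : Set Disc) (f : Disc ≃ₜ Disc) where
  toFun : unitInterval → (Disc ≃ₜ Disc)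
  continuous_uncurry : Continuous fun x : unitInterval × Disc => toFun x.1 x.2
  map_zero : toFun 0 = 1
  map_one : toFun 1 = f
  boundary_iff : ∀ t z, toFun t z ∈ boundary ↔ z ∈ boundary
  fixes : ∀ t, ∀ z ∈ Z, toFun t z = z

namespace Isotopy

variable {Z : Set Disc} {f g : Disc ≃ₜ Disc}

/-- The constant isotopy. -/
def refl (Z : Set Disc) : Isotopy Z 1 where
  toFun _ := 1
  continuous_uncurry := continuous_snd
  map_zero := rfl
  map_one := rfl
  boundary_iff _ _ := Iff.rfl
  fixes _ _ _ := rfl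

/-- The product of two isotopies. -/
def mul (F : Isotopy Z f) (G : Isotopy Z g) : Isotopy Z (f * g) where
  toFun t := F.toFun t * G.toFun t
  continuous_uncurry :=
    F.continuous_uncurry.comp (continuous_fst.prodMk G.continuous_uncurry)
  map_zero := by rw [F.map_zero, G.map_zero, one_mul]
  map_one := by rw [F.map_one, G.map_one]
  boundary_iff t z := (F.boundary_iff t _).trans (G.boundary_iff t z)
  fixes t z hz := by
    change F.toFun t (G.toFun t z) = z
    rw [G.fixes t z hz, F.fixes t z hz]

/-- The isotopy `t ↦ f⁻¹ F_{1-t}` from the identity to `f⁻¹`. -/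
def inv (F : Isotopy Z f) : Isotopy Z f⁻¹ where
  toFun t := f⁻¹ * F.toFun (unitInterval.symm t)
  continuous_uncurry :=
    (f⁻¹).continuous.comp (F.continuous_uncurry.comp
      ((unitInterval.continuous_symm.comp continuous_fst).prodMk continuous_snd))
  map_zero := by rw [unitInterval.symm_zero, F.map_one, inv_mul_cancel]
  map_one := by rw [unitInterval.symm_one, F.map_zero, mul_one]
  boundary_iff t z := by
    have h1 := F.boundary_iff 1 (f.symm (F.toFun (unitInterval.symm t) z))
    rw [F.map_one, f.apply_symm_apply] at h1
    exact h1.symm.trans (F.boundary_iff _ z)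
  fixes t z hz := by
    change f.symm (F.toFun (unitInterval.symm t) z) = z
    rw [F.fixes _ z hz]
    have h1 := F.fixes 1 z hz
    rw [F.map_one] at h1
    rw [Homeomorph.symm_apply_eq, h1]

/-- Conjugating an isotopy that fixes `Z` by a homeomorphism `g` of the disc that preserves
`Z` and the boundary. -/
def conj (F : Isotopy Z f) (g : Disc ≃ₜ Disc) (hb : ∀ z, g z ∈ boundary ↔ z ∈ boundary)
    (hZ : ∀ z, g z ∈ Z ↔ z ∈ Z) : Isotopy Z (g * f * g⁻¹) where
  toFun t := g * F.toFun t * g⁻¹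
  continuous_uncurry :=
    g.continuous.comp (F.continuous_uncurry.comp
      (continuous_fst.prodMk ((g⁻¹).continuous.comp continuous_snd)))
  map_zero := by rw [F.map_zero, mul_one, mul_inv_cancel]
  map_one := by rw [F.map_one]
  boundary_iff t z := by
    have h1 := hb (g.symm z)
    rw [g.apply_symm_apply] at h1
    exact (hb _).trans ((F.boundary_iff t _).trans h1.symm)
  fixes t z hz := by
    change g (F.toFun t (g.symm z)) = z
    have h1 : g.symm z ∈ Z := by rw [← hZ, g.apply_symm_apply]; exact hz
    rw [F.fixes t _ h1, g.apply_symm_apply]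

end Isotopy

/-- The orientation-preserving homeomorphisms of the disc that preserve setwise the punctures and
the marked points of `D_{p,q}`. A homeomorphism of the closed disc preserves the orientation if
and only if it is isotopic to the identity through homeomorphisms of the disc
(without any condition on punctures and marked points); this is taken as the definition. -/
def homeoGroup (p q : ℕ) : Subgroup (Disc ≃ₜ Disc) where
  carrier := {f | Nonempty (Isotopy ∅ f) ∧ (∀ z, f z ∈ punctures p ↔ z ∈ punctures p) ∧
    ∀ z, f z ∈ marks q ↔ z ∈ marks q}
  mul_mem' := by
    rintro f g ⟨⟨F⟩, hf, hf'⟩ ⟨⟨G⟩, hg, hg'⟩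
    exact ⟨⟨F.mul G⟩, fun z => (hf _).trans (hg z), fun z => (hf' _).trans (hg' z)⟩
  one_mem' := ⟨⟨Isotopy.refl _⟩, fun _ => Iff.rfl, fun _ => Iff.rfl⟩
  inv_mem' := by
    rintro f ⟨⟨F⟩, hf, hf'⟩
    refine ⟨⟨F.inv⟩, fun z => ?_, fun z => ?_⟩
    · have h := hf (f.symm z)
      rw [f.apply_symm_apply] at h
      exact h.symm
    · have h := hf' (f.symm z)
      rw [f.apply_symm_apply] at h
      exact h.symm

/-- The homeomorphisms that are isotopic to the identity by an isotopy fixing pointwise the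
punctures and the marked points of `D_{p,q}`. -/
def isotopyTrivial (p q : ℕ) : Subgroup (homeoGroup p q) where
  carrier := {f | Nonempty (Isotopy (punctures p ∪ marks q) f.1)}
  mul_mem' := by
    rintro f g ⟨F⟩ ⟨G⟩
    exact ⟨F.mul G⟩
  one_mem' := ⟨Isotopy.refl _⟩
  inv_mem' := by
    rintro f ⟨F⟩
    exact ⟨F.inv⟩

instance isotopyTrivial_normal (p q : ℕ) : (isotopyTrivial p q).Normal where
  conj_mem := by
    rintro f ⟨F⟩ ⟨g, ⟨G⟩, hp, hq⟩
    refine ⟨F.conj g (fun z => ?_) (fun z => ?_)⟩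
    · have h := G.boundary_iff 1 z
      rwa [G.map_one] at h
    · exact or_congr (hp z) (hq z)

/-- The group `B_{p,q}` of the orientation-preserving homeomorphisms of `D_{p,q}` that preserve
setwise the punctures and the marked points, up to isotopy fixing pointwise the punctures and the
marked points. -/
abbrev BraidGroup (p q : ℕ) : Type := homeoGroup p q ⧸ isotopyTrivial p q

/-- The mapping class of a homeomorphism. -/
abbrev braidClass {p q : ℕ} (f : homeoGroup p q) : BraidGroup p q := QuotientGroup.mk f

/-! ### Strands and wires in the cylinder -/

/-- The closed cylinder over the disc; the second coordinate is the level. -/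
abbrev Cylinder : Type := Disc × unitInterval

/-- The point `(1 - t) x + t y`. -/
def interpolate (x y t : unitInterval) : unitInterval :=
  ⟨(1 - (t : ℝ)) * x + (t : ℝ) * y, by
    have hx := x.2; have hy := y.2; have ht := t.2
    exact (convex_Icc (0 : ℝ) 1) hx hy (sub_nonneg.2 ht.2) ht.1 (by ring)⟩

/-- The straight line from `x` to `y` in the disc at the level `s` of the cylinder. -/
def levelSegment (x y : Disc) (s : unitInterval) : Path ((x, s) : Cylinder) (y, s) where
  toFun t := ((interpolate x.1 y.1 t, interpolate x.2 y.2 t), s)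
  continuous_toFun := by
    unfold interpolate
    fun_prop
  source' := by simp [interpolate]
  target' := by simp [interpolate]

/-- The arc that is traced in the cylinder by the point `z` under an isotopy from the identity
to `f`: the strand, or the wire, that starts at `z`. -/
def Isotopy.trace {Z : Set Disc} {f : Disc ≃ₜ Disc} (F : Isotopy Z f) (z : Disc) :
    Path ((z, 0) : Cylinder) (f z, 1) where
  toFun t := (F.toFun t z, t)
  continuous_toFun :=
    (F.continuous_uncurry.comp (continuous_id.prodMk continuous_const)).prodMk continuous_id
  source' := by rw [F.map_zero]; rfl
  target' := by rw [F.map_one]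

/-- In the cylinder with its `p` strands drawn by means of an isotopy `F` from the identity to `f`,
the strand starting from the puncture `a` is parallel to the wire starting from the marked point
`m`: the wire is homotopic, relative to its endpoints and in the complement of the strands distinct
from the strand of `a`, to the arc that follows the straight line from `m` to `a` at level `0`,
then the strand, and then the straight line from the end of the strand to the end of the wire at
level `1`. -/
def IsParallel (p : ℕ) {f : Disc ≃ₜ Disc} (F : Isotopy ∅ f) (a m : Disc) : Prop :=
  ∃ K : Path.Homotopy (F.trace m)
      (((levelSegment m a 0).trans (F.trace a)).trans (levelSegment (f a) (f m) 1)),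
    ∀ x, ∀ c ∈ punctures p, c ≠ a → ∀ t, K x ≠ F.trace c t

/-! ### Braided strand diagrams -/

section Diagrams

variable {P : SemigroupPresentation S} {w : List S}

/-- The puncture of the disc that is indexed by the `P`-interior vertex `x` of `A`. -/
noncomputable def Forest.puncture (A : Forest P w) (x : List ℕ) : Disc :=
  Chambord.puncture A.interior.card (rank A.interior x)

/-- The marked point of the disc that is indexed by the `P`-leaf `x` of `A`. -/
noncomputable def Forest.mark (A : Forest P w) (x : List ℕ) : Disc :=
  Chambord.mark A.pLeaves.card (rank A.pLeaves x)

/-- `(A, β, B)` is a braided strand diagram over `(P, w)`: the forests `A`, `B` have `p`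
`P`-interior vertices and `q` `P`-leaves each, and the bijection from the `P`-leaves of `A` to
those of `B` induced by `β` preserves the labels. -/
structure IsDiagram {p q : ℕ} (A : Forest P w) (β : BraidGroup p q) (B : Forest P w) : Prop where
  interior_top : A.interior.card = p
  interior_bot : B.interior.card = p
  pLeaves_top : A.pLeaves.card = q
  pLeaves_bot : B.pLeaves.card = q
  label : ∀ f : homeoGroup p q, braidClass f = β → ∀ x ∈ A.pLeaves, ∀ y ∈ B.pLeaves,
    f.1 (A.mark x) = B.mark y → ∀ s, IsVertex P w x s ↔ IsVertex P w y s

/-- The braided strand diagrams over `(P, w)`. -/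
structure Diagram (P : SemigroupPresentation S) (w : List S) where
  {p q : ℕ}
  top : Forest P w
  braid : BraidGroup p q
  bot : Forest P w
  isDiagram : IsDiagram top braid bot

/-- The `P`-interior vertices `a` of the top forest and `b` of the bottom forest, which are not
leaves, form a dipole: their children are `P`-leaves, the wires starting from the children of `a`
end, from left to right, at the children of `b`, and the strand starting from `a` ends at `b` and
is parallel to all these wires. Strands and wires are drawn by means of a representative `f` of the
braid and of an isotopy `F` from the identity to `f`. -/
structure IsDipole (Δ : Diagram P w) (a b : List ℕ) : Prop where
  top_mem : a ∈ Δ.top.interior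
  bot_mem : b ∈ Δ.bot.interior
  exists_child : ∃ i, HasVertex P w (a ++ [i])
  top_children : ∀ i, HasVertex P w (a ++ [i]) → a ++ [i] ∈ Δ.top.pLeaves
  bot_children : ∀ i, HasVertex P w (b ++ [i]) → b ++ [i] ∈ Δ.bot.pLeaves
  child_iff : ∀ i, HasVertex P w (a ++ [i]) ↔ HasVertex P w (b ++ [i])
  parallel : ∃ f : homeoGroup Δ.p Δ.q, braidClass f = Δ.braid ∧ ∃ F : Isotopy ∅ f.1,
    f.1 (Δ.top.puncture a) = Δ.bot.puncture b ∧
    ∀ i, HasVertex P w (a ++ [i]) →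
      f.1 (Δ.top.mark (a ++ [i])) = Δ.bot.mark (b ++ [i]) ∧
      IsParallel Δ.p F (Δ.top.puncture a) (Δ.top.mark (a ++ [i]))

/-- A homeomorphism of the disc that slides the points horizontally, without changing their order
on horizontal lines. -/
structure IsSlide (h : Disc ≃ₜ Disc) : Prop where
  height : ∀ z, (h z).2 = z.2
  mono : ∀ z z', z.2 = z'.2 → z.1 < z'.1 → (h z).1 < (h z').1

/-- Let `A'` be obtained from `A` by removing the children of `a`. The homeomorphism `h` slides
the punctures of `A` distinct from the one of `a` to the corresponding punctures of `A'`, the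
marked points of the common `P`-leaves of `A` and `A'` to the corresponding marked points of `A'`,
and the marked point of the leftmost child of `a` to the marked point of `a`. Up to isotopy, there
is exactly one such slide. It renumbers the punctures and the marked points that are left when the
puncture of `a`, together with the marked points of the children of `a` other than the first one,
is forgotten. -/
structure IsRenumbering (A A' : Forest P w) (a : List ℕ) (h : Disc ≃ₜ Disc) : Prop where
  isSlide : IsSlide h
  puncture_eq : ∀ x ∈ A.interior, x ≠ a → h (A.puncture x) = A'.puncture x
  mark_eq : ∀ x ∈ A.pLeaves, (∀ i, x ≠ a ++ [i]) → h (A.mark x) = A'.mark x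
  mark_child : h (A.mark (a ++ [0])) = A'.mark a

/-- The diagram `Δ'` is obtained from `Δ` by reducing a dipole `a`, `b`: the children of `a` and
`b` are removed, and the strand connecting `a` to `b` and the wires connecting their children are
replaced with a single wire. This means that the strand and all but the first of these (parallel)
wires are forgotten, the remaining one being now the wire that connects `a` to `b`. -/
def Reduces (Δ Δ' : Diagram P w) : Prop :=
  ∃ a b, IsDipole Δ a b ∧
    (∀ x, x ∈ Δ'.top.verts ↔ x ∈ Δ.top.verts ∧ ∀ i, x ≠ a ++ [i]) ∧
    (∀ x, x ∈ Δ'.bot.verts ↔ x ∈ Δ.bot.verts ∧ ∀ i, x ≠ b ++ [i]) ∧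
    ∃ (f : homeoGroup Δ.p Δ.q) (f' : homeoGroup Δ'.p Δ'.q) (h k : Disc ≃ₜ Disc),
      braidClass f = Δ.braid ∧ braidClass f' = Δ'.braid ∧
      IsRenumbering Δ.top Δ'.top a h ∧ IsRenumbering Δ.bot Δ'.bot b k ∧
      ∀ z, f'.1 (h z) = k (f.1 z)

/-- A diagram is reduced if it does not contain any dipole. -/
def IsReduced (Δ : Diagram P w) : Prop := ∀ a b, ¬ IsDipole Δ a b

/-- Two diagrams are equipotent if they are connected by a finite sequence of diagrams in which,
of any two consecutive ones, one is obtained from the other by reducing a dipole. -/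
def Equipotent : Diagram P w → Diagram P w → Prop :=
  Relation.ReflTransGen fun Δ Δ' => Reduces Δ Δ' ∨ Reduces Δ' Δ

/-- `Δ` is a concatenation of `Δ₁` and `Δ₂`: for some `A`, `B`, `C` and `β₁`, `β₂` such that
`Δ₁ ≡ (A, β₁, B)` and `Δ₂ ≡ (B, β₂, C)`, it is a reduced form of `(A, β₂ β₁, C)`. -/
def IsConcatenation (Δ₁ Δ₂ Δ : Diagram P w) : Prop :=
  ∃ (p q : ℕ) (A B C : Forest P w) (β₁ β₂ : BraidGroup p q) (h₁ : IsDiagram A β₁ B)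
    (h₂ : IsDiagram B β₂ C) (h : IsDiagram A (β₂ * β₁) C),
    Equipotent Δ₁ ⟨A, β₁, B, h₁⟩ ∧ Equipotent Δ₂ ⟨B, β₂, C, h₂⟩ ∧
      Equipotent ⟨A, β₂ * β₁, C, h⟩ Δ ∧ IsReduced Δ

end Diagrams

end Chambord

namespace Chambord

open unitInterval Topology

/-! ### Path homotopies inside a set -/

section Homotopies

variable {X Y : Type*} [TopologicalSpace X] [TopologicalSpace Y]

/-- Two paths are homotopic, relative to their endpoints, by a homotopy with values in `U`. -/
def HomotopicIn (U : Set X) (γ δ : I → X) : Prop :=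
  ∃ K : I × I → X, Continuous K ∧ (∀ t, K (0, t) = γ t) ∧ (∀ t, K (1, t) = δ t) ∧
    (∀ s, K (s, 0) = γ 0) ∧ (∀ s, K (s, 1) = γ 1) ∧ ∀ z, K z ∈ U

namespace HomotopicIn

variable {U V : Set X} {γ δ ε : I → X}

theorem refl (hγ : Continuous γ) (h : ∀ t, γ t ∈ U) : HomotopicIn U γ γ :=
  ⟨fun z => γ z.2, hγ.comp continuous_snd, fun _ => rfl, fun _ => rfl, fun _ => rfl, fun _ => rfl,
    fun z => h z.2⟩

theorem mono (h : HomotopicIn U γ δ) (hUV : U ⊆ V) : HomotopicIn V γ δ := by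
  obtain ⟨K, h1, h2, h3, h4, h5, h6⟩ := h
  exact ⟨K, h1, h2, h3, h4, h5, fun z => hUV (h6 z)⟩

theorem map (h : HomotopicIn U γ δ) {f : X → Y} (hf : Continuous f) {V : Set Y}
    (hUV : ∀ z ∈ U, f z ∈ V) : HomotopicIn V (f ∘ γ) (f ∘ δ) := by
  obtain ⟨K, h1, h2, h3, h4, h5, h6⟩ := h
  exact ⟨f ∘ K, hf.comp h1, fun t => congrArg f (h2 t), fun t => congrArg f (h3 t),
    fun s => congrArg f (h4 s), fun s => congrArg f (h5 s), fun z => hUV _ (h6 z)⟩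

theorem left_mem (h : HomotopicIn U γ δ) (t : I) : γ t ∈ U := by
  obtain ⟨K, h1, h2, h3, h4, h5, h6⟩ := h
  exact h2 t ▸ h6 _

theorem right_mem (h : HomotopicIn U γ δ) (t : I) : δ t ∈ U := by
  obtain ⟨K, h1, h2, h3, h4, h5, h6⟩ := h
  exact h3 t ▸ h6 _

theorem continuous_left (h : HomotopicIn U γ δ) : Continuous γ := by
  obtain ⟨K, h1, h2, h3, h4, h5, h6⟩ := h
  have : γ = fun t => K (0, t) := funext fun t => (h2 t).symm
  rw [this]; exact h1.comp (by fun_prop)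

theorem continuous_right (h : HomotopicIn U γ δ) : Continuous δ := by
  obtain ⟨K, h1, h2, h3, h4, h5, h6⟩ := h
  have : δ = fun t => K (1, t) := funext fun t => (h3 t).symm
  rw [this]; exact h1.comp (by fun_prop)

theorem zero_eq (h : HomotopicIn U γ δ) : γ 0 = δ 0 := by
  obtain ⟨K, h1, h2, h3, h4, h5, h6⟩ := h
  rw [← h4 1, h3]

theorem one_eq (h : HomotopicIn U γ δ) : γ 1 = δ 1 := by
  obtain ⟨K, h1, h2, h3, h4, h5, h6⟩ := h
  rw [← h5 1, h3]

theorem symm (h : HomotopicIn U γ δ) : HomotopicIn U δ γ := by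
  have h0 := h.zero_eq
  have h1' := h.one_eq
  obtain ⟨K, h1, h2, h3, h4, h5, h6⟩ := h
  refine ⟨fun z => K (σ z.1, z.2), h1.comp (by fun_prop), fun t => ?_, fun t => ?_, fun s => ?_,
    fun s => ?_, fun z => h6 _⟩
  · simpa using h3 t
  · simpa using h2 t
  · exact (h4 _).trans h0
  · exact (h5 _).trans h1'

/-- A path with values in a set, as a path in the subtype. -/
def restrictPath {x y : X} (γ : Path x y) (h : ∀ t, γ t ∈ U) :
    Path (⟨x, γ.source ▸ h 0⟩ : U) ⟨y, γ.target ▸ h 1⟩ where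
  toFun t := ⟨γ t, h t⟩
  continuous_toFun := by fun_prop
  source' := by simp
  target' := by simp

theorem restrictPath_trans {x y z : X} (γ : Path x y) (δ : Path y z) (h : ∀ t, γ t ∈ U)
    (h' : ∀ t, δ t ∈ U) (h'' : ∀ t, (γ.trans δ) t ∈ U) :
    restrictPath (γ.trans δ) h'' = (restrictPath γ h).trans (restrictPath δ h') := by
  ext t
  simp only [restrictPath, Path.trans_apply, Path.coe_mk_mk]
  split_ifs <;> rfl

theorem iff_restrictPath {x y : X} (γ δ : Path x y) (h : ∀ t, γ t ∈ U) (h' : ∀ t, δ t ∈ U) :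
    HomotopicIn U γ δ ↔ (restrictPath γ h).Homotopic (restrictPath δ h') := by
  constructor
  · rintro ⟨K, h1, h2, h3, h4, h5, h6⟩
    refine ⟨⟨⟨⟨fun z => ⟨K z, h6 z⟩, by fun_prop⟩, fun t => ?_, fun t => ?_⟩, ?_⟩⟩
    · exact Subtype.ext (h2 t)
    · exact Subtype.ext (h3 t)
    · rintro s t (rfl | ht)
      · exact Subtype.ext (h4 s)
      · rw [Set.mem_singleton_iff.1 ht]; exact Subtype.ext (h5 s)
  · rintro ⟨K⟩
    refine ⟨fun z => (K z : X), by fun_prop, fun t => ?_, fun t => ?_, fun s => ?_, fun s => ?_,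
      fun z => (K z).2⟩
    · exact congrArg Subtype.val (K.apply_zero t)
    · exact congrArg Subtype.val (K.apply_one t)
    · exact (congrArg Subtype.val (K.source s)).trans γ.source.symm
    · exact (congrArg Subtype.val (K.target s)).trans γ.target.symm

theorem trans (h : HomotopicIn U γ δ) (h' : HomotopicIn U δ ε) : HomotopicIn U γ ε := by
  let γ' : Path (γ 0) (γ 1) := ⟨⟨γ, h.continuous_left⟩, rfl, rfl⟩
  let δ' : Path (γ 0) (γ 1) := ⟨⟨δ, h.continuous_right⟩, h.zero_eq.symm, h.one_eq.symm⟩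
  let ε' : Path (γ 0) (γ 1) := ⟨⟨ε, h'.continuous_right⟩, (h.zero_eq.trans h'.zero_eq).symm,
    (h.one_eq.trans h'.one_eq).symm⟩
  have a := (iff_restrictPath γ' δ' h.left_mem h.right_mem).1 h
  have b := (iff_restrictPath δ' ε' h'.left_mem h'.right_mem).1 h'
  exact (iff_restrictPath γ' ε' h.left_mem h'.right_mem).2 (a.trans b)

theorem hcomp {x y z : X} {γ γ' : Path x y} {δ δ' : Path y z} (h : HomotopicIn U γ γ')
    (h' : HomotopicIn U δ δ') : HomotopicIn U (γ.trans δ) (γ'.trans δ') := by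
  have a := (iff_restrictPath _ _ h.left_mem h.right_mem).1 h
  have b := (iff_restrictPath _ _ h'.left_mem h'.right_mem).1 h'
  have c : ∀ t, (γ.trans δ) t ∈ U := by
    intro t; rw [Path.trans_apply]; split_ifs
    · exact h.left_mem _
    · exact h'.left_mem _
  have d : ∀ t, (γ'.trans δ') t ∈ U := by
    intro t; rw [Path.trans_apply]; split_ifs
    · exact h.right_mem _
    · exact h'.right_mem _
  rw [iff_restrictPath _ _ c d, restrictPath_trans _ _ h.left_mem h'.left_mem,
    restrictPath_trans _ _ h.right_mem h'.right_mem]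
  exact a.hcomp b

theorem trans_mem {x y z : X} {γ : Path x y} {δ : Path y z} (h : ∀ t, γ t ∈ U)
    (h' : ∀ t, δ t ∈ U) (t : I) : (γ.trans δ) t ∈ U := by
  rw [Path.trans_apply]; split_ifs
  · exact h _
  · exact h' _

open Path in
/-- If `γ * δ` is homotopic to `γ`, then the loop `δ` is null-homotopic. -/
theorem refl_of_trans {x y : X} {γ : Path x y} {δ : Path y y} (hγ : ∀ t, γ t ∈ U)
    (hδ : ∀ t, δ t ∈ U) (h : HomotopicIn U (γ.trans δ) γ) :
    HomotopicIn U (Path.refl y) δ := by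
  have hy : ∀ t, Path.refl y t ∈ U := fun t => by simpa using γ.target ▸ hγ 1
  rw [iff_restrictPath _ _ (trans_mem hγ hδ) hγ, restrictPath_trans _ _ hγ hδ, ← Homotopic.Quotient.eq,
    Homotopic.Quotient.mk_trans] at h
  rw [iff_restrictPath _ _ hy hδ, ← Homotopic.Quotient.eq]
  have h2 := congrArg (fun q => (Homotopic.Quotient.symm (Homotopic.Quotient.mk (restrictPath γ hγ))).trans q) h
  simp only [← Homotopic.Quotient.trans_assoc, Homotopic.Quotient.symm_trans, Homotopic.Quotient.refl_trans] at h2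
  rw [h2]; rfl

open Path in
/-- A loop `(γ * const) * δ` is null-homotopic if and only if `γ` is homotopic to the reverse
of `δ`. -/
theorem refl_trans_refl_trans_iff {x y : X} {γ : Path x y} {δ : Path y x} (hγ : ∀ t, γ t ∈ U)
    (hδ : ∀ t, δ t ∈ U) : HomotopicIn U (Path.refl x) ((γ.trans (Path.refl y)).trans δ) ↔
      HomotopicIn U γ δ.symm := by
  have hx : ∀ t, Path.refl x t ∈ U := fun t => by simpa using γ.source ▸ hγ 0
  have hy : ∀ t, Path.refl y t ∈ U := fun t => by simpa using γ.target ▸ hγ 1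
  have hs : ∀ t, δ.symm t ∈ U := fun t => hδ _
  rw [iff_restrictPath _ _ hx (trans_mem (trans_mem hγ hy) hδ), iff_restrictPath _ _ hγ hs,
    restrictPath_trans _ _ (trans_mem hγ hy) hδ, restrictPath_trans _ _ hγ hy, ← Homotopic.Quotient.eq,
    ← Homotopic.Quotient.eq, Homotopic.Quotient.mk_trans, Homotopic.Quotient.mk_trans]
  have e1 : Homotopic.Quotient.mk (restrictPath (Path.refl y) hy) = Homotopic.Quotient.refl _ := rfl
  have e2 : Homotopic.Quotient.mk (restrictPath (Path.refl x) hx) = Homotopic.Quotient.refl _ := rfl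
  have e3 : Homotopic.Quotient.mk (restrictPath δ.symm hs) =
    Homotopic.Quotient.symm (Homotopic.Quotient.mk (restrictPath δ hδ)) := rfl
  rw [e1, e2, e3, Homotopic.Quotient.trans_refl]
  constructor
  · intro h
    have h2 := congrArg (fun q => q.trans (Homotopic.Quotient.symm (Homotopic.Quotient.mk (restrictPath δ hδ)))) h
    simp only [Homotopic.Quotient.trans_assoc, Homotopic.Quotient.trans_symm, Homotopic.Quotient.trans_refl,
      Homotopic.Quotient.refl_trans] at h2
    exact h2.symm
  · intro h
    rw [h, Homotopic.Quotient.symm_trans]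

theorem refl_trans {x y : X} {γ : Path x y} (h : ∀ t, γ t ∈ U) :
    HomotopicIn U ((Path.refl x).trans γ) γ := by
  have hy : ∀ t, Path.refl x t ∈ U := fun t => by simpa using γ.source ▸ h 0
  rw [iff_restrictPath _ _ (trans_mem hy h) h, restrictPath_trans _ _ hy h]
  exact ⟨Path.Homotopy.reflTrans _⟩

end HomotopicIn

end Homotopies

/-! ### Straight segments in the disc -/

@[fun_prop]
theorem continuous_interpolate {X : Type*} [TopologicalSpace X] {f g h : X → I}
    (hf : Continuous f) (hg : Continuous g) (hh : Continuous h) :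
    Continuous fun x => interpolate (f x) (g x) (h x) := by
  unfold interpolate
  fun_prop

@[simp] theorem interpolate_zero (x y : I) : interpolate x y 0 = x := by simp [interpolate]
@[simp] theorem interpolate_one (x y : I) : interpolate x y 1 = y := by simp [interpolate]
@[simp] theorem interpolate_self (x t : I) : interpolate x x t = x := by
  ext; simp [interpolate]; ring


/-- The point `(1 - t) x + t y` of the disc. -/
def lerp (x y : Disc) (t : I) : Disc := (interpolate x.1 y.1 t, interpolate x.2 y.2 t)

@[fun_prop]
theorem continuous_lerp {X : Type*} [TopologicalSpace X] {f g : X → Disc} {h : X → I}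
    (hf : Continuous f) (hg : Continuous g) (hh : Continuous h) :
    Continuous fun x => lerp (f x) (g x) (h x) := by
  unfold lerp
  fun_prop

@[simp] theorem lerp_zero (x y : Disc) : lerp x y 0 = x := by simp [lerp]
@[simp] theorem lerp_one (x y : Disc) : lerp x y 1 = y := by simp [lerp]
@[simp] theorem lerp_self (x : Disc) (t : I) : lerp x x t = x := by simp [lerp]

/-- The straight segment. -/
def seg (x y : Disc) : Path x y where
  toFun t := lerp x y t
  continuous_toFun := by fun_prop
  source' := by simp
  target' := by simp

theorem seg_apply (x y : Disc) (t : I) : seg x y t = lerp x y t := rfl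

theorem seg_symm (x y : Disc) : (seg x y).symm = seg y x := by
  ext t <;> simp [seg, lerp, interpolate] <;> ring

/-- Convexity in the disc. -/
def DiscConvex (L : Set Disc) : Prop := ∀ x ∈ L, ∀ y ∈ L, ∀ t, lerp x y t ∈ L

theorem DiscConvex.homotopicIn {L : Set Disc} (hL : DiscConvex L) {γ δ : I → Disc}
    (hγ : Continuous γ) (hδ : Continuous δ) (h0 : γ 0 = δ 0) (h1 : γ 1 = δ 1)
    (hγL : ∀ t, γ t ∈ L) (hδL : ∀ t, δ t ∈ L) : HomotopicIn L γ δ :=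
  ⟨fun z => lerp (γ z.2) (δ z.2) z.1, by fun_prop, fun t => by simp, fun t => by simp,
    fun s => by simp [h0], fun s => by simp [h1], fun z => hL _ (hγL _) _ (hδL _) _⟩

theorem DiscConvex.homotopicIn_univ {x y : Disc} (γ δ : Path x y) :
    HomotopicIn Set.univ γ δ :=
  DiscConvex.homotopicIn (L := Set.univ) (fun _ _ _ _ _ => trivial) γ.continuous δ.continuous (by simp) (by simp)
    (fun _ => trivial) fun _ => trivial

theorem DiscConvex.seg_mem {L : Set Disc} (hL : DiscConvex L) {x y : Disc} (hx : x ∈ L)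
    (hy : y ∈ L) (t : I) : seg x y t ∈ L := hL x hx y hy t

/-- The two ways around a square are homotopic. -/
theorem HomotopicIn.square {X : Type*} [TopologicalSpace X] {U : Set X} {a b c d : X} (l : Path a b) (t : Path b d) (u : Path a c) (r : Path c d)
    (S : I × I → X) (hS : Continuous S) (hl : ∀ x, S (0, x) = l x) (ht : ∀ x, S (x, 1) = t x)
    (hu : ∀ x, S (x, 0) = u x) (hr : ∀ x, S (1, x) = r x) (hU : ∀ z, S z ∈ U) :
    HomotopicIn U (l.trans t) (u.trans r) := by
  let l' : Path ((0, 0) : I × I) (0, 1) := (Path.refl 0).prod Path.id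
  let t' : Path ((0, 1) : I × I) (1, 1) := Path.id.prod (Path.refl 1)
  let u' : Path ((0, 0) : I × I) (1, 0) := Path.id.prod (Path.refl 0)
  let r' : Path ((1, 0) : I × I) (1, 1) := (Path.refl 1).prod Path.id
  obtain ⟨K, hK, k1, k2, k3, k4, -⟩ := DiscConvex.homotopicIn_univ (l'.trans t') (u'.trans r')
  have h0 : ∀ x, S ((l'.trans t') x) = (l.trans t) x := by
    intro x
    simp only [Path.trans_apply]
    split_ifs
    · exact hl _
    · exact ht _
  have h1 : ∀ x, S ((u'.trans r') x) = (u.trans r) x := by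
    intro x
    simp only [Path.trans_apply]
    split_ifs
    · exact hu _
    · exact hr _
  refine ⟨fun z => S (K z), hS.comp hK, fun x => ?_, fun x => ?_, fun s => ?_,
    fun s => ?_, fun z => hU _⟩
  · rw [← h0, ← k1]
  · rw [← h1, ← k2]
  · rw [← h0, ← k3]
  · rw [← h0, ← k4]

/-! ### Families of homeomorphisms, and parallel strands -/

theorem continuous_symm_family {X : Type*} [TopologicalSpace X] [CompactSpace X] [T2Space X]
    {Y : Type*} [TopologicalSpace Y] [CompactSpace Y] [T2Space Y] {Φ : X → (Y ≃ₜ Y)}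
    (h : Continuous fun z : X × Y => Φ z.1 z.2) :
    Continuous fun z : X × Y => (Φ z.1).symm z.2 := by
  let e : X × Y ≃ X × Y :=
    { toFun := fun z => (z.1, Φ z.1 z.2)
      invFun := fun z => (z.1, (Φ z.1).symm z.2)
      left_inv := fun z => by simp
      right_inv := fun z => by simp }
  have he : Continuous e := continuous_fst.prodMk h
  exact continuous_snd.comp (he.continuous_symm_of_equiv_compact_to_t2)

namespace Isotopy

variable {Z : Set Disc} {f : Disc ≃ₜ Disc}

theorem continuous_symm (F : Isotopy Z f) :
    Continuous fun x : I × Disc => (F.toFun x.1).symm x.2 :=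
  continuous_symm_family F.continuous_uncurry

end Isotopy

theorem isParallel_iff {p : ℕ} {f : Disc ≃ₜ Disc} (F : Isotopy ∅ f) (a m : Disc) :
    IsParallel p F a m ↔ HomotopicIn {z | ∀ c ∈ punctures p, c ≠ a → z ≠ f c}
      (f ∘ seg m a) (seg (f m) (f a)) := by
  have key : IsParallel p F a m ↔ HomotopicIn {z | ∀ c ∈ punctures p, c ≠ a → z ≠ f c}
      (Path.refl (f m)) ((((seg m a).map f.continuous).trans (Path.refl (f a))).trans
        (seg (f a) (f m))) := by
    have hθ : Continuous fun z : Cylinder => f ((F.toFun z.2).symm z.1) :=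
      f.continuous.comp (F.continuous_symm.comp (continuous_snd.prodMk continuous_fst))
    have hC : ∀ t, f ((F.toFun ((((levelSegment m a 0).trans (F.trace a)).trans
        (levelSegment (f a) (f m) 1)) t).2).symm ((((levelSegment m a 0).trans (F.trace a)).trans
        (levelSegment (f a) (f m) 1)) t).1) = ((((seg m a).map f.continuous).trans
        (Path.refl (f a))).trans (seg (f a) (f m))) t := by
      intro t
      simp only [Path.trans_apply]
      split_ifs
      · simp [levelSegment, F.map_zero, seg, lerp]; rfl
      · simp [Isotopy.trace]
      · simp [levelSegment, F.map_one, seg, lerp]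
    constructor
    · rintro ⟨K, hK⟩
      refine ⟨fun z => f ((F.toFun (K z).2).symm (K z).1), hθ.comp K.continuous, fun t => ?_,
        fun t => ?_, fun s => ?_, fun s => ?_, fun z c hc hca hz => ?_⟩
      · beta_reduce; rw [K.apply_zero]; simp [Isotopy.trace]
      · beta_reduce; rw [K.apply_one]; exact hC t
      · beta_reduce; rw [Path.Homotopy.source]; simp [F.map_zero]; rfl
      · beta_reduce; rw [Path.Homotopy.target]; simp [F.map_one]
      · refine hK z c hc hca (K z).2 ?_
        have := f.injective hz
        rw [Homeomorph.symm_apply_eq] at this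
        exact Prod.ext this rfl
    · rintro ⟨K, h1, h2, h3, h4, h5, h6⟩
      set C := ((levelSegment m a 0).trans (F.trace a)).trans (levelSegment (f a) (f m) 1) with hCdef
      refine ⟨⟨⟨⟨fun z => (F.toFun (interpolate z.2 (C z.2).2 z.1) (f.symm (K z)),
        interpolate z.2 (C z.2).2 z.1), ?_⟩, fun t => ?_, fun t => ?_⟩, ?_⟩, ?_⟩
      · have hg : Continuous fun z : I × I => interpolate z.2 (C z.2).2 z.1 :=
          continuous_interpolate continuous_snd
            (continuous_snd.comp (C.continuous.comp continuous_snd)) continuous_fst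
        exact (F.continuous_uncurry.comp
          (hg.prodMk (f.symm.continuous.comp h1))).prodMk hg
      · simp [h2, Isotopy.trace]
      · simp only [interpolate_one, h3]
        rw [← hC, Homeomorph.symm_apply_apply]
        simp
        rfl
      · rintro s t (rfl | ht)
        · simp [h4, F.map_zero]
        · rw [Set.mem_singleton_iff.1 ht]
          simp [h5, F.map_one]
      · intro z c hc hca t hz
        simp only [Isotopy.trace] at hz
        have e1 := congrArg Prod.fst hz
        have e2 := congrArg Prod.snd hz
        change F.toFun (interpolate z.2 (C z.2).2 z.1) (f.symm (K z)) = F.toFun t c at e1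
        change interpolate z.2 (C z.2).2 z.1 = t at e2
        rw [e2] at e1
        have := (F.toFun t).injective e1
        rw [Homeomorph.symm_apply_eq] at this
        exact h6 z c hc hca this
  rw [key]
  constructor
  · intro h
    have hU := h.right_mem
    have hγ : ∀ t, (seg m a).map f.continuous t ∈ {z | ∀ c ∈ punctures p, c ≠ a → z ≠ f c} := by
      intro t
      have hr : (seg m a).map f.continuous t ∈ Set.range ((((seg m a).map f.continuous).trans
        (Path.refl (f a))).trans (seg (f a) (f m))) := by
        rw [Path.trans_range, Path.trans_range]; exact Or.inl (Or.inl ⟨t, rfl⟩)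
      obtain ⟨s, hs⟩ := hr
      exact hs ▸ hU s
    have hδ : ∀ t, seg (f a) (f m) t ∈ {z | ∀ c ∈ punctures p, c ≠ a → z ≠ f c} := by
      intro t
      have hr : seg (f a) (f m) t ∈ Set.range ((((seg m a).map f.continuous).trans
        (Path.refl (f a))).trans (seg (f a) (f m))) := by
        rw [Path.trans_range]; exact Or.inr ⟨t, rfl⟩
      obtain ⟨s, hs⟩ := hr
      exact hs ▸ hU s
    have := (HomotopicIn.refl_trans_refl_trans_iff hγ hδ).1 h
    rwa [seg_symm] at this
  · intro h
    refine (HomotopicIn.refl_trans_refl_trans_iff h.left_mem fun t => ?_).2 ?_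
    · rw [← seg_symm]; exact h.right_mem _
    · rw [seg_symm]; exact h

end Chambord

namespace Chambord

open unitInterval Topology

/-! ### The round disc and its local pushes -/

/-- The round closed disc. -/
abbrev Round : Type := Metric.closedBall (0 : ℂ) 1

/-- The tent function of height one around `c`, supported in the ball of radius `r`. -/
noncomputable def tent (c : ℂ) (r : ℝ) (z : ℂ) : ℝ := max 0 (1 - ‖z - c‖ / r)

theorem tent_nonneg (c : ℂ) (r : ℝ) (z : ℂ) : 0 ≤ tent c r z := le_max_left _ _

theorem tent_le_one (c : ℂ) {r : ℝ} (hr : 0 < r) (z : ℂ) : tent c r z ≤ 1 :=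
  max_le zero_le_one (sub_le_self _ (by positivity))

@[simp] theorem tent_self (c : ℂ) (r : ℝ) : tent c r c = 1 := by simp [tent]

theorem tent_eq_zero {c z : ℂ} {r : ℝ} (hr : 0 < r) (h : r ≤ ‖z - c‖) : tent c r z = 0 := by
  apply max_eq_left
  have : 1 ≤ ‖z - c‖ / r := by rwa [le_div_iff₀ hr, one_mul]
  linarith

theorem abs_tent_sub_le (c : ℂ) {r : ℝ} (hr : 0 < r) (z w : ℂ) :
    |tent c r z - tent c r w| ≤ ‖z - w‖ / r := by
  refine (abs_max_sub_max_le_max (0 : ℝ) _ 0 _).trans ?_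
  rw [sub_self, abs_zero, max_eq_right (abs_nonneg _), sub_sub_sub_cancel_left, ← sub_div, abs_div, abs_of_pos hr]
  gcongr
  rw [abs_sub_comm]
  refine (abs_norm_sub_norm_le _ _).trans (le_of_eq ?_)
  congr 1; ring

theorem continuous_tent {X : Type*} [TopologicalSpace X] {c z : X → ℂ} (r : ℝ)
    (hc : Continuous c) (hz : Continuous z) : Continuous fun x => tent (c x) r (z x) := by
  unfold tent
  fun_prop

/-- A perturbation of the identity of the plane by a contraction is bijective. -/
theorem bijective_add_of_contraction {P : ℂ → ℂ} {K : ℝ} (hK : K < 1)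
    (hP : ∀ z w, ‖P z - P w‖ ≤ K * ‖z - w‖) : Function.Bijective fun z => z + P z := by
  have hK0 : 0 ≤ K := by
    have h := hP 0 1
    have h2 := norm_nonneg (P 0 - P 1)
    simp only [zero_sub, norm_neg, norm_one, mul_one] at h
    linarith
  constructor
  · intro z w h
    have h1 : z - w = P w - P z := by linear_combination (h : z + P z = w + P w)
    have h2 := hP w z
    rw [← h1, norm_sub_rev w z] at h2
    by_contra hne
    have : 0 < ‖z - w‖ := norm_pos_iff.2 (sub_ne_zero.2 hne)
    nlinarith
  · intro y
    have hc : ContractingWith ⟨K, hK0⟩ fun z => y - P z := by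
      refine ⟨by exact_mod_cast hK, LipschitzWith.of_dist_le_mul fun z w => ?_⟩
      rw [dist_eq_norm, dist_eq_norm]
      have : y - P z - (y - P w) = P w - P z := by ring
      rw [this, norm_sub_rev z w]
      exact hP w z
    refine ⟨ContractingWith.fixedPoint _ hc, ?_⟩
    have h : y - P _ = _ := hc.fixedPoint_isFixedPt
    change _ + P _ = y
    nth_rw 1 [← h]
    ring

/-- The restriction to the round disc of a bijection of the plane that preserves it. -/
noncomputable def roundHomeo (g : ℂ → ℂ) (hg : Continuous g) (hb : Function.Bijective g)
    (hm : ∀ z, ‖g z‖ ≤ 1 ↔ ‖z‖ ≤ 1) : Round ≃ₜ Round :=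
  let f : Round → Round := fun z => ⟨g z, by
    rw [mem_closedBall_zero_iff, hm]; exact mem_closedBall_zero_iff.1 z.2⟩
  have hf : Function.Bijective f := by
    constructor
    · intro z w h
      exact Subtype.ext (hb.1 (congrArg Subtype.val h))
    · intro w
      obtain ⟨z, hz⟩ := hb.2 w
      refine ⟨⟨z, ?_⟩, Subtype.ext hz⟩
      rw [mem_closedBall_zero_iff, ← hm, hz]
      exact mem_closedBall_zero_iff.1 w.2
  (show Continuous f by fun_prop).homeoOfEquivCompactToT2 (f := Equiv.ofBijective f hf)

theorem coe_roundHomeo (g : ℂ → ℂ) (hg : Continuous g) (hb : Function.Bijective g)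
    (hm : ∀ z, ‖g z‖ ≤ 1 ↔ ‖z‖ ≤ 1) (z : Round) :
    (roundHomeo g hg hb hm z : ℂ) = g z := rfl

/-- Points of `S` can be pushed continuously to nearby points of `S` by homeomorphisms that
fix `Z`. -/
def Pushable (S Z : Set Round) : Prop :=
  ∃ κ : ℝ, 0 < κ ∧ ∀ c u : I × I → Round, Continuous c → Continuous u → (∀ x, c x ∈ S) →
    (∀ x, u x ∈ S) → (∀ x, dist (c x) (u x) < κ) →
    ∃ Φ : I × I → (Round ≃ₜ Round), Continuous (fun y : (I × I) × Round => Φ y.1 y.2) ∧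
      (∀ x, Φ x (c x) = u x) ∧ (∀ x, c x = u x → Φ x = 1) ∧ (∀ x, ∀ z ∈ Z, Φ x z = z) ∧
      ∀ x z, ‖(Φ x z : ℂ)‖ = 1 ↔ ‖(z : ℂ)‖ = 1

theorem exists_pos_le_dist {S Z : Set Round} (hS : IsCompact S) (hZ : IsClosed Z)
    (hSZ : Disjoint S Z) : ∃ r : ℝ, 0 < r ∧ ∀ x ∈ S, ∀ y ∈ Z, r ≤ dist x y := by
  obtain ⟨r, hr, h⟩ := Metric.exists_pos_forall_lt_edist hS hZ hSZ
  refine ⟨r, hr, fun x hx y hy => ?_⟩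
  have := (h x hx y hy).le
  rw [edist_nndist] at this
  exact_mod_cast this

theorem pushable_interior {S Z : Set Round} (hS : IsCompact S) (hZ : IsClosed Z)
    (hSZ : Disjoint S Z) (hZb : ∀ z : Round, ‖(z : ℂ)‖ = 1 → z ∈ Z) : Pushable S Z := by
  obtain ⟨r, hr, hd⟩ := exists_pos_le_dist hS hZ hSZ
  have hball : ∀ c ∈ S, ‖(c : ℂ)‖ + r ≤ 1 := by
    intro c hc
    have h1 : ‖(c : ℂ)‖ ≤ 1 := mem_closedBall_zero_iff.1 c.2
    rcases eq_or_ne (c : ℂ) 0 with h0 | h0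
    · have := hd c hc ⟨1, by simp⟩ (hZb _ (by simp))
      rw [Subtype.dist_eq, h0] at this
      simp at this
      simpa [h0] using this
    · have hn : 0 < ‖(c : ℂ)‖ := norm_pos_iff.2 h0
      have hs : ‖(c : ℂ) / (‖(c : ℂ)‖ : ℂ)‖ = 1 := by simp [h0]
      have := hd c hc ⟨(c : ℂ) / (‖(c : ℂ)‖ : ℂ), by rw [mem_closedBall_zero_iff, hs]⟩ (hZb _ hs)
      rw [Subtype.dist_eq, dist_eq_norm] at this
      have e : (c : ℂ) - (c : ℂ) / (‖(c : ℂ)‖ : ℂ)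
          = ((‖(c : ℂ)‖ - 1 : ℝ) : ℂ) * ((c : ℂ) / (‖(c : ℂ)‖ : ℂ)) := by
        have : (‖(c : ℂ)‖ : ℂ) ≠ 0 := by exact_mod_cast hn.ne'
        push_cast
        field_simp
      simp only [e, norm_mul, hs, mul_one, Complex.norm_real, Real.norm_eq_abs] at this
      rw [abs_of_nonpos (by linarith)] at this
      linarith
  refine ⟨r, hr, fun c u hc hu hcS huS hcu => ?_⟩
  let g : I × I → ℂ → ℂ := fun x z => z + tent (c x) r z • ((u x : ℂ) - c x)
  have hgc : Continuous fun y : (I × I) × ℂ => g y.1 y.2 := by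
    have := continuous_tent r (c := fun y : (I × I) × ℂ => (c y.1 : ℂ)) (z := Prod.snd)
      (by fun_prop) (by fun_prop)
    change Continuous fun y : (I × I) × ℂ => y.2 + tent (c y.1) r y.2 • ((u y.1 : ℂ) - c y.1)
    fun_prop
  have hv : ∀ x, ‖(u x : ℂ) - c x‖ < r := by
    intro x
    have := hcu x
    rwa [dist_comm, Subtype.dist_eq, dist_eq_norm] at this
  have hb : ∀ x, Function.Bijective (g x) := by
    intro x
    refine bijective_add_of_contraction (K := ‖(u x : ℂ) - c x‖ / r)
      (by rw [div_lt_one hr]; exact hv x) fun z w => ?_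
    rw [← sub_smul, norm_smul, Real.norm_eq_abs]
    calc _ ≤ ‖z - w‖ / r * ‖(u x : ℂ) - c x‖ := by gcongr; exact abs_tent_sub_le _ hr _ _
      _ = _ := by ring
  have hout : ∀ x (z : ℂ), r ≤ ‖z - c x‖ → g x z = z := by
    intro x z h
    simp [g, tent_eq_zero hr h]
  have hin : ∀ x (z : ℂ), ‖z - c x‖ < r → ‖g x z‖ < 1 ∧ ‖z‖ < 1 := by
    intro x z h
    have hB := hball _ (hcS x)
    have h1 : tent (c x) r z = 1 - ‖z - c x‖ / r := by
      apply max_eq_right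
      have : ‖z - c x‖ / r ≤ 1 := by rw [div_le_one hr]; exact h.le
      linarith
    have h2 : ‖tent (c x) r z • ((u x : ℂ) - c x)‖ < r - ‖z - c x‖ := by
      rw [norm_smul, Real.norm_eq_abs, abs_of_nonneg (tent_nonneg _ _ _), h1]
      have h3 : 0 < 1 - ‖z - c x‖ / r := by
        have : ‖z - c x‖ / r < 1 := by rw [div_lt_one hr]; exact h
        linarith
      calc _ < (1 - ‖z - c x‖ / r) * r := by gcongr; exact hv x
        _ = _ := by field_simp
    constructor
    · calc ‖g x z‖ = ‖(z - c x) + tent (c x) r z • ((u x : ℂ) - c x) + c x‖ := by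
            congr 1; simp only [g]; ring
        _ ≤ ‖z - c x‖ + ‖tent (c x) r z • ((u x : ℂ) - c x)‖ + ‖(c x : ℂ)‖ :=
            (norm_add_le _ _).trans (add_le_add_left (norm_add_le _ _) _)
        _ < 1 := by linarith
    · calc ‖z‖ = ‖(z - c x) + c x‖ := by congr 1; ring
        _ ≤ _ := norm_add_le _ _
        _ < 1 := by linarith
  have hm : ∀ x z, ‖g x z‖ ≤ 1 ↔ ‖z‖ ≤ 1 := by
    intro x z
    rcases lt_or_ge ‖z - c x‖ r with h | h
    · have := hin x z h
      exact ⟨fun _ => this.2.le, fun _ => this.1.le⟩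
    · rw [hout x z h]
  have hm' : ∀ x z, ‖g x z‖ = 1 ↔ ‖z‖ = 1 := by
    intro x z
    rcases lt_or_ge ‖z - c x‖ r with h | h
    · have := hin x z h
      exact ⟨fun h => absurd h this.1.ne, fun h => absurd h this.2.ne⟩
    · rw [hout x z h]
  refine ⟨fun x => roundHomeo (g x) (hgc.comp (continuous_const.prodMk continuous_id)) (hb x) (hm x), ?_, fun x => ?_,
    fun x h => ?_, fun x z hz => ?_, fun x z => hm' x z⟩
  · refine Continuous.subtype_mk ?_ _
    exact hgc.comp (by fun_prop : Continuous fun y : (I × I) × Round => (y.1, (y.2 : ℂ)))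
  · apply Subtype.ext
    rw [coe_roundHomeo]
    simp [g]
  · ext z
    rw [coe_roundHomeo]
    simp [g, h]
  · apply Subtype.ext
    rw [coe_roundHomeo]
    refine hout _ _ ?_
    have := hd _ (hcS x) z hz
    rwa [dist_comm, Subtype.dist_eq, dist_eq_norm] at this

theorem norm_exp_mul_I_sub_exp_le (a b : ℝ) :
    ‖Complex.exp (a * Complex.I) - Complex.exp (b * Complex.I)‖ ≤ |a - b| := by
  have h : Complex.exp (a * Complex.I) - Complex.exp (b * Complex.I)
      = Complex.exp (b * Complex.I) * (Complex.exp (Complex.I * (a - b : ℝ)) - 1) := by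
    rw [mul_sub, ← Complex.exp_add, mul_one]
    congr 2
    push_cast; ring
  rw [h, norm_mul, Complex.norm_exp_ofReal_mul_I, one_mul]
  exact Real.norm_exp_I_mul_ofReal_sub_one_le

theorem pushable_sphere {S Z : Set Round} (hS : IsCompact S) (hZ : IsClosed Z)
    (hSZ : Disjoint S Z) (hSb : ∀ z ∈ S, ‖(z : ℂ)‖ = 1) : Pushable S Z := by
  obtain ⟨r₀, hr₀, hd₀⟩ := exists_pos_le_dist hS hZ hSZ
  obtain ⟨r, hr, hr1, hd⟩ : ∃ r : ℝ, 0 < r ∧ r ≤ 1 ∧ ∀ x ∈ S, ∀ y ∈ Z, r ≤ dist x y :=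
    ⟨min r₀ 1, by positivity, min_le_right _ _,
      fun x hx y hy => (min_le_left _ _).trans (hd₀ x hx y hy)⟩
  let ang : ℂ → ℂ → ℝ := fun c u => Complex.arg (u * (starRingEnd ℂ) c)
  have hsq : ∀ c : ℂ, ‖c‖ = 1 → c * (starRingEnd ℂ) c = 1 := by
    intro c hc
    rw [Complex.mul_conj, Complex.normSq_eq_norm_sq, hc]; simp
  have hcont : ∃ κ : ℝ, 0 < κ ∧ ∀ c u : ℂ, ‖c‖ = 1 → ‖u‖ = 1 → dist c u < κ →
      u * (starRingEnd ℂ) c ∈ Complex.slitPlane ∧ |ang c u| < r / 4 := by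
    have h1 : ContinuousAt Complex.arg 1 := Complex.continuousAt_arg (by simp)
    have h2 := Metric.continuousAt_iff.1 h1 (r / 4) (by positivity)
    obtain ⟨δ, hδ, h2⟩ := h2
    have h3 : ∀ᶠ z in 𝓝 (1 : ℂ), z ∈ Complex.slitPlane :=
      Complex.isOpen_slitPlane.mem_nhds (by simp)
    obtain ⟨δ', hδ', h3⟩ := Metric.eventually_nhds_iff.1 h3
    refine ⟨min δ δ', by positivity, fun c u hc hu hcu => ?_⟩
    have h4 : dist (u * (starRingEnd ℂ) c) 1 = dist c u := by
      rw [← hsq c hc, dist_eq_norm, ← sub_mul, norm_mul, dist_comm c u, dist_eq_norm]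
      simp [hc]
    constructor
    · exact h3 (by rw [h4]; exact hcu.trans_le (min_le_right _ _))
    · have := h2 (x := u * (starRingEnd ℂ) c) (by rw [h4]; exact hcu.trans_le (min_le_left _ _))
      simpa [ang, Real.dist_eq] using this
  obtain ⟨κ, hκ, hang⟩ := hcont
  refine ⟨κ, hκ, fun c u hc hu hcS huS hcu => ?_⟩
  have hcn : ∀ x, ‖(c x : ℂ)‖ = 1 := fun x => hSb _ (hcS x)
  have hun : ∀ x, ‖(u x : ℂ)‖ = 1 := fun x => hSb _ (huS x)
  have hcu' : ∀ x, dist (c x : ℂ) (u x) < κ := fun x => hcu x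
  have hangc : Continuous fun x => ang (c x) (u x) := by
    rw [continuous_iff_continuousAt]
    intro x
    refine ContinuousAt.comp (g := Complex.arg) (f := fun x => (u x : ℂ) * (starRingEnd ℂ) (c x))
      (Complex.continuousAt_arg (hang _ _ (hcn x) (hun x) (hcu' x)).1)
      (Continuous.continuousAt ?_)
    have : Continuous fun x => (starRingEnd ℂ) (c x : ℂ) := Complex.continuous_conj.comp (by fun_prop)
    fun_prop
  let g : I × I → ℂ → ℂ := fun x z =>
    z * Complex.exp ((ang (c x) (u x) * tent (c x) r z : ℝ) * Complex.I)
  have hgc : Continuous fun y : (I × I) × ℂ => g y.1 y.2 := by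
    have h1 := continuous_tent r (c := fun y : (I × I) × ℂ => (c y.1 : ℂ)) (z := Prod.snd)
      (by fun_prop) (by fun_prop)
    have h2 : Continuous fun y : (I × I) × ℂ => ang (c y.1) (u y.1) := hangc.comp continuous_fst
    change Continuous fun y : (I × I) × ℂ =>
      y.2 * Complex.exp ((ang (c y.1) (u y.1) * tent (c y.1) r y.2 : ℝ) * Complex.I)
    exact continuous_snd.mul (Complex.continuous_exp.comp
      ((Complex.continuous_ofReal.comp (h2.mul h1)).mul continuous_const))
  have hnorm : ∀ x z, ‖g x z‖ = ‖z‖ := by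
    intro x z
    simp only [g, norm_mul, Complex.norm_exp_ofReal_mul_I, mul_one]
  have hlip : ∀ x (z w : ℂ), ‖z‖ ≤ 2 → ‖(g x z - z) - (g x w - w)‖ ≤ 3 / 4 * ‖z - w‖ := by
    intro x z w hz
    set θ := ang (c x) (u x)
    have hθ : |θ| ≤ r / 4 := (hang _ _ (hcn x) (hun x) (hcu' x)).2.le
    have e : (g x z - z) - (g x w - w) =
        (z - w) * (Complex.exp ((θ * tent (c x) r w : ℝ) * Complex.I)
          - Complex.exp ((0 : ℝ) * Complex.I)) +
        z * (Complex.exp ((θ * tent (c x) r z : ℝ) * Complex.I)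
          - Complex.exp ((θ * tent (c x) r w : ℝ) * Complex.I)) := by
      simp only [g, Complex.ofReal_zero, zero_mul, Complex.exp_zero]
      ring
    rw [e]
    refine (norm_add_le _ _).trans ?_
    rw [norm_mul, norm_mul]
    have h1 : |θ * tent (c x) r w - 0| ≤ 1 / 4 := by
      rw [sub_zero, abs_mul, abs_of_nonneg (tent_nonneg _ _ _)]
      calc _ ≤ r / 4 * 1 := by
            gcongr
            · exact tent_nonneg _ _ _
            · exact tent_le_one _ hr _
        _ ≤ _ := by linarith
    have h2 : |θ * tent (c x) r z - θ * tent (c x) r w| ≤ 1 / 4 * ‖z - w‖ := by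
      rw [← mul_sub, abs_mul]
      calc _ ≤ r / 4 * (‖z - w‖ / r) := by
            gcongr
            exact abs_tent_sub_le _ hr _ _
        _ = _ := by field_simp
    calc _ ≤ ‖z - w‖ * (1 / 4) + 2 * (1 / 4 * ‖z - w‖) := by
          gcongr
          · exact (norm_exp_mul_I_sub_exp_le _ _).trans h1
          · exact (norm_exp_mul_I_sub_exp_le _ _).trans h2
      _ = _ := by ring
  have hout : ∀ x (z : ℂ), r ≤ ‖z - c x‖ → g x z = z := by
    intro x z h
    simp [g, tent_eq_zero hr h]
  have hfar : ∀ x (z : ℂ), 2 < ‖z‖ → g x z = z := by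
    intro x z hz
    apply hout
    have := norm_sub_norm_le z (c x)
    rw [hcn] at this
    linarith
  have hb : ∀ x, Function.Bijective (g x) := by
    intro x
    have : g x = fun z => z + (g x z - z) := by ext z; ring
    rw [this]
    refine bijective_add_of_contraction (K := 3 / 4) (by norm_num) fun z w => ?_
    rcases le_or_gt ‖z‖ 2 with hz | hz
    · exact hlip x z w hz
    rcases le_or_gt ‖w‖ 2 with hw | hw
    · rw [norm_sub_rev, norm_sub_rev z w]
      exact hlip x w z hw
    · rw [hfar x z hz, hfar x w hw]
      simp
  refine ⟨fun x => roundHomeo (g x) (hgc.comp (continuous_const.prodMk continuous_id)) (hb x) (fun z => by rw [hnorm]), ?_,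
    fun x => ?_, fun x h => ?_, fun x z hz => ?_, fun x z => by rw [coe_roundHomeo, hnorm]⟩
  · refine Continuous.subtype_mk ?_ _
    exact hgc.comp (by fun_prop : Continuous fun y : (I × I) × Round => (y.1, (y.2 : ℂ)))
  · apply Subtype.ext
    rw [coe_roundHomeo]
    simp only [g, tent_self, mul_one, ang]
    have h1 : ‖(u x : ℂ) * (starRingEnd ℂ) (c x)‖ = 1 := by simp [hcn, hun]
    have h2 := Complex.norm_mul_exp_arg_mul_I ((u x : ℂ) * (starRingEnd ℂ) (c x))
    rw [h1, Complex.ofReal_one, one_mul] at h2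
    rw [h2]
    linear_combination (u x : ℂ) * hsq _ (hcn x)
  · ext z
    rw [coe_roundHomeo]
    simp [g, ang, h, hsq _ (hun x)]
  · apply Subtype.ext
    rw [coe_roundHomeo]
    refine hout _ _ ?_
    have := hd _ (hcS x) z hz
    rwa [dist_comm, Subtype.dist_eq, dist_eq_norm] at this

/-- A family of paths in a pushable set is traced by a family of isotopies. -/
theorem Pushable.exists_family {S Z : Set Round} (hSZ : Pushable S Z) {H : I × I → Round}
    (hH : Continuous H) (hHS : ∀ x, H x ∈ S) :
    ∃ Φ : I × I → (Round ≃ₜ Round), Continuous (fun y : (I × I) × Round => Φ y.1 y.2) ∧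
      (∀ s, Φ (s, 0) = 1) ∧ (∀ s t, Φ (s, t) (H (s, 0)) = H (s, t)) ∧
      (∀ s, (∀ t, H (s, t) = H (s, 0)) → ∀ t, Φ (s, t) = 1) ∧
      (∀ x, ∀ z ∈ Z, Φ x z = z) ∧ ∀ x z, ‖(Φ x z : ℂ)‖ = 1 ↔ ‖(z : ℂ)‖ = 1 := by
  obtain ⟨κ, hκ, hpush⟩ := hSZ
  have huc := CompactSpace.uniformContinuous_of_continuous hH
  obtain ⟨δ, hδ, huc⟩ := Metric.uniformContinuous_iff.1 huc κ hκ
  obtain ⟨N, hN⟩ := exists_nat_gt (1 / δ)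
  have hN0 : (0 : ℝ) < N := lt_trans (by positivity) hN
  let cut : ℕ → I → I := fun k t => min t (Set.projIcc 0 1 zero_le_one ((k : ℝ) / N))
  have hcut : ∀ k, Continuous (cut k) := fun k => by fun_prop
  have hcut0 : ∀ t, cut 0 t = 0 := by
    intro t
    simp only [cut, Nat.cast_zero, zero_div]
    rw [Set.projIcc_left]
    exact min_eq_right t.2.1
  have hcutN : ∀ t, cut N t = t := by
    intro t
    simp only [cut]
    rw [div_self hN0.ne', Set.projIcc_right]
    exact min_eq_left t.2.2
  have hcut00 : ∀ k, cut k 0 = 0 := fun k => min_eq_left unitInterval.nonneg'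
  have hstep : ∀ k t, dist (cut k t) (cut (k + 1) t) < δ := by
    intro k t
    rw [Subtype.dist_eq, Real.dist_eq]
    have e : ∀ j : ℕ, (cut j t : ℝ) = min (t : ℝ) (max 0 (min 1 ((j : ℝ) / N))) := fun j => rfl
    rw [e, e]
    have h1 : |min (t : ℝ) (max 0 (min 1 ((k : ℝ) / N)))
        - min (t : ℝ) (max 0 (min 1 (((k + 1 : ℕ) : ℝ) / N)))| ≤
        |(k : ℝ) / N - ((k + 1 : ℕ) : ℝ) / N| := by
      refine (abs_min_sub_min_le_max _ _ _ _).trans ?_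
      rw [sub_self, abs_zero, max_eq_right (abs_nonneg _)]
      refine (abs_max_sub_max_le_max _ _ _ _).trans ?_
      rw [sub_self, abs_zero, max_eq_right (abs_nonneg _)]
      refine (abs_min_sub_min_le_max _ _ _ _).trans ?_
      rw [sub_self, abs_zero, max_eq_right (abs_nonneg _)]
    refine h1.trans_lt ?_
    have : (k : ℝ) / N - ((k + 1 : ℕ) : ℝ) / N = -(1 / N) := by push_cast; ring
    rw [this, abs_neg, abs_of_pos (by positivity)]
    rw [div_lt_comm₀ hN0 hδ]
    exact hN
  have hmain : ∀ k : ℕ, ∃ Φ : I × I → (Round ≃ₜ Round),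
      Continuous (fun y : (I × I) × Round => Φ y.1 y.2) ∧
      (∀ s, Φ (s, 0) = 1) ∧ (∀ s t, Φ (s, t) (H (s, 0)) = H (s, cut k t)) ∧
      (∀ s, (∀ t, H (s, t) = H (s, 0)) → ∀ t, Φ (s, t) = 1) ∧
      (∀ x, ∀ z ∈ Z, Φ x z = z) ∧ ∀ x z, ‖(Φ x z : ℂ)‖ = 1 ↔ ‖(z : ℂ)‖ = 1 := by
    intro k
    induction k with
    | zero =>
      exact ⟨fun _ => 1, continuous_snd, fun _ => rfl, fun s t => by rw [hcut0]; rfl,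
        fun _ _ _ => rfl, fun _ _ _ => rfl, fun _ _ => Iff.rfl⟩
    | succ k ih =>
      obtain ⟨Φ, h1, h2, h3, h4, h5, h6⟩ := ih
      obtain ⟨Ψ, g1, g2, g3, g4, g5⟩ := hpush (fun x => H (x.1, cut k x.2))
        (fun x => H (x.1, cut (k + 1) x.2)) (hH.comp (by fun_prop)) (hH.comp (by fun_prop))
        (fun x => hHS _) (fun x => hHS _) (fun x => huc (by
          rw [Prod.dist_eq]
          simpa [hδ] using hstep k x.2))
      refine ⟨fun x => Ψ x * Φ x, g1.comp (continuous_fst.prodMk h1), fun s => ?_,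
        fun s t => ?_, fun s hs t => ?_, fun x z hz => ?_, fun x z => (g5 x _).trans (h6 x z)⟩
      · change Ψ (s, 0) * Φ (s, 0) = 1
        rw [h2, g3 _ (by simp [hcut00]), one_mul]
      · change Ψ (s, t) (Φ (s, t) (H (s, 0))) = _
        rw [h3]
        exact g2 (s, t)
      · change Ψ (s, t) * Φ (s, t) = 1
        rw [h4 s hs, g3 _ (by simp only; rw [hs, hs (cut _ _)]), one_mul]
      · change Ψ x (Φ x z) = z
        rw [h5 x z hz, g4 x z hz]
  obtain ⟨Φ, h1, h2, h3, h4⟩ := hmain N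
  exact ⟨Φ, h1, h2, fun s t => by rw [h3, hcutN], h4⟩

end Chambord

namespace Chambord

open unitInterval Topology

/-! ### The radial homeomorphism from the square to the round disc -/

/-- The point of the plane corresponding to a point of the square, rescaled to `[-1, 1]²`. -/
noncomputable def planePoint (z : Disc) : ℂ := ⟨2 * (z.1 : ℝ) - 1, 2 * (z.2 : ℝ) - 1⟩

/-- The supremum norm on the plane. -/
noncomputable def supNorm (w : ℂ) : ℝ := max |w.re| |w.im|

theorem supNorm_nonneg (w : ℂ) : 0 ≤ supNorm w := le_max_of_le_left (abs_nonneg _)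

theorem supNorm_le_norm (w : ℂ) : supNorm w ≤ ‖w‖ :=
  max_le (Complex.abs_re_le_norm w) (Complex.abs_im_le_norm w)

theorem supNorm_eq_zero {w : ℂ} : supNorm w = 0 ↔ w = 0 := by
  constructor
  · intro h
    have h1 : |w.re| ≤ 0 := h ▸ le_max_left _ _
    have h2 : |w.im| ≤ 0 := h ▸ le_max_right _ _
    exact Complex.ext (abs_nonpos_iff.1 h1) (abs_nonpos_iff.1 h2)
  · rintro rfl; simp [supNorm]

theorem supNorm_real_smul (c : ℝ) (w : ℂ) : supNorm ((c : ℂ) * w) = |c| * supNorm w := by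
  simp only [supNorm, Complex.re_ofReal_mul, Complex.im_ofReal_mul, abs_mul]
  rw [mul_max_of_nonneg _ _ (abs_nonneg c)]

theorem continuous_planePoint : Continuous planePoint := by
  have : planePoint = fun z : Disc => ((2 * (z.1 : ℝ) - 1 : ℝ) : ℂ) +
      ((2 * (z.2 : ℝ) - 1 : ℝ) : ℂ) * Complex.I := by
    funext z; exact (Complex.re_add_im (planePoint z)).symm
  rw [this]
  fun_prop

theorem planePoint_injective : Function.Injective planePoint := by
  intro z w h
  have h1 := congrArg Complex.re h
  have h2 := congrArg Complex.im h
  simp only [planePoint] at h1 h2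
  exact Prod.ext (Subtype.ext (by linarith)) (Subtype.ext (by linarith))

theorem supNorm_planePoint_le (z : Disc) : supNorm (planePoint z) ≤ 1 := by
  have h1 := z.1.2; have h2 := z.2.2
  simp only [Set.mem_Icc] at h1 h2
  exact max_le (abs_le.2 ⟨by simp only [planePoint]; linarith, by simp only [planePoint]; linarith⟩)
    (abs_le.2 ⟨by simp only [planePoint]; linarith, by simp only [planePoint]; linarith⟩)

theorem supNorm_planePoint_eq_one {z : Disc} : supNorm (planePoint z) = 1 ↔ z ∈ boundary := by
  have h1 := z.1.2; have h2 := z.2.2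
  simp only [Set.mem_Icc] at h1 h2
  have e1 : ∀ a : I, (|2 * (a : ℝ) - 1| = 1) ↔ (a = 0 ∨ a = 1) := by
    intro a
    rw [abs_eq zero_le_one]
    constructor
    · rintro (h | h)
      · exact Or.inr (Subtype.ext (show (a : ℝ) = 1 by linarith))
      · exact Or.inl (Subtype.ext (show (a : ℝ) = 0 by linarith))
    · rintro (rfl | rfl)
      · right; norm_num
      · left; norm_num
  have hle := supNorm_planePoint_le z
  simp only [supNorm, planePoint] at hle ⊢
  rw [max_le_iff] at hle
  have : max |2 * (z.1 : ℝ) - 1| |2 * (z.2 : ℝ) - 1| = 1 ↔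
      |2 * (z.1 : ℝ) - 1| = 1 ∨ |2 * (z.2 : ℝ) - 1| = 1 := by
    constructor
    · intro h
      rcases max_choice |2 * (z.1 : ℝ) - 1| |2 * (z.2 : ℝ) - 1| with h' | h'
      · exact Or.inl (h' ▸ h)
      · exact Or.inr (h' ▸ h)
    · rintro (h | h)
      · rw [h]; exact max_eq_left hle.2
      · rw [h]; exact max_eq_right hle.1
  rw [this, e1, e1, or_assoc]
  rfl

/-- The radial rescaling of the plane that maps the unit square to the unit disc. -/
noncomputable def rescale (w : ℂ) : ℂ := ((supNorm w / ‖w‖ : ℝ) : ℂ) * w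

theorem norm_rescale (w : ℂ) : ‖rescale w‖ = supNorm w := by
  rcases eq_or_ne w 0 with rfl | hw
  · simp [rescale, supNorm]
  · rw [rescale, norm_mul, Complex.norm_real, Real.norm_eq_abs,
      abs_of_nonneg (div_nonneg (supNorm_nonneg w) (norm_nonneg w)),
      div_mul_cancel₀ _ (norm_ne_zero_iff.2 hw)]

theorem continuous_supNorm : Continuous supNorm := by
  unfold supNorm
  exact (Complex.continuous_re.abs).max (Complex.continuous_im.abs)

theorem continuous_rescale : Continuous rescale := by
  rw [continuous_iff_continuousAt]
  intro w
  rcases eq_or_ne w 0 with rfl | hw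
  · rw [ContinuousAt, show rescale 0 = 0 by simp [rescale]]
    refine squeeze_zero_norm (a := fun w => ‖w‖) (fun z => ?_) ?_
    · rw [norm_rescale]; exact supNorm_le_norm z
    · have : Continuous fun w : ℂ => ‖w‖ := continuous_norm
      simpa using this.tendsto 0
  · have h1 : ContinuousAt (fun w => supNorm w / ‖w‖) w :=
      continuous_supNorm.continuousAt.div continuous_norm.continuousAt (norm_ne_zero_iff.2 hw)
    exact (Complex.continuous_ofReal.continuousAt.comp h1).mul continuousAt_id

theorem rescale_injective : Function.Injective rescale := by
  intro z w h
  have hn : supNorm z = supNorm w := by rw [← norm_rescale, ← norm_rescale, h]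
  rcases eq_or_ne z 0 with rfl | hz
  · have : supNorm w = 0 := by rw [← hn, supNorm_eq_zero]
    exact (supNorm_eq_zero.1 this).symm
  have hw : w ≠ 0 := by
    rintro rfl
    exact hz (supNorm_eq_zero.1 (hn.trans (supNorm_eq_zero.2 rfl)))
  have hs : 0 < supNorm z := lt_of_le_of_ne (supNorm_nonneg z)
    (Ne.symm (mt supNorm_eq_zero.1 hz))
  have hz' := norm_pos_iff.2 hz
  have hw' := norm_pos_iff.2 hw
  have h2 : z = ((‖z‖ / ‖w‖ : ℝ) : ℂ) * w := by
    unfold rescale at h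
    rw [← hn] at h
    have e1 : (supNorm z : ℂ) ≠ 0 := by exact_mod_cast hs.ne'
    have e2 : (‖z‖ : ℂ) ≠ 0 := by exact_mod_cast hz'.ne'
    have e3 : (‖w‖ : ℂ) ≠ 0 := by exact_mod_cast hw'.ne'
    push_cast at h ⊢
    field_simp at h ⊢
    exact h
  have h3 : supNorm z = ‖z‖ / ‖w‖ * supNorm w := by
    nth_rw 1 [h2]
    rw [supNorm_real_smul, abs_of_pos (by positivity)]
  have h4 : ‖z‖ / ‖w‖ = 1 := by
    rw [← hn] at h3
    exact mul_right_cancel₀ hs.ne' (by rw [one_mul]; exact h3.symm)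
  rw [h2, h4]; simp

theorem exists_rescale_eq (u : ℂ) : ∃ w, rescale w = u ∧ supNorm w = ‖u‖ := by
  rcases eq_or_ne u 0 with rfl | hu
  · exact ⟨0, by simp [rescale], by simp [supNorm]⟩
  have hs : 0 < supNorm u := lt_of_le_of_ne (supNorm_nonneg u)
    (Ne.symm (mt supNorm_eq_zero.1 hu))
  have hu' := norm_pos_iff.2 hu
  have h1 : supNorm (((‖u‖ / supNorm u : ℝ) : ℂ) * u) = ‖u‖ := by
    rw [supNorm_real_smul, abs_of_pos (by positivity)]
    field_simp
  refine ⟨((‖u‖ / supNorm u : ℝ) : ℂ) * u, ?_, h1⟩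
  rw [rescale, h1, norm_mul, Complex.norm_real, Real.norm_eq_abs, abs_of_pos (by positivity),
    ← mul_assoc, ← Complex.ofReal_mul]
  have : ‖u‖ / (‖u‖ / supNorm u * ‖u‖) * (‖u‖ / supNorm u) = 1 := by field_simp
  rw [this]; simp

/-- The radial homeomorphism from the square to the round disc. -/
noncomputable def radial : Disc ≃ₜ Round :=
  let f : Disc → Round := fun z => ⟨rescale (planePoint z), by
    rw [mem_closedBall_zero_iff, norm_rescale]; exact supNorm_planePoint_le z⟩
  have hf : Function.Bijective f := by
    constructor
    · intro z w h
      exact planePoint_injective (rescale_injective (congrArg Subtype.val h))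
    · intro u
      obtain ⟨w, h1, h2⟩ := exists_rescale_eq u
      have hu := mem_closedBall_zero_iff.1 u.2
      have h3 : |w.re| ≤ 1 := (le_max_left _ _).trans (h2.trans_le hu)
      have h4 : |w.im| ≤ 1 := (le_max_right _ _).trans (h2.trans_le hu)
      rw [abs_le] at h3 h4
      refine ⟨(⟨(w.re + 1) / 2, by constructor <;> linarith⟩,
        ⟨(w.im + 1) / 2, by constructor <;> linarith⟩), Subtype.ext ?_⟩
      change rescale (planePoint _) = u
      rw [← h1]
      congr 1
      apply Complex.ext <;> simp only [planePoint] <;> ring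
  (show Continuous f from (continuous_rescale.comp continuous_planePoint).subtype_mk
    fun z => by
      rw [mem_closedBall_zero_iff, Function.comp_apply, norm_rescale]
      exact supNorm_planePoint_le z).homeoOfEquivCompactToT2
    (f := Equiv.ofBijective f hf)

theorem coe_radial (z : Disc) : (radial z : ℂ) = rescale (planePoint z) := rfl

theorem norm_radial_eq_one {z : Disc} : ‖(radial z : ℂ)‖ = 1 ↔ z ∈ boundary := by
  rw [coe_radial, norm_rescale, supNorm_planePoint_eq_one]

theorem isClosed_boundary : IsClosed boundary := by
  have : boundary = {z : Disc | ‖(radial z : ℂ)‖ = 1} := by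
    ext z; exact norm_radial_eq_one.symm
  rw [this]
  exact isClosed_eq (by fun_prop) continuous_const

/-! ### Pushing points of the disc -/

theorem exists_pushFamily {Z : Set Disc} (hZ : IsClosed Z) {H : I × I → Disc} (hH : Continuous H)
    (hHZ : ∀ x, H x ∉ Z) (hb : boundary ⊆ Z ∨ ∀ x, H x ∈ boundary) :
    ∃ Φ : I × I → (Disc ≃ₜ Disc), Continuous (fun y : (I × I) × Disc => Φ y.1 y.2) ∧
      (∀ s, Φ (s, 0) = 1) ∧ (∀ s t, Φ (s, t) (H (s, 0)) = H (s, t)) ∧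
      (∀ s, (∀ t, H (s, t) = H (s, 0)) → ∀ t, Φ (s, t) = 1) ∧
      (∀ x, ∀ z ∈ Z, Φ x z = z) ∧ ∀ x z, Φ x z ∈ boundary ↔ z ∈ boundary := by
  have hS : IsCompact (Set.range (radial ∘ H)) :=
    isCompact_range (radial.continuous.comp hH)
  have hZ' : IsClosed (radial '' Z) := radial.isClosedMap _ hZ
  have hd : Disjoint (Set.range (radial ∘ H)) (radial '' Z) := by
    rw [Set.disjoint_left]
    rintro _ ⟨x, rfl⟩ ⟨z, hz, h⟩
    exact hHZ x (radial.injective h ▸ hz)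
  have hp : Pushable (Set.range (radial ∘ H)) (radial '' Z) := by
    rcases hb with hb | hb
    · refine pushable_interior hS hZ' hd fun z hz => ⟨radial.symm z, hb ?_, by simp⟩
      rw [← norm_radial_eq_one]; simpa using hz
    · refine pushable_sphere hS hZ' hd ?_
      rintro _ ⟨x, rfl⟩
      exact norm_radial_eq_one.2 (hb x)
  obtain ⟨Φ, h1, h2, h3, h4, h5, h6⟩ := hp.exists_family (radial.continuous.comp hH)
    (fun x => ⟨x, rfl⟩)
  refine ⟨fun x => (radial.trans (Φ x)).trans radial.symm, ?_, fun s => ?_, fun s t => ?_,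
    fun s hs t => ?_, fun x z hz => ?_, fun x z => ?_⟩
  · exact radial.symm.continuous.comp
      (h1.comp (continuous_fst.prodMk (radial.continuous.comp continuous_snd)))
  · beta_reduce; rw [h2]; ext z : 1; exact radial.symm_apply_apply z
  · change radial.symm (Φ (s, t) (radial (H (s, 0)))) = _
    rw [show Φ (s, t) (radial (H (s, 0))) = radial (H (s, t)) from h3 s t,
      radial.symm_apply_apply]
  · beta_reduce; rw [h4 s (fun t => congrArg radial (hs t)) t]; ext z : 1; exact radial.symm_apply_apply z
  · change radial.symm (Φ x (radial z)) = z
    rw [h5 x _ ⟨z, hz, rfl⟩, radial.symm_apply_apply]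
  · change radial.symm (Φ x (radial z)) ∈ boundary ↔ _
    rw [← norm_radial_eq_one, ← norm_radial_eq_one, radial.apply_symm_apply, h6]

/-- Pushing a point along a path. -/
theorem exists_push {Z : Set Disc} (hZ : IsClosed Z) {γ : I → Disc} (hγ : Continuous γ)
    (hγZ : ∀ t, γ t ∉ Z) (hb : boundary ⊆ Z ∨ ∀ t, γ t ∈ boundary) :
    ∃ (φ : Disc ≃ₜ Disc) (F : Isotopy Z φ), ∀ t, F.toFun t (γ 0) = γ t := by
  obtain ⟨Φ, h1, h2, h3, -, h5, h6⟩ := exists_pushFamily hZ (H := fun x => γ x.2)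
    (hγ.comp continuous_snd) (fun x => hγZ _) (hb.imp_right fun h x => h _)
  exact ⟨Φ (0, 1), ⟨fun t => Φ (0, t),
    h1.comp ((continuous_const.prodMk continuous_fst).prodMk continuous_snd), h2 0, rfl, fun t z => h6 _ z,
    fun t z hz => h5 _ z hz⟩, fun t => h3 0 t⟩

/-- An isotopy along which `x` describes a null-homotopic loop can be made to fix `x`. -/
theorem Isotopy.insert_of_null {Z : Set Disc} (hZ : IsClosed Z) {g : Disc ≃ₜ Disc}
    (G : Isotopy Z g) {x : Disc} {K : I × I → Disc} (hK : Continuous K)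
    (h0 : ∀ t, K (0, t) = x) (h1 : ∀ t, K (1, t) = G.toFun t x) (hs0 : ∀ s, K (s, 0) = x)
    (hs1 : ∀ s, K (s, 1) = x) (hKZ : ∀ p, K p ∉ Z)
    (hb : (∀ p, K p ∉ boundary) ∨ ∀ p, K p ∈ boundary) :
    Nonempty (Isotopy (insert x Z) g) := by
  obtain ⟨Φ, c1, c2, c3, c4, c5, c6⟩ : ∃ Φ : I × I → (Disc ≃ₜ Disc),
      Continuous (fun y : (I × I) × Disc => Φ y.1 y.2) ∧
      (∀ s, Φ (s, 0) = 1) ∧ (∀ s t, Φ (s, t) (K (s, 0)) = K (s, t)) ∧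
      (∀ s, (∀ t, K (s, t) = K (s, 0)) → ∀ t, Φ (s, t) = 1) ∧
      (∀ x, ∀ z ∈ Z, Φ x z = z) ∧ ∀ x z, Φ x z ∈ boundary ↔ z ∈ boundary := by
    rcases hb with hb | hb
    · obtain ⟨Φ, c1, c2, c3, c4, c5, c6⟩ := exists_pushFamily (hZ.union isClosed_boundary) hK
        (fun p => by rintro (h | h); exacts [hKZ p h, hb p h])
        (Or.inl Set.subset_union_right)
      exact ⟨Φ, c1, c2, c3, c4, fun x z hz => c5 x z (Or.inl hz), c6⟩
    · exact exists_pushFamily hZ hK hKZ (Or.inr hb)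
  let A : Isotopy (insert x Z) (Φ (1, 1)) :=
    { toFun := fun s => Φ (s, 1)
      continuous_uncurry := c1.comp
        ((continuous_fst.prodMk continuous_const).prodMk continuous_snd)
      map_zero := c4 0 (fun t => by rw [h0, h0]) 1
      map_one := rfl
      boundary_iff := fun s z => c6 _ z
      fixes := by
        rintro s z (rfl | hz)
        · nth_rw 1 [← hs0 s]
          rw [c3, hs1]
        · exact c5 _ z hz }
  have hsymm := continuous_symm_family c1
  let B : Isotopy (insert x Z) ((Φ (1, 1))⁻¹ * g) :=
    { toFun := fun t => (Φ (1, t))⁻¹ * G.toFun t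
      continuous_uncurry := hsymm.comp
        ((by fun_prop : Continuous fun y : I × Disc => ((1 : I), y.1)).prodMk G.continuous_uncurry)
      map_zero := by rw [c2, G.map_zero]; rfl
      map_one := by rw [G.map_one]
      boundary_iff := fun t z => by
        rw [← G.boundary_iff t z, ← c6 (1, t)]
        change (Φ (1, t)) ((Φ (1, t)).symm _) ∈ _ ↔ _
        rw [Homeomorph.apply_symm_apply]
        rfl
      fixes := by
        rintro t z (rfl | hz)
        · change (Φ (1, t)).symm (G.toFun t z) = z
          rw [Homeomorph.symm_apply_eq, ← h1, ← c3, hs0]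
        · change (Φ (1, t)).symm (G.toFun t z) = z
          rw [Homeomorph.symm_apply_eq, G.fixes t z hz, c5 _ z hz] }
  have := A.mul B
  rw [mul_inv_cancel_left] at this
  exact ⟨this⟩

/-- The centre of the square. -/
noncomputable def discCenter : Disc :=
  (⟨1 / 2, by norm_num, by norm_num⟩, ⟨1 / 2, by norm_num, by norm_num⟩)

theorem not_mem_boundary {z : Disc} : z ∉ boundary ↔ (0 < z.1 ∧ z.1 < 1) ∧ (0 < z.2 ∧ z.2 < 1) := by
  simp only [boundary, Set.mem_ofPred_eq, not_or]
  constructor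
  · rintro ⟨a, b, c, d⟩
    exact ⟨⟨unitInterval.pos_iff_ne_zero.2 a, unitInterval.lt_one_iff_ne_one.2 b⟩,
      unitInterval.pos_iff_ne_zero.2 c, unitInterval.lt_one_iff_ne_one.2 d⟩
  · rintro ⟨⟨a, b⟩, c, d⟩
    exact ⟨a.ne', b.ne, c.ne', d.ne⟩

theorem interpolate_mem_Ioo {x y t : I} (hy : 0 < y ∧ y < 1) (ht : 0 < t) :
    0 < interpolate x y t ∧ interpolate x y t < 1 := by
  have h1 : (0 : ℝ) ≤ x := x.2.1
  have h2 : (x : ℝ) ≤ 1 := x.2.2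
  have h3 : (0 : ℝ) < y := hy.1
  have h4 : (y : ℝ) < 1 := hy.2
  have h5 : (0 : ℝ) < t := ht
  have h6 : (t : ℝ) ≤ 1 := t.2.2
  constructor
  · change (0 : ℝ) < (1 - (t : ℝ)) * x + t * y
    have := mul_nonneg (sub_nonneg.2 h6) h1
    have := mul_pos h5 h3
    linarith
  · change (1 - (t : ℝ)) * x + t * y < 1
    nlinarith [mul_nonneg (sub_nonneg.2 h6) (sub_nonneg.2 h2), mul_pos h5 (sub_pos.2 h4)]

theorem lerp_not_mem_boundary {x y : Disc} (hy : y ∉ boundary) {t : I} (ht : 0 < t) :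
    lerp x y t ∉ boundary := by
  rw [not_mem_boundary] at hy ⊢
  exact ⟨interpolate_mem_Ioo hy.1 ht, interpolate_mem_Ioo hy.2 ht⟩

theorem discCenter_not_mem_boundary : discCenter ∉ boundary := by
  rw [not_mem_boundary]
  refine ⟨⟨?_, ?_⟩, ?_, ?_⟩ <;>
  · rw [← Subtype.coe_lt_coe]
    simp only [discCenter, Set.Icc.coe_zero, Set.Icc.coe_one]
    norm_num

/-- A map from the square can be pushed off the boundary, relative to the boundary of the square,
in the complement of a closed set. -/
theorem exists_interior_of_square {Q : Set Disc} (hQ : IsClosed Q) {K : I × I → Disc}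
    (hK : Continuous K) (hKQ : ∀ p, K p ∉ Q) :
    ∃ K' : I × I → Disc, Continuous K' ∧ (∀ p, K' p ∉ Q) ∧
      (∀ p ∈ boundary, K' p = K p) ∧ ∀ p, p ∉ boundary → K' p ∉ boundary := by
  have hev : ∀ᶠ η in 𝓝 (0 : I), ∀ p ∈ (Set.univ : Set (I × I)), lerp (K p) discCenter η ∉ Q := by
    refine IsCompact.eventually_forall_of_forall_eventually isCompact_univ fun p _ => ?_
    have hc : Continuous fun z : I × (I × I) => lerp (K z.2) discCenter z.1 := by fun_prop
    refine (hc.tendsto (0, p)).eventually (hQ.isOpen_compl.mem_nhds ?_)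
    simpa using hKQ p
  obtain ⟨δ, hδ, hev⟩ := Metric.eventually_nhds_iff.1 hev
  obtain ⟨η, hη0, hηδ⟩ : ∃ η : I, 0 < η ∧ (η : ℝ) < δ := by
    refine ⟨⟨min (δ / 2) 1, by positivity, min_le_right _ _⟩, ?_, ?_⟩
    · rw [← Subtype.coe_lt_coe]; simp [hδ]
    · exact (min_le_left _ _).trans_lt (by linarith)
  let b : I × I → I := fun p => η * ((p.1 * σ p.1) * (p.2 * σ p.2))
  have hb : Continuous b := by fun_prop
  have hbη : ∀ p, (b p : ℝ) ≤ η := fun p => by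
    have : b p ≤ η := mul_le_of_le_one_right' unitInterval.le_one'
    exact this
  refine ⟨fun p => lerp (K p) discCenter (b p), by fun_prop, fun p => ?_, fun p hp => ?_,
    fun p hp => ?_⟩
  · refine hev ?_ p trivial
    rw [Subtype.dist_eq, Real.dist_eq, Set.Icc.coe_zero, sub_zero, abs_of_nonneg (b p).2.1]
    exact (hbη p).trans_lt hηδ
  · have : b p = 0 := by
      rcases hp with h | h | h | h <;> simp [b, h]
    simp [this]
  · refine lerp_not_mem_boundary discCenter_not_mem_boundary ?_
    rw [not_mem_boundary] at hp
    obtain ⟨⟨a, b'⟩, c, d⟩ := hp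
    have s1 : 0 < σ p.1 := by
      rw [unitInterval.pos_iff_ne_zero]; intro h; exact b'.ne (by simpa using h)
    have s2 : 0 < σ p.2 := by
      rw [unitInterval.pos_iff_ne_zero]; intro h; exact d.ne (by simpa using h)
    have m : ∀ x y : I, 0 < x → 0 < y → 0 < x * y := fun x y hx hy =>
      Subtype.coe_lt_coe.1 (mul_pos (show (0 : ℝ) < x from hx) (show (0 : ℝ) < y from hy))
    exact m _ _ hη0 (m _ _ (m _ _ a s1) (m _ _ c s2))

/-- If `g` is isotopic to the identity relative to `Z ∋ m`, and if `g` maps a path from `m` to an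
interior point `x` to a homotopic path, then the isotopy can be made to fix `x`. -/
theorem Isotopy.insert_interior {Z Q : Set Disc} (hZ : IsClosed Z) (hQ : IsClosed Q)
    (hQZ : Q ⊆ Z) (hZQ : ∀ z ∈ Z, z ∈ Q ∨ z ∈ boundary) {g : Disc ≃ₜ Disc} (G : Isotopy Z g)
    {m x : Disc} (hm : m ∈ Z) (hx : x ∉ boundary) (hgx : g x = x) (γ : Path m x)
    (h : HomotopicIn Qᶜ (g ∘ γ) γ) : Nonempty (Isotopy (insert x Z) g) := by
  have hγ := h.right_mem
  have hGQ : ∀ t z, z ∉ Q → G.toFun t z ∉ Q := by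
    intro t z hz hz'
    have := (G.toFun t).injective (G.fixes t _ (hQZ hz'))
    exact hz (this ▸ hz')
  let l : Path x x := ⟨⟨fun t => G.toFun t x, G.continuous_uncurry.comp
      (continuous_id.prodMk continuous_const)⟩, by simp [G.map_zero], by simp [G.map_one, hgx]⟩
  let r : Path m x := ⟨⟨g ∘ γ, by fun_prop⟩, by
    have := G.fixes 1 m hm
    rw [G.map_one] at this
    simp [this], by simp [hgx]⟩
  have hsq : HomotopicIn Qᶜ (γ.trans l) ((Path.refl m).trans r) := by
    refine HomotopicIn.square γ l (Path.refl m) r (fun z => G.toFun z.1 (γ z.2))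
      (G.continuous_uncurry.comp (continuous_fst.prodMk (γ.continuous.comp continuous_snd)))
      (fun t => ?_) (fun t => ?_) (fun t => ?_)
      (fun t => ?_) fun z => hGQ _ _ (hγ _)
    · simp [G.map_zero]
    · simp [l]
    · simp [G.fixes t m hm]
    · simp [r, G.map_one]
  have hl : ∀ t, l t ∈ Qᶜ := fun t => hGQ _ _ (by simpa using hγ 1)
  have hnull := HomotopicIn.refl_of_trans hγ hl
    ((hsq.trans (HomotopicIn.refl_trans (γ := r) h.left_mem)).trans h)
  obtain ⟨K, k1, k2, k3, k4, k5, k6⟩ := hnull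
  obtain ⟨K', c1, c2, c3, c4⟩ := exists_interior_of_square hQ k1 k6
  have e0 : ∀ t, K' (0, t) = x := fun t => by
    rw [c3 _ (Or.inl rfl), k2]; simp
  have e1 : ∀ t, K' (1, t) = G.toFun t x := fun t => by
    rw [c3 _ (Or.inr (Or.inl rfl)), k3]; rfl
  have e2 : ∀ s, K' (s, 0) = x := fun s => by
    rw [c3 _ (Or.inr (Or.inr (Or.inl rfl))), k4]; simp
  have e3 : ∀ s, K' (s, 1) = x := fun s => by
    rw [c3 _ (Or.inr (Or.inr (Or.inr rfl))), k5]; simp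
  have hKb : ∀ p, K' p ∉ boundary := by
    rintro ⟨s, t⟩
    by_cases hp : (s, t) ∈ boundary
    · have hp' : s = 0 ∨ s = 1 ∨ t = 0 ∨ t = 1 := hp
      rcases hp' with rfl | rfl | rfl | rfl
      · rwa [e0]
      · rw [e1, G.boundary_iff]; exact hx
      · rwa [e2]
      · rwa [e3]
    · exact c4 _ hp
  refine G.insert_of_null hZ c1 e0 e1 e2 e3 (fun p hp => ?_) (Or.inl hKb)
  rcases hZQ _ hp with h | h
  · exact c2 p h
  · exact hKb p h

/-- If `g` is isotopic to the identity relative to a set that contains a boundary point, then the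
isotopy can be made to fix any further boundary point that is fixed by `g`. -/
theorem Isotopy.insert_boundary {Z : Set Disc} (hZ : IsClosed Z) {g : Disc ≃ₜ Disc}
    (G : Isotopy Z g) {m x : Disc} (hm : m ∈ Z) (hmb : m ∈ boundary) (hx : x ∈ boundary)
    (hgx : g x = x) : Nonempty (Isotopy (insert x Z) g) := by
  by_cases hxZ : x ∈ Z
  · rw [Set.insert_eq_of_mem hxZ]; exact ⟨G⟩
  have hm1 : ‖(radial m : ℂ)‖ = 1 := norm_radial_eq_one.2 hmb
  have hm0 : (radial m : ℂ) ≠ 0 := by rw [← norm_ne_zero_iff, hm1]; exact one_ne_zero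
  let P : ℝ → Disc := fun θ => radial.symm ⟨-(radial m : ℂ) * Complex.exp (θ * Complex.I), by
    rw [mem_closedBall_zero_iff, norm_mul, Complex.norm_exp_ofReal_mul_I, norm_neg, hm1, mul_one]⟩
  have hP : Continuous P := by
    refine radial.symm.continuous.comp (Continuous.subtype_mk ?_ _)
    fun_prop
  have hPb : ∀ θ, P θ ∈ boundary := by
    intro θ
    rw [← norm_radial_eq_one]
    simp only [P, radial.apply_symm_apply]
    rw [norm_mul, Complex.norm_exp_ofReal_mul_I, norm_neg, hm1, mul_one]
  let A : Disc → ℂ := fun z => -(radial z : ℂ) / (radial m : ℂ)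
  have hAs : ∀ z ∈ boundary, z ≠ m → A z ∈ Complex.slitPlane := by
    intro z hz hzm
    rw [Complex.mem_slitPlane_iff_arg]
    have hA1 : ‖A z‖ = 1 := by simp [A, hm1, norm_radial_eq_one.2 hz]
    refine ⟨fun h => hzm ?_, fun h => by rw [h] at hA1; simp at hA1⟩
    have h2 := Complex.norm_mul_exp_arg_mul_I (A z)
    rw [hA1, h, Complex.exp_pi_mul_I] at h2
    simp only [A] at h2
    rw [eq_div_iff hm0] at h2
    apply radial.injective
    apply Subtype.ext
    simpa using h2.symm
  have hPA : ∀ z ∈ boundary, P (Complex.arg (A z)) = z := by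
    intro z hz
    have hA1 : ‖A z‖ = 1 := by simp [A, hm1, norm_radial_eq_one.2 hz]
    have h2 := Complex.norm_mul_exp_arg_mul_I (A z)
    rw [hA1, Complex.ofReal_one, one_mul] at h2
    simp only [P]
    rw [Homeomorph.symm_apply_eq]
    apply Subtype.ext
    simp only [h2, A]
    field_simp
  have hGx : ∀ t, G.toFun t x ∈ boundary := fun t => (G.boundary_iff t x).2 hx
  have hGZ : ∀ t, G.toFun t x ∉ Z := by
    intro t h
    have := (G.toFun t).injective (G.fixes t _ h)
    exact hxZ (this ▸ h)
  let θ : I → ℝ := fun t => Complex.arg (A (G.toFun t x))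
  have hθ : Continuous θ := by
    rw [continuous_iff_continuousAt]
    intro t
    refine ContinuousAt.comp (g := Complex.arg) (f := fun t => A (G.toFun t x))
      (Complex.continuousAt_arg (hAs _ (hGx t) fun h => hGZ t (h ▸ hm)))
      (Continuous.continuousAt ?_)
    have h1 : Continuous fun t => G.toFun t x :=
      G.continuous_uncurry.comp (continuous_id.prodMk continuous_const)
    simp only [A]
    fun_prop
  have hPθ : ∀ t, P (θ t) = G.toFun t x := fun t => hPA _ (hGx t)
  have hx0 : P (θ 0) = x := by rw [hPθ, G.map_zero]; rfl
  have hθ1 : θ 1 = θ 0 := by simp only [θ, G.map_zero, G.map_one, hgx]; rfl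
  refine G.insert_of_null hZ (K := fun z => P ((1 - (z.1 : ℝ)) * θ 0 + z.1 * θ z.2))
    (hP.comp (by fun_prop)) (fun t => by simpa using hx0) (fun t => by simpa using hPθ t)
    (fun s => ?_) (fun s => ?_) (fun z => ?_) (Or.inr fun z => hPb _)
  · rw [← hx0]; congr 1; ring
  · rw [← hx0]; congr 1; rw [hθ1]; ring
  · have hmem : (1 - (z.1 : ℝ)) * θ 0 + z.1 * θ z.2 ∈ Set.range θ := by
      refine mem_range_of_exists_le_of_exists_ge hθ ?_ ?_
      · rcases le_total (θ 0) (θ z.2) with h | h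
        · exact ⟨0, by nlinarith [z.1.2.1, z.1.2.2]⟩
        · exact ⟨z.2, by nlinarith [z.1.2.1, z.1.2.2]⟩
      · rcases le_total (θ 0) (θ z.2) with h | h
        · exact ⟨z.2, by nlinarith [z.1.2.1, z.1.2.2]⟩
        · exact ⟨0, by nlinarith [z.1.2.1, z.1.2.2]⟩
    obtain ⟨t, ht⟩ := hmem
    rw [← ht, hPθ]
    exact hGZ t

end Chambord

namespace Chambord

open unitInterval Topology

/-! ### Rotations, and the multiplication of marked points -/

/-- The rotations of the round disc, acting on the square. -/
noncomputable def rot (θ : ℝ) (z : Disc) : Disc :=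
  radial.symm ⟨Complex.exp (θ * Complex.I) * radial z, by
    rw [mem_closedBall_zero_iff, norm_mul, Complex.norm_exp_ofReal_mul_I, one_mul]
    exact mem_closedBall_zero_iff.1 (radial z).2⟩

theorem radial_rot (θ : ℝ) (z : Disc) :
    (radial (rot θ z) : ℂ) = Complex.exp (θ * Complex.I) * radial z := by
  rw [rot, radial.apply_symm_apply]

theorem continuous_rot {X : Type*} [TopologicalSpace X] {θ : X → ℝ} {z : X → Disc}
    (hθ : Continuous θ) (hz : Continuous z) : Continuous fun x => rot (θ x) (z x) := by
  refine radial.symm.continuous.comp (Continuous.subtype_mk ?_ _)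
  fun_prop

@[simp] theorem rot_zero (z : Disc) : rot 0 z = z := by
  apply radial.injective
  apply Subtype.ext
  rw [radial_rot]; simp

theorem rot_mem_boundary {θ : ℝ} {z : Disc} : rot θ z ∈ boundary ↔ z ∈ boundary := by
  rw [← norm_radial_eq_one, ← norm_radial_eq_one, radial_rot, norm_mul,
    Complex.norm_exp_ofReal_mul_I, one_mul]

theorem dist_radial_rot_le (θ : ℝ) (z : Disc) : dist (radial (rot θ z)) (radial z) ≤ |θ| := by
  rw [Subtype.dist_eq, radial_rot, dist_eq_norm]
  have h := norm_exp_mul_I_sub_exp_le θ 0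
  simp only [Complex.ofReal_zero, zero_mul, Complex.exp_zero, sub_zero] at h
  have e : Complex.exp (θ * Complex.I) * (radial z : ℂ) - radial z =
    (Complex.exp (θ * Complex.I) - 1) * radial z := by ring
  rw [e, norm_mul]
  calc _ ≤ |θ| * 1 := by
        gcongr
        exact mem_closedBall_zero_iff.1 (radial z).2
    _ = _ := mul_one _

theorem rot_injective_of_lt {θ θ' : ℝ} {z : Disc} (hz : z ∈ boundary) (h : rot θ z = rot θ' z)
    (hlt : |θ - θ'| < 2 * Real.pi) : θ = θ' := by
  have h1 : Complex.exp (θ * Complex.I) * radial z = Complex.exp (θ' * Complex.I) * radial z := by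
    rw [← radial_rot, ← radial_rot, h]
  have hz0 : (radial z : ℂ) ≠ 0 := by
    rw [← norm_ne_zero_iff, norm_radial_eq_one.2 hz]; exact one_ne_zero
  have h2 := mul_right_cancel₀ hz0 h1
  rw [Complex.exp_eq_exp_iff_exists_int] at h2
  obtain ⟨n, hn⟩ := h2
  have h3 : θ - θ' = n * (2 * Real.pi) := by
    have := congrArg Complex.im hn
    simp at this
    linarith
  rw [h3, abs_mul, abs_of_pos (a := 2 * Real.pi) (by positivity)] at hlt
  have h4 : |(n : ℝ)| < 1 := by
    by_contra hc
    push Not at hc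
    nlinarith [Real.pi_pos]
  have h5 : n = 0 := by
    have : |n| < 1 := by exact_mod_cast h4
    exact Int.abs_lt_one_iff.1 this
  rw [h5] at h3
  simp at h3
  linarith

theorem mem_boundary_of_bottom {z : Disc} (hz : z.2 = 0) : z ∈ boundary := Or.inr (Or.inr (Or.inl hz))

theorem radial_of_bottom {z : Disc} (hz : z.2 = 0) :
    ∃ c : ℝ, 0 < c ∧ (radial z : ℂ) = (c : ℂ) * ((2 * (z.1 : ℝ) - 1 : ℝ) - Complex.I) := by
  have h1 : supNorm (planePoint z) = 1 := supNorm_planePoint_eq_one.2 (mem_boundary_of_bottom hz)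
  have h2 : planePoint z = (2 * (z.1 : ℝ) - 1 : ℝ) - Complex.I := by
    apply Complex.ext <;> simp [planePoint, hz]
  refine ⟨1 / ‖planePoint z‖, ?_, ?_⟩
  · have : planePoint z ≠ 0 := by
      intro h; rw [h] at h1; simp [supNorm] at h1
    have := norm_pos_iff.2 this
    positivity
  · rw [coe_radial, rescale, h1, ← h2]

theorem rot_lt_rot {θ θ' : ℝ} {z : Disc} (h : θ < θ') (h' : θ' - θ < Real.pi)
    (h1 : (rot θ z).2 = 0) (h2 : (rot θ' z).2 = 0) : (rot θ z).1 < (rot θ' z).1 := by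
  obtain ⟨c, hc, e⟩ := radial_of_bottom h1
  obtain ⟨c', hc', e'⟩ := radial_of_bottom h2
  set a : ℝ := 2 * ((rot θ z).1 : ℝ) - 1 with ha
  set a' : ℝ := 2 * ((rot θ' z).1 : ℝ) - 1 with ha'
  have h3 : (radial (rot θ' z) : ℂ)
      = Complex.exp ((θ' - θ : ℝ) * Complex.I) * radial (rot θ z) := by
    rw [radial_rot, radial_rot, ← mul_assoc, ← Complex.exp_add]
    congr 2
    push_cast; ring
  rw [e, e'] at h3
  have h4 := congrArg (fun w : ℂ => (w * (a + Complex.I)).im) h3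
  simp only [Complex.exp_mul_I, ← Complex.ofReal_cos, ← Complex.ofReal_sin] at h4
  simp only [Complex.mul_im, Complex.mul_re, Complex.add_re, Complex.add_im, Complex.sub_re,
    Complex.sub_im, Complex.ofReal_re, Complex.ofReal_im, Complex.I_re, Complex.I_im] at h4
  have hs : 0 < Real.sin (θ' - θ) := Real.sin_pos_of_pos_of_lt_pi (by linarith) h'
  have h5 : c' * (a' - a) = c * (a ^ 2 + 1) * Real.sin (θ' - θ) := by
    linear_combination h4
  have h6 : 0 < c' * (a' - a) := by rw [h5]; positivity
  have h7 : 0 < a' - a := by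
    by_contra hcon
    push Not at hcon
    nlinarith
  have : ((rot θ z).1 : ℝ) < (rot θ' z).1 := by linarith
  exact this

theorem eventually_rot_bottom {z : Disc} (hz : z.2 = 0) (h0 : 0 < z.1) (h1 : z.1 < 1) {δ : ℝ}
    (hδ : 0 < δ) : ∀ᶠ θ in 𝓝 (0 : ℝ), (rot θ z).2 = 0 ∧ ((rot θ z).1 : ℝ) < z.1 + δ := by
  have hc : Continuous fun θ : ℝ => rot θ z := continuous_rot continuous_id continuous_const
  have ht : Filter.Tendsto (fun θ : ℝ => rot θ z) (𝓝 0) (𝓝 z) := by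
    have := hc.tendsto 0
    rwa [rot_zero] at this
  have t1 := (continuous_fst.tendsto z).comp ht
  have t2 := (continuous_snd.tendsto z).comp ht
  have t3 : Filter.Tendsto (fun θ : ℝ => ((rot θ z).1 : ℝ)) (𝓝 0) (𝓝 (z.1 : ℝ)) :=
    (continuous_subtype_val.tendsto _).comp t1
  filter_upwards [t1.eventually (lt_mem_nhds h0), t1.eventually (gt_mem_nhds h1),
    t2.eventually (gt_mem_nhds (hz ▸ zero_lt_one : z.2 < 1)),
    t3.eventually (gt_mem_nhds (lt_add_of_pos_right (z.1 : ℝ) hδ))] with θ a b c d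
  refine ⟨?_, d⟩
  have hb : rot θ z ∈ boundary := rot_mem_boundary.2 (mem_boundary_of_bottom hz)
  rcases hb with h | h | h | h
  · exact absurd h a.ne'
  · exact absurd h b.ne
  · exact h
  · exact absurd h c.ne

/-- An isotopy can be modified so that a further boundary point follows a prescribed path. -/
theorem Isotopy.lift_boundary {f : Disc ≃ₜ Disc} (F : Isotopy ∅ f) {Z : Set Disc}
    (hZ : IsClosed Z) {w : I → Disc} (hw : Continuous w) (hwb : ∀ t, w t ∈ boundary)
    (hwZ : ∀ t, ∀ z ∈ Z, w t ≠ F.toFun t z) :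
    ∃ (g : Disc ≃ₜ Disc) (G : Isotopy ∅ g), (∀ t, ∀ z ∈ Z, G.toFun t z = F.toFun t z) ∧
      ∀ t, G.toFun t (w 0) = w t := by
  let γ : I → Disc := fun t => (F.toFun t).symm (w t)
  have hγ : Continuous γ := F.continuous_symm.comp (continuous_id.prodMk hw)
  have hγZ : ∀ t, γ t ∉ Z := fun t h => hwZ t _ h (by simp [γ])
  have hγb : ∀ t, γ t ∈ boundary := fun t => by
    rw [← F.boundary_iff t]; simpa [γ] using hwb t
  obtain ⟨φ, Φ, hΦ⟩ := exists_push hZ hγ hγZ (Or.inr hγb)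
  let Φ' : Isotopy ∅ φ := ⟨Φ.toFun, Φ.continuous_uncurry, Φ.map_zero, Φ.map_one, Φ.boundary_iff,
    fun _ _ h => h.elim⟩
  refine ⟨f * φ, F.mul Φ', fun t z hz => ?_, fun t => ?_⟩
  · change F.toFun t (Φ.toFun t z) = _
    rw [Φ.fixes t z hz]
  · change F.toFun t (Φ.toFun t (w 0)) = _
    have h0 : γ 0 = w 0 := by simp only [γ, F.map_zero]; rfl
    rw [← h0, hΦ]
    simp [γ]

theorem discConvex_bottom : DiscConvex {z : Disc | z.2 = 0} := by
  intro x hx y hy t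
  simp only [Set.mem_ofPred_eq] at hx hy ⊢
  simp [lerp, hx, hy]

theorem Isotopy.exists_le_dist {f : Disc ≃ₜ Disc} (F : Isotopy ∅ f) {Z : Set Disc} (hZ : Z.Finite)
    (m : Disc) : ∃ d : ℝ, 0 < d ∧ ∀ t, ∀ z ∈ Z, z ≠ m →
      d ≤ dist (radial (F.toFun t m)) (radial (F.toFun t z)) := by
  have hc : ∀ z, Continuous fun t : I => radial (F.toFun t z) := fun z =>
    radial.continuous.comp (F.continuous_uncurry.comp (continuous_id.prodMk continuous_const))
  have h1 : ∀ z, z ≠ m → ∃ d : ℝ, 0 < d ∧ ∀ t,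
      d ≤ dist (radial (F.toFun t m)) (radial (F.toFun t z)) := by
    intro z hz
    obtain ⟨t₀, -, h⟩ := isCompact_univ.exists_isMinOn (Set.univ_nonempty (α := I))
      ((hc m).dist (hc z)).continuousOn
    refine ⟨_, ?_, fun t => isMinOn_iff.1 h t trivial⟩
    rw [dist_pos]
    intro h
    exact hz ((F.toFun t₀).injective (radial.injective h)).symm
  induction Z, hZ using Set.Finite.induction_on with
  | empty => exact ⟨1, one_pos, fun _ _ h => h.elim⟩
  | @insert z Z _ _ ih =>
    obtain ⟨d, hd, h⟩ := ih
    by_cases hz : z = m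
    · refine ⟨d, hd, fun t x hx hxm => ?_⟩
      rcases hx with rfl | hx
      · exact absurd hz hxm
      · exact h t x hx hxm
    · obtain ⟨d', hd', h'⟩ := h1 z hz
      refine ⟨min d d', lt_min hd hd', fun t x hx hxm => ?_⟩
      rcases hx with rfl | hx
      · exact (min_le_right _ _).trans (h' t)
      · exact (min_le_left _ _).trans (h t x hx hxm)

/-- Near a marked point `m` and its image under `f`, one can modify `f`, relative to `Z ∋ m`, so
that it maps finitely many points on the right of `m` to points on the right of `f m`. -/
theorem exists_split {Z : Set Disc} (hZ : Z.Finite) {f : Disc ≃ₜ Disc} (F : Isotopy ∅ f)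
    {m : Disc} (hm : m ∈ Z) (hm2 : m.2 = 0) (hm0 : 0 < m.1) (hm1 : m.1 < 1)
    (hfm2 : (f m).2 = 0) (hfm0 : 0 < (f m).1) (hfm1 : (f m).1 < 1) (n : ℕ) {δ : ℝ} (hδ : 0 < δ) :
    ∃ (g : Disc ≃ₜ Disc) (y y' : ℕ → Disc), Nonempty (Isotopy ∅ g) ∧
      Nonempty (Isotopy Z (f⁻¹ * g)) ∧ y 0 = m ∧ y' 0 = f m ∧
      (∀ i < n, (y i).2 = 0 ∧ (y' i).2 = 0 ∧ ((y i).1 : ℝ) < m.1 + δ ∧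
        ((y' i).1 : ℝ) < (f m).1 + δ ∧ g (y i) = y' i ∧
        HomotopicIn boundary (g ∘ seg m (y i)) (seg (f m) (y' i))) ∧
      ∀ i j, i < j → j < n → (y i).1 < (y j).1 ∧ (y' i).1 < (y' j).1 := by
  obtain ⟨d, hd, hdist⟩ := F.exists_le_dist hZ m
  obtain ⟨η, hη, hrot⟩ := Metric.eventually_nhds_iff.1
    ((eventually_rot_bottom hm2 hm0 hm1 hδ).and (eventually_rot_bottom hfm2 hfm0 hfm1 hδ))
  obtain ⟨ε, hε, hεη, hεd, hεπ⟩ : ∃ ε : ℝ, 0 < ε ∧ n * ε < η ∧ n * ε < d ∧ n * ε < Real.pi := by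
    have hpos : 0 < min η (min d Real.pi) := by positivity
    have hlt : n * (min η (min d Real.pi) / (n + 1)) < min η (min d Real.pi) := by
      rw [mul_div_assoc', div_lt_iff₀ (by positivity)]
      nlinarith
    exact ⟨_, by positivity, hlt.trans_le (min_le_left _ _),
      hlt.trans_le ((min_le_right _ _).trans (min_le_left _ _)),
      hlt.trans_le ((min_le_right _ _).trans (min_le_right _ _))⟩
  have hi : ∀ i : ℕ, i < n → (i : ℝ) * ε < n * ε := fun i h => by
    have : (i : ℝ) < n := by exact_mod_cast h
    gcongr
  have hi0 : ∀ i : ℕ, 0 ≤ (i : ℝ) * ε := fun i => by positivity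
  have hmb := mem_boundary_of_bottom hm2
  have hfmb := mem_boundary_of_bottom hfm2
  have hFmb : ∀ t, F.toFun t m ∈ boundary := fun t => (F.boundary_iff t m).2 hmb
  have hFc : Continuous fun t => F.toFun t m :=
    F.continuous_uncurry.comp (continuous_id.prodMk continuous_const)
  have hmain : ∀ k ≤ n, ∃ (g : Disc ≃ₜ Disc) (G : Isotopy ∅ g),
      (∀ t, ∀ z ∈ Z, G.toFun t z = F.toFun t z) ∧
      ∀ i < k, ∀ t, G.toFun t (rot (i * ε) m) = rot (i * ε) (F.toFun t m) := by
    intro k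
    induction k with
    | zero => exact fun _ => ⟨f, F, fun _ _ _ => rfl, fun i hi => absurd hi (by omega)⟩
    | succ k ih =>
      intro hk
      obtain ⟨g, G, hG1, hG2⟩ := ih (by omega)
      rcases Nat.eq_zero_or_pos k with rfl | hk0
      · refine ⟨g, G, hG1, fun i hi t => ?_⟩
        obtain rfl : i = 0 := by omega
        simp [hG1 t m hm]
      have hfin : (Z ∪ (fun i : ℕ => rot (i * ε) m) '' Set.Iio k).Finite :=
        hZ.union ((Set.finite_Iio k).image _)
      obtain ⟨g', G', h1, h2⟩ := G.lift_boundary hfin.isClosed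
        (w := fun t => rot (k * ε) (F.toFun t m)) (continuous_rot continuous_const hFc)
        (fun t => rot_mem_boundary.2 (hFmb t)) (by
          rintro t z (hz | ⟨i, hik, rfl⟩) he
          · rw [hG1 t z hz] at he
            by_cases hzm : z = m
            · subst hzm
              have h3 : rot (k * ε) (F.toFun t z) = rot 0 (F.toFun t z) := by simpa using he
              have h4 := rot_injective_of_lt (hFmb t) h3 (by
                rw [sub_zero, abs_of_nonneg (hi0 k)]
                linarith [hi k (by omega), Real.pi_pos])
              have : 0 < (k : ℝ) * ε := by positivity
              exact this.ne' h4
            · have h3 := hdist t z hz hzm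
              rw [← he, dist_comm] at h3
              have h4 := h3.trans (dist_radial_rot_le _ _)
              rw [abs_of_nonneg (hi0 k)] at h4
              linarith [hi k (by omega)]
          · have hik' : i < k := hik
            simp only [hG2 i hik' t] at he
            have h4 := rot_injective_of_lt (hFmb t) he (by
              have h5 : (i : ℝ) * ε < k * ε := by
                have : (i : ℝ) < k := by exact_mod_cast hik'
                gcongr
              rw [abs_of_nonneg (by linarith)]
              linarith [hi k (by omega), Real.pi_pos, hi0 i])
            have h5 : (i : ℝ) * ε < k * ε := by
              have : (i : ℝ) < k := by exact_mod_cast hik'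
              gcongr
            exact h5.ne' h4)
      refine ⟨g', G', fun t z hz => (h1 t z (Or.inl hz)).trans (hG1 t z hz), fun i hi t => ?_⟩
      rcases Nat.lt_succ_iff_lt_or_eq.1 hi with hlt | rfl
      · rw [h1 t _ (Or.inr ⟨i, hlt, rfl⟩), hG2 i hlt t]
      · have := h2 t
        simpa [F.map_zero] using this
  obtain ⟨g, G, hG1, hG2⟩ := hmain n le_rfl
  have hGm : ∀ t, G.toFun t m = F.toFun t m := fun t => hG1 t m hm
  have hFm1 : F.toFun 1 m = f m := by rw [F.map_one]
  have hb : ∀ θ, 0 ≤ θ → θ < n * ε → (rot θ m).2 = 0 ∧ (rot θ (f m)).2 = 0 ∧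
      ((rot θ m).1 : ℝ) < m.1 + δ ∧ ((rot θ (f m)).1 : ℝ) < (f m).1 + δ := by
    intro θ h0 h1
    have := hrot (y := θ) (by rw [Real.dist_eq, sub_zero, abs_of_nonneg h0]; linarith)
    exact ⟨this.1.1, this.2.1, this.1.2, this.2.2⟩
  refine ⟨g, fun i => rot (i * ε) m, fun i => rot (i * ε) (f m), ⟨G⟩, ?_, by simp, by simp,
    fun i hin => ?_, fun i j hij hjn => ?_⟩
  · exact ⟨⟨fun t => (F.toFun t)⁻¹ * G.toFun t,
      F.continuous_symm.comp (continuous_fst.prodMk G.continuous_uncurry),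
      by rw [F.map_zero, G.map_zero, inv_one, mul_one], by rw [F.map_one, G.map_one],
      fun t z => by
        rw [← G.boundary_iff t z, ← F.boundary_iff t]
        change (F.toFun t) ((F.toFun t).symm _) ∈ _ ↔ _
        rw [Homeomorph.apply_symm_apply]
        rfl,
      fun t z hz => by
        change (F.toFun t).symm (G.toFun t z) = z
        rw [hG1 t z hz, Homeomorph.symm_apply_apply]⟩⟩
  · obtain ⟨b1, b2, b3, b4⟩ := hb _ (hi0 i) (hi i hin)
    have hgy : g (rot (i * ε) m) = rot (i * ε) (f m) := by
      have := hG2 i hin 1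
      rwa [G.map_one, hFm1] at this
    refine ⟨b1, b2, b3, b4, hgy, ?_⟩
    have hρ : ∀ z : Disc, z.2 = 0 → (∀ θ, 0 ≤ θ → θ < n * ε → (rot θ z).2 = 0) →
        HomotopicIn boundary (fun r : I => rot (r * (i * ε)) z) (seg z (rot (i * ε) z)) := by
      intro z hz hθ
      have h1 : ∀ r : I, (rot (r * (i * ε)) z).2 = 0 := fun r => by
        refine hθ _ (mul_nonneg r.2.1 (hi0 i)) ?_
        have : (r : ℝ) * (i * ε) ≤ 1 * (i * ε) := by
          have := r.2.2
          have := hi0 i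
          gcongr
        linarith [hi i hin]
      refine (discConvex_bottom.homotopicIn (continuous_rot (by fun_prop) continuous_const)
        (seg _ _).continuous (by simp) (by simp) h1
        (fun t => discConvex_bottom.seg_mem hz ?_ t)).mono fun z hz => mem_boundary_of_bottom hz
      simpa using h1 1
    have h1 := (hρ m hm2 fun θ a b => (hb θ a b).1).symm
    have h2 := hρ (f m) hfm2 fun θ a b => (hb θ a b).2.1
    have hgb : ∀ z ∈ boundary, g z ∈ boundary := fun z hz => by
      rw [← G.map_one]; exact (G.boundary_iff 1 z).2 hz
    refine (h1.map g.continuous hgb).trans (HomotopicIn.trans ?_ h2)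
    refine ⟨fun x => g ((G.toFun x.1).symm (rot (x.2 * (i * ε)) (F.toFun x.1 m))), ?_, fun t => ?_,
      fun t => ?_, fun s => ?_, fun s => ?_, fun x => hgb _ ?_⟩
    · refine g.continuous.comp (G.continuous_symm.comp (continuous_fst.prodMk
        (continuous_rot (by fun_prop) (hFc.comp continuous_fst))))
    · simp only [G.map_zero, F.map_zero]; rfl
    · simp only [G.map_one, F.map_one, Homeomorph.apply_symm_apply]
    · simp only [Set.Icc.coe_zero, zero_mul, rot_zero, ← hGm, Homeomorph.symm_apply_apply,
        Function.comp_apply]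
    · simp only [Set.Icc.coe_one, one_mul, ← hG2 i hin, Homeomorph.symm_apply_apply,
        Function.comp_apply]
    · rw [← G.boundary_iff x.1, Homeomorph.apply_symm_apply, rot_mem_boundary]
      exact hFmb _
  · have hlt : (i : ℝ) * ε < j * ε := by
      have : (i : ℝ) < j := by exact_mod_cast hij
      gcongr
    have hj := hi j hjn
    have b1 := hb _ (hi0 i) (hlt.trans hj)
    have b2 := hb _ (hi0 j) hj
    exact ⟨rot_lt_rot hlt (by linarith [hi0 i]) b1.1 b2.1,
      rot_lt_rot hlt (by linarith [hi0 i]) b1.2.1 b2.2.1⟩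

end Chambord

namespace Chambord

open unitInterval Topology

/-! ### Insertion of a puncture next to a marked point -/

/-- Conjugation of an isotopy by a homeomorphism that preserves the boundary. -/
def Isotopy.conj_of {Z Z' : Set Disc} {f : Disc ≃ₜ Disc} (F : Isotopy Z f) (g : Disc ≃ₜ Disc)
    (hb : ∀ z, g z ∈ boundary ↔ z ∈ boundary) (hZ : ∀ z ∈ Z', g.symm z ∈ Z) :
    Isotopy Z' (g * f * g⁻¹) where
  toFun t := g * F.toFun t * g⁻¹
  continuous_uncurry :=
    g.continuous.comp (F.continuous_uncurry.comp
      (continuous_fst.prodMk ((g⁻¹).continuous.comp continuous_snd)))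
  map_zero := by rw [F.map_zero, mul_one, mul_inv_cancel]
  map_one := by rw [F.map_one]
  boundary_iff t z := by
    have h1 := hb (g.symm z)
    rw [g.apply_symm_apply] at h1
    exact (hb _).trans ((F.boundary_iff t _).trans h1.symm)
  fixes t z hz := by
    change g (F.toFun t (g.symm z)) = z
    rw [F.fixes t _ (hZ z hz), g.apply_symm_apply]

/-- The height of the punctures. -/
noncomputable def half : I := ⟨1 / 2, by norm_num, by norm_num⟩

theorem half_pos : (0 : I) < half := by
  rw [← Subtype.coe_lt_coe]; simp [half]

theorem half_lt_one : half < (1 : I) := by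
  rw [← Subtype.coe_lt_coe]; simp [half]; norm_num

/-- The points below the middle line, together with the point `x`. -/
def lowerWith (x : Disc) : Set Disc := {z | z.2 < half ∨ z = x}

theorem coe_lerp_fst (x y : Disc) (t : I) :
    ((lerp x y t).1 : ℝ) = (1 - (t : ℝ)) * x.1 + t * y.1 := rfl

theorem coe_lerp_snd (x y : Disc) (t : I) :
    ((lerp x y t).2 : ℝ) = (1 - (t : ℝ)) * x.2 + t * y.2 := rfl

theorem discConvex_lowerWith {x : Disc} (hx : x.2 = half) : DiscConvex (lowerWith x) := by
  have key : ∀ z ∈ lowerWith x, (z.2 : ℝ) ≤ half := by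
    rintro z (h | rfl)
    · exact h.le
    · rw [hx]
  intro z hz w hw t
  rcases eq_or_ne t 0 with rfl | ht0
  · simpa using hz
  rcases eq_or_ne t 1 with rfl | ht1
  · simpa using hw
  have h0 : (0 : ℝ) < t := unitInterval.pos_iff_ne_zero.2 ht0
  have h1 : (t : ℝ) < 1 := unitInterval.lt_one_iff_ne_one.2 ht1
  have kz := key z hz
  have kw := key w hw
  rcases hz with hz | rfl
  · left
    have hz' : (z.2 : ℝ) < half := hz
    change ((lerp z w t).2 : ℝ) < half
    rw [coe_lerp_snd]
    nlinarith
  · rcases hw with hw | rfl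
    · left
      have hw' : (w.2 : ℝ) < half := hw
      change ((lerp z w t).2 : ℝ) < half
      rw [coe_lerp_snd]
      nlinarith
    · right; simp

theorem lowerWith_subset {x : Disc} {Q : Set Disc} (hQ : ∀ z ∈ Q, z.2 = half) (hx : x ∉ Q) :
    lowerWith x ⊆ Qᶜ := by
  rintro z (h | rfl) hz
  · exact h.ne (hQ z hz)
  · exact hx hz

theorem seg_mem_lowerWith {m x : Disc} (hm : m.2 = 0) (hx : x.2 = half) (t : I) :
    seg m x t ∈ lowerWith x :=
  (discConvex_lowerWith hx).seg_mem (Or.inl (hm ▸ half_pos)) (Or.inr rfl) t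

/-- The points on the left of the line through a bottom point `m` and a middle point `x`, where
the orientation is chosen so that `ε > 0` stands for the left. -/
def sideOf (m x : Disc) (ε : ℝ) : Set Disc :=
  {z | 0 < ε * ((m.1 : ℝ) + 2 * z.2 * ((x.1 : ℝ) - m.1) - z.1)}

theorem isOpen_sideOf (m x : Disc) (ε : ℝ) : IsOpen (sideOf m x ε) :=
  isOpen_lt continuous_const (by fun_prop)

theorem discConvex_sideOf (m x : Disc) (ε : ℝ) : DiscConvex (sideOf m x ε) := by
  intro z hz w hw t
  simp only [sideOf, Set.mem_ofPred_eq] at hz hw ⊢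
  rw [coe_lerp_fst, coe_lerp_snd]
  have h0 : (0 : ℝ) ≤ t := t.2.1
  have h1 : (t : ℝ) ≤ 1 := t.2.2
  have e : ε * ((m.1 : ℝ) + 2 * ((1 - (t : ℝ)) * z.2 + t * w.2) * ((x.1 : ℝ) - m.1)
      - ((1 - (t : ℝ)) * z.1 + t * w.1)) =
      (1 - (t : ℝ)) * (ε * ((m.1 : ℝ) + 2 * z.2 * ((x.1 : ℝ) - m.1) - z.1)) +
      t * (ε * ((m.1 : ℝ) + 2 * w.2 * ((x.1 : ℝ) - m.1) - w.1)) := by ring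
  rw [e]
  rcases eq_or_lt_of_le h0 with h | h
  · rw [← h]; simpa using hz
  · have := mul_nonneg (sub_nonneg.2 h1) hz.le
    have := mul_pos h hw
    linarith

theorem seg_not_mem_sideOf {m x : Disc} (hm : m.2 = 0) (hx : x.2 = half) (ε : ℝ) (t : I) :
    seg m x t ∉ sideOf m x ε := by
  simp only [sideOf, Set.mem_ofPred_eq, seg_apply]
  rw [coe_lerp_fst, coe_lerp_snd, hm, hx]
  simp only [half, Set.Icc.coe_zero]
  have : ε * ((m.1 : ℝ) + 2 * ((1 - (t : ℝ)) * 0 + t * (1 / 2)) * ((x.1 : ℝ) - m.1)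
      - ((1 - (t : ℝ)) * m.1 + t * x.1)) = 0 := by ring
  rw [this]; simp

theorem exists_side {m x m' x' : Disc} (hm : m'.2 = 0) (hx : x'.2 = half) (hmm : m.1 ≠ m'.1)
    (hxx : x.1 ≠ x'.1) (h : x.1 < x'.1 ↔ m.1 < m'.1) :
    ∃ ε, m' ∈ sideOf m x ε ∧ x' ∈ sideOf m x ε := by
  simp only [sideOf, Set.mem_ofPred_eq, hm, hx, half, Set.Icc.coe_zero]
  rcases lt_or_gt_of_ne hmm with h1 | h1
  · have h2 := h.2 h1
    refine ⟨-1, ?_, ?_⟩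
    · have : (m.1 : ℝ) < m'.1 := h1
      linarith
    · have : (x.1 : ℝ) < x'.1 := h2
      linarith
  · have h2 : x'.1 < x.1 := lt_of_le_of_ne (not_lt.1 fun h' => (h.1 h').not_gt h1) hxx.symm
    refine ⟨1, ?_, ?_⟩
    · have : (m'.1 : ℝ) < m.1 := h1
      linarith
    · have : (x'.1 : ℝ) < x.1 := h2
      linarith

/-- Pushing `x` along the segment from `x` to `u` maps the segment from `m` to `x` to a path that is
homotopic to any path from `m` to `u` below the middle line. -/
theorem Isotopy.push_seg {Q : Set Disc} (hQ : ∀ z ∈ Q, z.2 = half) {m x u : Disc}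
    (hm : m.2 = 0) (hx : x.2 = half) (hxQ : x ∉ Q) (hu : u.2 < half) {V : Disc ≃ₜ Disc}
    (F : Isotopy (Q ∪ boundary) V) (hF : ∀ t, F.toFun t x = seg x u t) {δ : I → Disc}
    (hδ : Continuous δ) (hδ0 : δ 0 = m) (hδ1 : δ 1 = u) (hδL : ∀ t, (δ t).2 < half) :
    HomotopicIn Qᶜ (V ∘ seg m x) δ := by
  have hL := lowerWith_subset hQ hxQ
  have hmF : ∀ t, F.toFun t m = m := fun t => F.fixes t m (Or.inr (mem_boundary_of_bottom hm))
  have hVm : V m = m := by have := hmF 1; rwa [F.map_one] at this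
  have hVx : V x = u := by
    have := hF 1
    rw [F.map_one] at this
    simpa using this
  have hsegu : ∀ t, seg x u t ∈ lowerWith x :=
    (discConvex_lowerWith hx).seg_mem (Or.inr rfl) (Or.inl hu)
  let r : Path m u := ⟨⟨V ∘ seg m x, by fun_prop⟩, by simp [hVm], by simp [hVx]⟩
  have hsq : HomotopicIn Qᶜ ((seg m x).trans (seg x u)) ((Path.refl m).trans r) := by
    refine HomotopicIn.square _ _ (Path.refl m) r (fun z => F.toFun z.1 (seg m x z.2))
      (F.continuous_uncurry.comp (continuous_fst.prodMk
        ((seg m x).continuous.comp continuous_snd)))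
      (fun t => ?_) (fun t => ?_) (fun t => ?_) (fun t => ?_) fun z hz => ?_
    · simp [F.map_zero]
    · simp [hF]
    · simp [hmF]
    · simp [r, F.map_one]
    · have := (F.toFun z.1).injective (F.fixes z.1 _ (Or.inl hz))
      exact hL (seg_mem_lowerWith hm hx z.2) (this ▸ hz)
  have hr : ∀ t, r t ∈ Qᶜ := by
    intro t hz
    have h1 := F.fixes 1 (r t) (Or.inl hz)
    rw [F.map_one] at h1
    have := V.injective h1
    exact hL (seg_mem_lowerWith hm hx t) (this ▸ hz)
  refine ((hsq.trans (HomotopicIn.refl_trans hr)).symm).trans ?_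
  refine ((discConvex_lowerWith hx).homotopicIn (Path.continuous _) hδ (by simp [hδ0])
    (by simp [hδ1]) (fun t => ?_) fun t => Or.inl (hδL t)).mono hL
  exact HomotopicIn.trans_mem (seg_mem_lowerWith hm hx) hsegu t

/-- Pushing `x` along a path that avoids a segment preserves this segment up to homotopy. -/
theorem Isotopy.homotopicIn_of_avoid {Z Q : Set Disc} (hQZ : Q ⊆ Z) {V : Disc ≃ₜ Disc}
    (F : Isotopy Z V) {x : Disc} {τ : I → Disc} (hτ : Continuous τ) (h0 : τ 0 ∈ Z) (h1 : τ 1 ∈ Z)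
    (hx : ∀ s t, F.toFun s x ≠ τ t) (hτQ : ∀ t, τ t ∉ Q) :
    HomotopicIn (insert (V x) Q)ᶜ (V ∘ τ) τ := by
  refine ⟨fun z => V ((F.toFun z.1).symm (τ z.2)), V.continuous.comp (F.continuous_symm.comp
    (continuous_fst.prodMk (hτ.comp continuous_snd))), fun t => ?_, fun t => ?_, fun s => ?_,
    fun s => ?_, fun z => ?_⟩
  · simp only [F.map_zero]; rfl
  · simp only [F.map_one, Homeomorph.apply_symm_apply]
  · have : (F.toFun s).symm (τ 0) = τ 0 := by
      rw [Homeomorph.symm_apply_eq, F.fixes s _ h0]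
    simp only [this, Function.comp_apply]
  · have : (F.toFun s).symm (τ 1) = τ 1 := by
      rw [Homeomorph.symm_apply_eq, F.fixes s _ h1]
    simp only [this, Function.comp_apply]
  · rintro (h | h)
    · have h2 := V.injective h
      rw [Homeomorph.symm_apply_eq] at h2
      exact hx _ _ h2.symm
    · have hV := F.fixes 1 _ (hQZ h)
      rw [F.map_one] at hV
      have h2 := V.injective hV
      have h3 : (F.toFun z.1).symm (τ z.2) ∈ Q := by rw [← h2]; exact h
      have h4 := F.fixes z.1 _ (hQZ h3)
      rw [Homeomorph.apply_symm_apply] at h4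
      exact hτQ z.2 (h4 ▸ h3)

/-- A homotopy between paths that avoid a boundary point can be made to avoid a neighbourhood of
this point. -/
theorem HomotopicIn.eventually_insert {Q : Set Disc} (hQ : IsClosed Q) {γ δ : I → Disc}
    (h : HomotopicIn Qᶜ γ δ) {m : Disc} (hm : m ∈ boundary) (hγ : ∀ t, γ t ≠ m)
    (hδ : ∀ t, δ t ≠ m) : ∀ᶠ u in 𝓝 m, HomotopicIn (insert u Q)ᶜ γ δ := by
  obtain ⟨K, k1, k2, k3, k4, k5, k6⟩ := h
  obtain ⟨K', c1, c2, c3, c4⟩ := exists_interior_of_square hQ k1 k6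
  have e0 : ∀ t, K' (0, t) = γ t := fun t => by rw [c3 _ (Or.inl rfl), k2]
  have e1 : ∀ t, K' (1, t) = δ t := fun t => by rw [c3 _ (Or.inr (Or.inl rfl)), k3]
  have e2 : ∀ s, K' (s, 0) = γ 0 := fun s => by rw [c3 _ (Or.inr (Or.inr (Or.inl rfl))), k4]
  have e3 : ∀ s, K' (s, 1) = γ 1 := fun s => by rw [c3 _ (Or.inr (Or.inr (Or.inr rfl))), k5]
  have hmK : m ∉ Set.range K' := by
    rintro ⟨⟨s, t⟩, hst⟩
    by_cases hp : (s, t) ∈ boundary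
    · have hp' : s = 0 ∨ s = 1 ∨ t = 0 ∨ t = 1 := hp
      rcases hp' with rfl | rfl | rfl | rfl
      · exact hγ t (by rw [← e0, hst])
      · exact hδ t (by rw [← e1, hst])
      · exact hγ 0 (by rw [← e2 s, hst])
      · exact hγ 1 (by rw [← e3 s, hst])
    · exact c4 _ hp (hst ▸ hm)
  have hcl : IsClosed (Set.range K') := (isCompact_range c1).isClosed
  filter_upwards [hcl.isOpen_compl.mem_nhds hmK] with u hu
  refine ⟨K', c1, e0, e1, e2, e3, fun z => ?_⟩
  rintro (h | h)
  · exact hu ⟨z, h⟩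
  · exact c2 z h

/-- A new puncture, whose strand is parallel to the wire of `m`, can be inserted while preserving
the parallelism of finitely many other pairs. -/
theorem exists_insert {f : Disc ≃ₜ Disc} (F : Isotopy ∅ f) {Q Q' : Set Disc} (hQ : Q.Finite)
    (hfQ : f '' Q = Q') (hQh : ∀ z ∈ Q, z.2 = half) (hQ'h : ∀ z ∈ Q', z.2 = half)
    (hQb : ∀ z ∈ Q, z ∉ boundary) {m m' x x' : Disc} (hm : m.2 = 0) (hm' : m'.2 = 0)
    (hfm : f m = m') (hx : x.2 = half) (hx' : x'.2 = half) (hxb : x ∉ boundary)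
    (hxb' : x' ∉ boundary) (hxQ : x ∉ Q) (hxQ' : x' ∉ Q') {Λ : Set (Disc × Disc)} (hΛ : Λ.Finite)
    (hΛQ : ∀ l ∈ Λ, l.1 ∈ Q ∧ l.2.2 = 0 ∧ (f l.2).2 = 0 ∧ l.2 ≠ m)
    (hΛx : ∀ l ∈ Λ, (l.1.1 < x.1 ↔ l.2.1 < m.1) ∧ ((f l.1).1 < x'.1 ↔ (f l.2).1 < m'.1))
    (hΛh : ∀ l ∈ Λ, HomotopicIn (Q' \ {f l.1})ᶜ (f ∘ seg l.2 l.1) (seg (f l.2) (f l.1))) :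
    ∃ g : Disc ≃ₜ Disc, Nonempty (Isotopy (Q ∪ boundary) (f⁻¹ * g)) ∧ g x = x' ∧
      HomotopicIn Q'ᶜ (g ∘ seg m x) (seg m' x') ∧
      ∀ l ∈ Λ, HomotopicIn (insert x' (Q' \ {f l.1}))ᶜ (g ∘ seg l.2 l.1)
        (seg (g l.2) (g l.1)) := by
  have hQ' : Q'.Finite := hfQ ▸ hQ.image f
  have hfb : ∀ z, f z ∈ boundary ↔ z ∈ boundary := fun z => by
    have := F.boundary_iff 1 z
    rwa [F.map_one] at this
  have hfQ' : ∀ z, f z ∈ Q' ↔ z ∈ Q := fun z => by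
    rw [← hfQ]; exact f.injective.mem_set_image
  have hmb := mem_boundary_of_bottom hm
  have hmb' := mem_boundary_of_bottom hm'
  have hQb' : ∀ z ∈ Q', z ∉ boundary := by
    rw [← hfQ]
    rintro _ ⟨z, hz, rfl⟩
    rw [hfb]; exact hQb z hz
  -- the sides of the preserved segments
  have hne : ∀ l ∈ Λ, (l.2.1 ≠ m.1 ∧ l.1.1 ≠ x.1) ∧ ((f l.2).1 ≠ m'.1 ∧ (f l.1).1 ≠ x'.1) := by
    intro l hl
    obtain ⟨h1, h2, h3, h4⟩ := hΛQ l hl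
    refine ⟨⟨fun h => h4 (Prod.ext h (h2.trans hm.symm)), fun h => hxQ ?_⟩, fun h => h4 ?_,
      fun h => hxQ' ?_⟩
    · rw [← show l.1 = x from Prod.ext h ((hQh _ h1).trans hx.symm)]; exact h1
    · exact f.injective ((Prod.ext h (h3.trans hm'.symm) : f l.2 = m').trans hfm.symm)
    · have h5 := (hfQ' _).2 h1
      rw [← show f l.1 = x' from Prod.ext h ((hQ'h _ h5).trans hx'.symm)]; exact h5
  have hside : ∀ l ∈ Λ, ∃ ε, m ∈ sideOf l.2 l.1 ε ∧ x ∈ sideOf l.2 l.1 ε := fun l hl =>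
    exists_side hm hx (hne l hl).1.1 (hne l hl).1.2 (hΛx l hl).1
  have hside' : ∀ l ∈ Λ, ∃ ε, m' ∈ sideOf (f l.2) (f l.1) ε ∧ x' ∈ sideOf (f l.2) (f l.1) ε :=
    fun l hl => exists_side hm' hx' (hne l hl).2.1 (hne l hl).2.2 (hΛx l hl).2
  choose! ε hε using hside
  choose! ε' hε' using hside'
  -- the choice of the point `u` on the segment from `m` to `x`
  have hft : Filter.Tendsto (fun u => f u) (𝓝 m) (𝓝 m') := hfm ▸ f.continuous.tendsto m
  have hlow : ∀ᶠ u in 𝓝 m, (f u).2 < half :=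
    hft.eventually ((isOpen_lt continuous_snd continuous_const).mem_nhds
      (show m'.2 < half from hm' ▸ half_pos))
  have hΛev : ∀ᶠ u in 𝓝 m, ∀ l ∈ Λ, f u ∈ sideOf (f l.2) (f l.1) (ε' l) ∧
      HomotopicIn (insert (f u) (Q' \ {f l.1}))ᶜ (f ∘ seg l.2 l.1) (seg (f l.2) (f l.1)) := by
    rw [Filter.eventually_all_finite hΛ]
    intro l hl
    obtain ⟨q1, q2, q3, q4⟩ := hΛQ l hl
    have e1 : ∀ᶠ z in 𝓝 m', z ∈ sideOf (f l.2) (f l.1) (ε' l) :=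
      (isOpen_sideOf _ _ _).mem_nhds (hε' l hl).1
    have e2 := (hΛh l hl).eventually_insert (hQ'.subset Set.sdiff_subset).isClosed hmb'
      (fun t ht => by
        have h1 : seg l.2 l.1 t = m := f.injective (ht.trans hfm.symm)
        exact seg_not_mem_sideOf q2 (hQh _ q1) (ε l) t (h1 ▸ (hε l hl).1)) (fun t ht =>
        seg_not_mem_sideOf q3 (hQ'h _ ((hfQ' _).2 q1)) (ε' l) t (ht ▸ (hε' l hl).1))
    exact hft.eventually (e1.and e2)
  obtain ⟨r, hr0, hr1, hrlow, hrΛ⟩ : ∃ r : I, 0 < r ∧ r < 1 ∧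
      (∀ t ≤ r, (f (seg m x t)).2 < half) ∧ ∀ l ∈ Λ,
      f (seg m x r) ∈ sideOf (f l.2) (f l.1) (ε' l) ∧
      HomotopicIn (insert (f (seg m x r)) (Q' \ {f l.1}))ᶜ (f ∘ seg l.2 l.1)
        (seg (f l.2) (f l.1)) := by
    have ht : Filter.Tendsto (seg m x) (𝓝 0) (𝓝 m) := by
      have := (seg m x).continuous.tendsto 0
      rwa [Path.source] at this
    obtain ⟨δ, hδ, h⟩ := Metric.eventually_nhds_iff.1 (ht.eventually (hlow.and hΛev))
    obtain ⟨r, hr0, hr1, hrδ⟩ : ∃ r : I, 0 < r ∧ r < 1 ∧ (r : ℝ) < δ := by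
      refine ⟨⟨min (δ / 2) (1 / 2), by positivity, (min_le_right _ _).trans (by norm_num)⟩,
        ?_, ?_, ?_⟩
      · rw [← Subtype.coe_lt_coe]; simp [hδ]
      · rw [← Subtype.coe_lt_coe]
        exact (min_le_right _ _).trans_lt (by norm_num)
      · exact (min_le_left _ _).trans_lt (by linarith)
    have hdist : ∀ t : I, t ≤ r → dist t 0 < δ := fun t ht => by
      rw [Subtype.dist_eq, Real.dist_eq, Set.Icc.coe_zero, sub_zero, abs_of_nonneg t.2.1]
      exact lt_of_le_of_lt ht hrδ
    exact ⟨r, hr0, hr1, fun t ht => (h (hdist t ht)).1, (h (hdist r le_rfl)).2⟩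
  set u := seg m x r with hu
  have hub : u ∉ boundary := lerp_not_mem_boundary hxb hr0
  have hu2 : u.2 < half := by
    have hr0' : (0 : ℝ) < r := hr0
    have hr1' : (r : ℝ) < 1 := hr1
    change ((lerp m x r).2 : ℝ) < half
    rw [coe_lerp_snd, hm, hx]
    simp only [Set.Icc.coe_zero, half]
    linarith
  have hfu2 : (f u).2 < half := hrlow r le_rfl
  have hfub : f u ∉ boundary := by rw [hfb]; exact hub
  -- the two pushes
  have hpush : ∀ {R : Set Disc} {z v : Disc}, R.Finite → (∀ z ∈ R, z.2 = half) → z.2 = half →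
      z ∉ R → z ∉ boundary → v ∉ boundary → v.2 < half →
      ∃ (V : Disc ≃ₜ Disc) (G : Isotopy (R ∪ boundary) V), ∀ t, G.toFun t z = seg z v t := by
    intro R z v hR hRh hz hzR hzb hvb hv
    have hav : ∀ t, seg z v t ∉ R ∪ boundary := by
      rintro t (h | h)
      · exact lowerWith_subset hRh hzR
          ((discConvex_lowerWith hz).seg_mem (Or.inr rfl) (Or.inl hv) t) h
      · rcases eq_or_ne t 0 with rfl | ht
        · rw [Path.source] at h; exact hzb h
        · exact lerp_not_mem_boundary hvb (unitInterval.pos_iff_ne_zero.2 ht) h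
    obtain ⟨V, G, hG⟩ := exists_push (hR.isClosed.union isClosed_boundary)
      (seg z v).continuous hav (Or.inl Set.subset_union_right)
    exact ⟨V, G, fun t => by simpa using hG t⟩
  obtain ⟨V, G, hG⟩ := hpush hQ hQh hx hxQ hxb hub hu2
  obtain ⟨W, G', hG'⟩ := hpush hQ' hQ'h hx' hxQ' hxb' hfub hfu2
  have hVx : V x = u := by
    have := hG 1
    rw [G.map_one] at this
    simpa using this
  have hWx : W x' = f u := by
    have := hG' 1
    rw [G'.map_one] at this
    simpa using this
  have hVfix : ∀ z, z ∈ Q ∪ boundary → V z = z := fun z hz => by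
    have := G.fixes 1 z hz
    rwa [G.map_one] at this
  have hWfix : ∀ z, z ∈ Q' ∪ boundary → W z = z := fun z hz => by
    have := G'.fixes 1 z hz
    rwa [G'.map_one] at this
  have hWfix' : ∀ z, z ∈ Q' ∪ boundary → W.symm z = z := fun z hz => by
    rw [Homeomorph.symm_apply_eq, hWfix z hz]
  have hWmem : ∀ z ∈ Q', ∀ y, W.symm y = z → y = z := fun z hz y h => by
    rw [Homeomorph.symm_apply_eq, hWfix z (Or.inl hz)] at h; exact h
  refine ⟨W⁻¹ * f * V, ?_, ?_, ?_, fun l hl => ?_⟩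
  · have h1 := G'.inv.conj_of f⁻¹ (Z' := Q ∪ boundary) (fun z => by
        have := hfb (f.symm z)
        rw [Homeomorph.apply_symm_apply] at this
        exact this.symm) (by
        rintro z (hz | hz)
        · exact Or.inl ((hfQ' z).2 hz)
        · exact Or.inr ((hfb z).2 hz))
    have h2 := h1.mul G
    have e : f⁻¹ * W⁻¹ * f⁻¹⁻¹ * V = f⁻¹ * (W⁻¹ * f * V) := by group
    exact ⟨e ▸ h2⟩
  · change W.symm (f (V x)) = x'
    rw [hVx, ← hWx, Homeomorph.symm_apply_apply]
  · let δ : I → Disc := fun t => seg m x (t * r)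
    have hδ : Continuous δ := by fun_prop
    have hr0' : (0 : ℝ) < r := hr0
    have hr1' : (r : ℝ) < 1 := hr1
    have htr : ∀ t : I, t * r ≤ r := fun t => mul_le_of_le_one_left' unitInterval.le_one'
    have h1 := G.push_seg hQh hm hx hxQ hu2 hG hδ (by simp [δ]) (by simp [δ, hu]) (fun t => by
      have h2 : ((t * r : I) : ℝ) ≤ r := htr t
      change ((lerp m x (t * r)).2 : ℝ) < half
      rw [coe_lerp_snd, hm, hx]
      simp only [Set.Icc.coe_zero, half]
      linarith)
    have h2 := G'.push_seg hQ'h hm' hx' hxQ' hfu2 hG' (δ := f ∘ δ) (by fun_prop)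
      (by simp [δ, hfm]) (by simp [δ, hu]) (fun t => hrlow _ (htr t))
    have h3 := (h1.map f.continuous (V := Q'ᶜ) fun z hz h => hz ((hfQ' z).1 h)).trans h2.symm
    have h4 := h3.map W.symm.continuous (V := Q'ᶜ) fun z hz h => hz (by
      have := hWmem _ h z rfl
      rwa [this])
    have e : W.symm ∘ W ∘ seg m' x' = seg m' x' := by
      funext t; exact W.symm_apply_apply _
    rw [e] at h4
    exact h4
  · obtain ⟨q1, q2, q3, q4⟩ := hΛQ l hl
    have hfl := (hfQ' l.1).2 q1
    have hVτ := G.homotopicIn_of_avoid (Q := Q \ {l.1}) (x := x) (τ := seg l.2 l.1)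
      (Set.sdiff_subset.trans Set.subset_union_left) (Path.continuous _)
      (by simp [mem_boundary_of_bottom q2]) (by simp [q1]) (fun s t h => by
        have hxS := (hε l hl).2
        have huS : u ∈ sideOf l.2 l.1 (ε l) := (discConvex_sideOf _ _ _).seg_mem (hε l hl).1 hxS r
        rw [hG] at h
        exact seg_not_mem_sideOf q2 (hQh _ q1) (ε l) t
          (h ▸ (discConvex_sideOf _ _ _).seg_mem hxS huS s))
      (fun t => lowerWith_subset (fun z hz => hQh z hz.1) (fun h => h.2 rfl)
        (seg_mem_lowerWith q2 (hQh _ q1) t))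
    have hWτ := G'.homotopicIn_of_avoid (Q := Q' \ {f l.1}) (x := x') (τ := seg (f l.2) (f l.1))
      (Set.sdiff_subset.trans Set.subset_union_left) (Path.continuous _)
      (by simp [mem_boundary_of_bottom q3]) (by simp [hfl]) (fun s t h => by
        have hxS := (hε' l hl).2
        rw [hG'] at h
        exact seg_not_mem_sideOf q3 (hQ'h _ hfl) (ε' l) t
          (h ▸ (discConvex_sideOf _ _ _).seg_mem hxS (hrΛ l hl).1 s))
      (fun t => lowerWith_subset (fun z hz => hQ'h z hz.1) (fun h => h.2 rfl)
        (seg_mem_lowerWith q3 (hQ'h _ hfl) t))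
    rw [hVx] at hVτ
    rw [hWx] at hWτ
    have h1 := hVτ.map f.continuous (V := (insert (f u) (Q' \ {f l.1}))ᶜ) (by
      rintro z hz (h | h)
      · exact hz (Or.inl (f.injective h))
      · exact hz (Or.inr ⟨(hfQ' z).1 h.1, fun h' => h.2 (congrArg f h')⟩))
    have h2 := (h1.trans (hrΛ l hl).2).trans hWτ.symm
    have h3 := h2.map W.symm.continuous (V := (insert x' (Q' \ {f l.1}))ᶜ) (by
      rintro z hz (h | h)
      · rw [Homeomorph.symm_apply_eq, hWx] at h
        exact hz (Or.inl h)
      · have := hWmem _ h.1 z rfl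
        rw [← this] at h
        exact hz (Or.inr h))
    have e : W.symm ∘ W ∘ seg (f l.2) (f l.1) = seg (f l.2) (f l.1) := by
      funext t; exact W.symm_apply_apply _
    have e1 : (W⁻¹ * f * V) l.2 = f l.2 := by
      change W.symm (f (V l.2)) = _
      rw [hVfix _ (Or.inr (mem_boundary_of_bottom q2)),
        hWfix' _ (Or.inr (mem_boundary_of_bottom q3))]
    have e2 : (W⁻¹ * f * V) l.1 = f l.1 := by
      change W.symm (f (V l.1)) = _
      rw [hVfix _ (Or.inl q1), hWfix' _ (Or.inl hfl)]
    rw [e] at h3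
    rw [e1, e2]
    exact h3

end Chambord

namespace Chambord

open unitInterval Topology

/-! ### Relative isotopy classes -/

/-- The homeomorphisms `f` and `g` are isotopic relative to `Z`. -/
def IsotopicRel (Z : Set Disc) (f g : Disc ≃ₜ Disc) : Prop := Nonempty (Isotopy Z (f⁻¹ * g))

/-- The homeomorphism `h` preserves the boundary. -/
def PreservesBoundary (h : Disc ≃ₜ Disc) : Prop := ∀ z, h z ∈ boundary ↔ z ∈ boundary

theorem PreservesBoundary.inv {h : Disc ≃ₜ Disc} (hh : PreservesBoundary h) :
    PreservesBoundary h⁻¹ := fun z => by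
  have := hh (h.symm z)
  rw [Homeomorph.apply_symm_apply] at this
  exact this.symm

theorem Isotopy.preservesBoundary {Z : Set Disc} {h : Disc ≃ₜ Disc} (F : Isotopy Z h) :
    PreservesBoundary h := fun z => by
  have := F.boundary_iff 1 z
  rwa [F.map_one] at this

/-- Forgetting a part of the set that is fixed. -/
def Isotopy.restrict {Z Z' : Set Disc} {f : Disc ≃ₜ Disc} (F : Isotopy Z f) (h : Z' ⊆ Z) :
    Isotopy Z' f :=
  ⟨F.toFun, F.continuous_uncurry, F.map_zero, F.map_one, F.boundary_iff,
    fun t z hz => F.fixes t z (h hz)⟩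

namespace IsotopicRel

variable {Z Z' : Set Disc} {f g k h : Disc ≃ₜ Disc}

theorem refl (Z : Set Disc) (f : Disc ≃ₜ Disc) : IsotopicRel Z f f := by
  have := Isotopy.refl Z
  rw [← inv_mul_cancel f] at this
  exact ⟨this⟩

theorem trans (h : IsotopicRel Z f g) (h' : IsotopicRel Z g k) : IsotopicRel Z f k := by
  obtain ⟨F⟩ := h
  obtain ⟨G⟩ := h'
  have := F.mul G
  rw [show f⁻¹ * g * (g⁻¹ * k) = f⁻¹ * k by group] at this
  exact ⟨this⟩

theorem mono (h : IsotopicRel Z f g) (hZ : Z' ⊆ Z) : IsotopicRel Z' f g := by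
  obtain ⟨F⟩ := h
  exact ⟨F.restrict hZ⟩

theorem mul_left (k : Disc ≃ₜ Disc) (h : IsotopicRel Z f g) : IsotopicRel Z (k * f) (k * g) := by
  obtain ⟨F⟩ := h
  rw [show f⁻¹ * g = (k * f)⁻¹ * (k * g) by group] at F
  exact ⟨F⟩

theorem mul_right (hfg : IsotopicRel Z f g) (hh : PreservesBoundary h)
    (hZ : ∀ z ∈ Z', h z ∈ Z) : IsotopicRel Z' (f * h) (g * h) := by
  obtain ⟨F⟩ := hfg
  have := F.conj_of h⁻¹ hh.inv (Z' := Z') hZ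
  rw [show h⁻¹ * (f⁻¹ * g) * h⁻¹⁻¹ = (f * h)⁻¹ * (g * h) by group] at this
  exact ⟨this⟩

theorem apply_eq (h : IsotopicRel Z f g) {z : Disc} (hz : z ∈ Z) : f z = g z := by
  obtain ⟨F⟩ := h
  have := F.fixes 1 z hz
  rw [F.map_one] at this
  change f.symm (g z) = z at this
  rw [Homeomorph.symm_apply_eq] at this
  exact this.symm

end IsotopicRel

theorem braidClass_eq_iff {p q : ℕ} {f g : homeoGroup p q} :
    braidClass f = braidClass g ↔ IsotopicRel (punctures p ∪ marks q) f.1 g.1 := by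
  rw [braidClass, braidClass, QuotientGroup.eq]
  rfl

theorem homeoGroup.preservesBoundary {p q : ℕ} (f : homeoGroup p q) : PreservesBoundary f.1 := by
  obtain ⟨F⟩ := f.2.1
  exact F.preservesBoundary

/-! ### Slides -/

/-- The homeomorphism that acts by `φ` on horizontal lines. -/
noncomputable def slideHomeo (φ : Disc → I) (hφ : Continuous φ)
    (hm : ∀ x x' y, x < x' → φ (x, y) < φ (x', y)) (h0 : ∀ y, φ (0, y) = 0)
    (h1 : ∀ y, φ (1, y) = 1) : Disc ≃ₜ Disc :=
  have hb : Function.Bijective fun z : Disc => ((φ z, z.2) : Disc) := by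
    constructor
    · rintro ⟨x, y⟩ ⟨x', y'⟩ h
      simp only [Prod.mk.injEq] at h
      obtain ⟨e, rfl⟩ := h
      have : StrictMono fun x => φ (x, y) := fun a b hab => hm a b y hab
      rw [this.injective e]
    · rintro ⟨x, y⟩
      have : x ∈ Set.range fun x => φ (x, y) :=
        mem_range_of_exists_le_of_exists_ge (by fun_prop)
          ⟨0, by simp [h0]⟩ ⟨1, by simp [h1, unitInterval.le_one']⟩
      obtain ⟨a, ha⟩ := this
      exact ⟨(a, y), by simp only [ha]⟩
  (show Continuous fun z : Disc => ((φ z, z.2) : Disc) by fun_prop).homeoOfEquivCompactToT2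
    (f := Equiv.ofBijective _ hb)

theorem slideHomeo_apply (φ : Disc → I) (hφ : Continuous φ)
    (hm : ∀ x x' y, x < x' → φ (x, y) < φ (x', y)) (h0 : ∀ y, φ (0, y) = 0)
    (h1 : ∀ y, φ (1, y) = 1) (z : Disc) : slideHomeo φ hφ hm h0 h1 z = (φ z, z.2) := rfl

theorem isSlide_slideHomeo (φ : Disc → I) (hφ : Continuous φ)
    (hm : ∀ x x' y, x < x' → φ (x, y) < φ (x', y)) (h0 : ∀ y, φ (0, y) = 0)
    (h1 : ∀ y, φ (1, y) = 1) : IsSlide (slideHomeo φ hφ hm h0 h1) where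
  height _ := rfl
  mono := by
    rintro ⟨x, y⟩ ⟨x', y'⟩ (rfl : y = y') h
    exact hm x x' y h

namespace IsSlide

variable {h k : Disc ≃ₜ Disc}

theorem one : IsSlide 1 := ⟨fun _ => rfl, fun _ _ _ h => h⟩

theorem mul (hh : IsSlide h) (hk : IsSlide k) : IsSlide (h * k) :=
  ⟨fun z => (hh.height _).trans (hk.height z), fun z z' e hlt =>
    hh.mono _ _ ((hk.height z).trans (e.trans (hk.height z').symm)) (hk.mono z z' e hlt)⟩

theorem lt_iff (hh : IsSlide h) {z z' : Disc} (e : z.2 = z'.2) :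
    (h z).1 < (h z').1 ↔ z.1 < z'.1 := by
  refine ⟨fun hlt => ?_, hh.mono z z' e⟩
  by_contra hn
  rcases lt_or_eq_of_le (not_lt.1 hn) with h1 | h1
  · exact (hh.mono z' z e.symm h1).not_gt hlt
  · rw [Prod.ext h1.symm e] at hlt; exact hlt.false

theorem inv (hh : IsSlide h) : IsSlide h⁻¹ := by
  have e : ∀ z, (h⁻¹ z).2 = z.2 := fun z => by
    rw [← hh.height]
    change (h (h.symm z)).2 = _
    rw [h.apply_symm_apply]
  refine ⟨e, fun z z' hz hlt => ?_⟩
  rw [← hh.lt_iff ((e z).trans (hz.trans (e z').symm))]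
  change (h (h.symm z)).1 < (h (h.symm z')).1
  simpa using hlt

theorem apply_zero (hh : IsSlide h) (y : I) : h (0, y) = (0, y) := by
  refine Prod.ext ?_ (hh.height _)
  by_contra hne
  have h1 : (0 : I) < (h (0, y)).1 := unitInterval.pos_iff_ne_zero.2 hne
  have h2 := hh.inv.mono (0, y) (h (0, y)) (hh.height _).symm h1
  change _ < (h.symm (h (0, y))).1 at h2
  rw [h.symm_apply_apply] at h2
  exact absurd h2 (not_lt.2 unitInterval.nonneg')

theorem apply_one (hh : IsSlide h) (y : I) : h (1, y) = (1, y) := by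
  refine Prod.ext ?_ (hh.height _)
  by_contra hne
  have h1 : (h (1, y)).1 < (1 : I) := unitInterval.lt_one_iff_ne_one.2 hne
  have h2 := hh.inv.mono (h (1, y)) (1, y) (hh.height _) h1
  change (h.symm (h (1, y))).1 < _ at h2
  rw [h.symm_apply_apply] at h2
  exact absurd h2 (not_lt.2 unitInterval.le_one')

theorem preservesBoundary (hh : IsSlide h) : PreservesBoundary h := by
  have key : ∀ {g : Disc ≃ₜ Disc}, IsSlide g → ∀ z ∈ boundary, g z ∈ boundary := by
    intro g hg
    rintro ⟨x, y⟩ (h' | h' | h' | h') <;> simp only at h' <;> subst h'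
    · rw [hg.apply_zero]; exact Or.inl rfl
    · rw [hg.apply_one]; exact Or.inr (Or.inl rfl)
    · exact Or.inr (Or.inr (Or.inl (hg.height _)))
    · exact Or.inr (Or.inr (Or.inr (hg.height _)))
  intro z
  refine ⟨fun hz => ?_, key hh z⟩
  have := key hh.inv _ hz
  change h.symm (h z) ∈ _ at this
  rwa [h.symm_apply_apply] at this

theorem isotopicRel (hh : IsSlide h) (hk : IsSlide k) {Z : Set Disc} (hZ : ∀ z ∈ Z, h z = k z) :
    IsotopicRel Z h k := by
  have hlt : ∀ t x x' y, x < x' → interpolate (h (x, y)).1 (k (x, y)).1 t <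
      interpolate (h (x', y)).1 (k (x', y)).1 t := by
    intro t x x' y hx
    have a : ((h (x, y)).1 : ℝ) < (h (x', y)).1 := hh.mono _ _ rfl hx
    have b : ((k (x, y)).1 : ℝ) < (k (x', y)).1 := hk.mono _ _ rfl hx
    have h0 : (0 : ℝ) ≤ t := t.2.1
    have h1 : (t : ℝ) ≤ 1 := t.2.2
    change (1 - (t : ℝ)) * (h (x, y)).1 + t * (k (x, y)).1 <
      (1 - (t : ℝ)) * (h (x', y)).1 + t * (k (x', y)).1
    rcases eq_or_lt_of_le h0 with e | e
    · rw [← e]; simpa using a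
    · have := mul_le_mul_of_nonneg_left a.le (sub_nonneg.2 h1)
      have := mul_lt_mul_of_pos_left b e
      linarith
  let Φ : I → (Disc ≃ₜ Disc) := fun t =>
    slideHomeo (fun z => interpolate (h z).1 (k z).1 t) (by fun_prop) (hlt t)
      (fun y => by simp [hh.apply_zero, hk.apply_zero])
      (fun y => by simp [hh.apply_one, hk.apply_one])
  have hΦ : ∀ t z, Φ t z = (interpolate (h z).1 (k z).1 t, z.2) := fun t z => rfl
  refine ⟨⟨fun t => h⁻¹ * Φ t, ?_, ?_, ?_, fun t z => ?_, fun t z hz => ?_⟩⟩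
  · refine (h⁻¹).continuous.comp ?_
    change Continuous fun x : I × Disc => ((interpolate (h x.2).1 (k x.2).1 x.1, x.2.2) : Disc)
    fun_prop
  · rw [show Φ 0 = h from by ext z : 1; rw [hΦ]; exact Prod.ext (by simp) (hh.height z).symm]
    exact inv_mul_cancel h
  · rw [show Φ 1 = k from by ext z : 1; rw [hΦ]; exact Prod.ext (by simp) (hk.height z).symm]
  · exact (hh.preservesBoundary.inv _).trans ((isSlide_slideHomeo _ _ _ _ _).preservesBoundary z)
  · change h.symm (Φ t z) = z
    rw [Homeomorph.symm_apply_eq, hΦ, ← hZ z hz]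
    exact Prod.ext (by simp) (hh.height z).symm

theorem isotopy (hh : IsSlide h) : Nonempty (Isotopy ∅ h) := by
  have := one.isotopicRel hh (Z := ∅) fun _ hz => hz.elim
  rwa [IsotopicRel, inv_one, one_mul] at this

end IsSlide

/-! ### Existence of slides -/

/-- An increasing homeomorphism of the interval that is the identity on `[0, c]`, and that maps `u`
to `v`. -/
theorem exists_strictMono_step {c u v : I} (hcu : c < u) (hcv : c < v) (hu : u < 1) (hv : v < 1) :
    ∃ φ : I → I, Continuous φ ∧ StrictMono φ ∧ φ 0 = 0 ∧ φ 1 = 1 ∧ (∀ x ≤ c, φ x = x) ∧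
      φ u = v := by
  have hcu' : (c : ℝ) < u := hcu
  have hcv' : (c : ℝ) < v := hcv
  have hu' : (u : ℝ) < 1 := hu
  have hv' : (v : ℝ) < 1 := hv
  have hc1 : (0 : ℝ) < 1 - c := by linarith
  have hc0 : (0 : ℝ) ≤ c := c.2.1
  set b : ℝ := ((u : ℝ) - c) / (1 - c) with hb
  set d : ℝ := ((v : ℝ) - c) / (1 - c) with hd
  have hb0 : 0 < b := div_pos (by linarith) hc1
  have hb1 : b < 1 := by rw [hb, div_lt_one hc1]; linarith
  have hd0 : 0 < d := div_pos (by linarith) hc1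
  have hd1 : d < 1 := by rw [hd, div_lt_one hc1]; linarith
  set α := Real.logb b d with hα
  have hα0 : 0 < α := Real.logb_pos_of_base_lt_one hb0 hb1 hd0 hd1
  let F : ℝ → ℝ := fun z => min z c + (1 - c) * (max (z - c) 0 / (1 - c)) ^ α
  have hFc : Continuous F := by
    have h1 : Continuous fun z : ℝ => (max (z - c) 0 / (1 - c)) ^ α :=
      Continuous.rpow_const (by fun_prop) fun _ => Or.inr hα0.le
    fun_prop
  have hF : ∀ z z' : ℝ, z < z' → F z < F z' := by
    intro z z' hz
    rcases le_or_gt z' c with h | h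
    · have e1 : F z = z := by
        simp only [F, min_eq_left (hz.le.trans h), max_eq_right (sub_nonpos.2 (hz.le.trans h)),
          zero_div, Real.zero_rpow hα0.ne', mul_zero, add_zero]
      have e2 : F z' = z' := by
        simp only [F, min_eq_left h, max_eq_right (sub_nonpos.2 h),
          zero_div, Real.zero_rpow hα0.ne', mul_zero, add_zero]
      rw [e1, e2]; exact hz
    · have h1 : min z (c : ℝ) ≤ min z' c := min_le_min hz.le le_rfl
      have h2 : max (z - c) 0 < max (z' - c) 0 := by
        rw [max_eq_left (a := z' - c) (by linarith)]
        exact max_lt (by linarith) (by linarith)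
      have h3 : (max (z - c) 0 / (1 - c)) ^ α < (max (z' - c) 0 / (1 - c)) ^ α :=
        Real.rpow_lt_rpow (by positivity) (by gcongr) hα0
      have := mul_lt_mul_of_pos_left h3 hc1
      simp only [F]
      linarith
  have hFid : ∀ z : ℝ, z ≤ c → F z = z := by
    intro z h
    simp only [F, min_eq_left h, max_eq_right (sub_nonpos.2 h),
      zero_div, Real.zero_rpow hα0.ne', mul_zero, add_zero]
  have hF1 : F 1 = 1 := by
    simp only [F, min_eq_right (show (c : ℝ) ≤ 1 by linarith),
      max_eq_left (show (0 : ℝ) ≤ 1 - c by linarith), div_self hc1.ne', Real.one_rpow]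
    ring
  have hF0 : F 0 = 0 := hFid 0 hc0
  have hmono : StrictMono F := fun z z' h => hF z z' h
  refine ⟨fun z => ⟨F z, ?_, ?_⟩, by fun_prop, fun z z' h => ?_, Subtype.ext hF0,
    Subtype.ext hF1, fun z hz => Subtype.ext (hFid z hz), Subtype.ext ?_⟩
  · rw [← hF0]; exact hmono.monotone z.2.1
  · rw [← hF1]; exact hmono.monotone z.2.2
  · exact hmono h
  · simp only [F, min_eq_right hcu'.le, max_eq_left (sub_nonneg.2 hcu'.le)]
    rw [← hb, hα, Real.rpow_logb hb0 hb1.ne hd0, hd]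
    field_simp
    ring

/-- Interpolation by increasing homeomorphisms of the interval. -/
theorem exists_strictMono_interpolation {ι : Type*} (s : Finset ι) (u v : ι → I)
    (hu : ∀ a ∈ s, u a < 1) (hu0 : ∀ a ∈ s, 0 < u a) (hv : ∀ a ∈ s, v a < 1)
    (hv0 : ∀ a ∈ s, 0 < v a) (h : ∀ a ∈ s, ∀ b ∈ s, u a < u b ↔ v a < v b) :
    ∃ φ : I → I, Continuous φ ∧ StrictMono φ ∧ φ 0 = 0 ∧ φ 1 = 1 ∧ ∀ a ∈ s, φ (u a) = v a := by
  classical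
  induction s using Finset.induction_on_max_value (f := u) with
  | empty => exact ⟨id, continuous_id, strictMono_id, rfl, rfl, by simp⟩
  | insert a s ha hmax ih =>
    obtain ⟨φ, c1, c2, c3, c4, c5⟩ := ih (fun b hb => hu b (Finset.mem_insert_of_mem hb))
      (fun b hb => hu0 b (Finset.mem_insert_of_mem hb))
      (fun b hb => hv b (Finset.mem_insert_of_mem hb))
      (fun b hb => hv0 b (Finset.mem_insert_of_mem hb))
      (fun b hb b' hb' => h b (Finset.mem_insert_of_mem hb) b' (Finset.mem_insert_of_mem hb'))
    have has := Finset.mem_insert_self a s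
    by_cases hex : ∃ b ∈ s, u b = u a
    · obtain ⟨b, hb, hab⟩ := hex
      have hbs := Finset.mem_insert_of_mem (a := b) (b := a) hb
      have hv' : v b = v a := by
        have h1 := h a has b hbs
        have h2 := h b hbs a has
        rw [hab] at h1 h2
        exact le_antisymm (not_lt.1 fun hlt => (lt_irrefl _ (h1.2 hlt)))
          (not_lt.1 fun hlt => (lt_irrefl _ (h2.2 hlt)))
      refine ⟨φ, c1, c2, c3, c4, fun x hx => ?_⟩
      rcases Finset.mem_insert.1 hx with rfl | hx
      · rw [← hab, ← hv', c5 b hb]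
      · exact c5 x hx
    · push Not at hex
      have hlt : ∀ b ∈ s, u b < u a := fun b hb => lt_of_le_of_ne (hmax b hb) (hex b hb)
      have hlt' : ∀ b ∈ s, v b < v a := fun b hb =>
        (h b (Finset.mem_insert_of_mem hb) a has).1 (hlt b hb)
      obtain ⟨ψ, d1, d2, d3, d4, d5, d6⟩ := exists_strictMono_step (c := s.sup v) (u := φ (u a))
        (v := v a)
        ((Finset.sup_lt_iff (by
          change 0 < φ (u a)
          rw [← c3]; exact c2 (hu0 a has))).2 fun b hb => by
            rw [← c5 b hb]; exact c2 (hlt b hb))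
        ((Finset.sup_lt_iff (hv0 a has)).2 hlt')
        (by rw [← c4]; exact c2 (hu a has)) (hv a has)
      refine ⟨ψ ∘ φ, d1.comp c1, d2.comp c2, by simp [c3, d3], by simp [c4, d4], fun x hx => ?_⟩
      rcases Finset.mem_insert.1 hx with rfl | hx
      · exact d6
      · simp only [Function.comp_apply, c5 x hx]
        exact d5 _ (Finset.le_sup hx)

/-- There is a slide with prescribed values on the middle line and on the bottom side. -/
theorem exists_slide {ι κ : Type*} (s : Finset ι) (u v : ι → I) (s' : Finset κ) (u' v' : κ → I)
    (hu : ∀ a ∈ s, 0 < u a ∧ u a < 1) (hv : ∀ a ∈ s, 0 < v a ∧ v a < 1)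
    (h : ∀ a ∈ s, ∀ b ∈ s, u a < u b ↔ v a < v b)
    (hu' : ∀ a ∈ s', 0 < u' a ∧ u' a < 1) (hv' : ∀ a ∈ s', 0 < v' a ∧ v' a < 1)
    (h' : ∀ a ∈ s', ∀ b ∈ s', u' a < u' b ↔ v' a < v' b) :
    ∃ k : Disc ≃ₜ Disc, IsSlide k ∧ (∀ a ∈ s, k (u a, half) = (v a, half)) ∧
      ∀ a ∈ s', k (u' a, 0) = (v' a, 0) := by
  obtain ⟨φ, c1, c2, c3, c4, c5⟩ := exists_strictMono_interpolation s u v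
    (fun a ha => (hu a ha).2) (fun a ha => (hu a ha).1) (fun a ha => (hv a ha).2)
    (fun a ha => (hv a ha).1) h
  obtain ⟨ψ, d1, d2, d3, d4, d5⟩ := exists_strictMono_interpolation s' u' v'
    (fun a ha => (hu' a ha).2) (fun a ha => (hu' a ha).1) (fun a ha => (hv' a ha).2)
    (fun a ha => (hv' a ha).1) h'
  let l : I → I := fun y => Set.projIcc 0 1 zero_le_one (2 * (y : ℝ))
  have hl : Continuous l := by fun_prop
  have hl0 : l 0 = 0 := by
    simp only [l, Set.Icc.coe_zero, mul_zero]; exact Set.projIcc_left _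
  have hl1 : l half = 1 := by
    simp only [l, half]
    rw [show (2 : ℝ) * (1 / 2) = 1 by norm_num]
    exact Set.projIcc_right _
  have hlt : ∀ x x' y, x < x' → interpolate (ψ x) (φ x) (l y) < interpolate (ψ x') (φ x') (l y) := by
    intro x x' y hx
    have a : (ψ x : ℝ) < ψ x' := d2 hx
    have b : (φ x : ℝ) < φ x' := c2 hx
    have h0 : (0 : ℝ) ≤ l y := (l y).2.1
    have h1 : (l y : ℝ) ≤ 1 := (l y).2.2
    change (1 - (l y : ℝ)) * ψ x + l y * φ x < (1 - (l y : ℝ)) * ψ x' + l y * φ x'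
    rcases eq_or_lt_of_le h0 with e | e
    · rw [← e]; simpa using a
    · have := mul_le_mul_of_nonneg_left a.le (sub_nonneg.2 h1)
      have := mul_lt_mul_of_pos_left b e
      linarith
  refine ⟨slideHomeo (fun z => interpolate (ψ z.1) (φ z.1) (l z.2)) (by fun_prop) hlt
    (fun y => by simp [c3, d3]) (fun y => by simp [c4, d4]), isSlide_slideHomeo _ _ _ _ _,
    fun a ha => ?_, fun a ha => ?_⟩
  · rw [slideHomeo_apply]; simp [hl1, c5 a ha]
  · rw [slideHomeo_apply]; simp [hl0, d5 a ha]

/-! ### Parallelism -/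

theorem coe_gridPoint {n r : ℕ} (h : r < n) : (gridPoint n r : ℝ) = ((r : ℝ) + 1) / ((n : ℝ) + 1) := by
  have h1 : (r : ℝ) + 1 ≤ n := by exact_mod_cast h
  rw [gridPoint, Set.projIcc_of_mem]
  exact ⟨by positivity, by rw [div_le_one (by positivity)]; linarith⟩

theorem gridPoint_mem_Ioo {n r : ℕ} (h : r < n) : 0 < gridPoint n r ∧ gridPoint n r < 1 := by
  have h1 : (r : ℝ) + 1 ≤ n := by exact_mod_cast h
  constructor
  · change (0 : ℝ) < gridPoint n r
    rw [coe_gridPoint h]; positivity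
  · change (gridPoint n r : ℝ) < 1
    rw [coe_gridPoint h, div_lt_one (by positivity)]; linarith

theorem gridPoint_lt_iff {n r s : ℕ} (hr : r < n) (hs : s < n) :
    gridPoint n r < gridPoint n s ↔ r < s := by
  change (gridPoint n r : ℝ) < gridPoint n s ↔ r < s
  rw [coe_gridPoint hr, coe_gridPoint hs, div_lt_div_iff_of_pos_right (by positivity)]
  simp

/-- The segment from `m` to `a` is mapped by `f` to a path that is homotopic to a segment in the
complement of the points of `R` other than `f a`. -/
def Par (R : Set Disc) (f : Disc ≃ₜ Disc) (a m : Disc) : Prop :=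
  HomotopicIn (R \ {f a})ᶜ (f ∘ seg m a) (seg (f m) (f a))

theorem isParallel_iff_par {p : ℕ} {f : Disc ≃ₜ Disc}
    (hf : ∀ z, f z ∈ punctures p ↔ z ∈ punctures p) (F : Isotopy ∅ f) (a m : Disc) :
    IsParallel p F a m ↔ Par (punctures p) f a m := by
  rw [isParallel_iff, Par]
  have : {z | ∀ c ∈ punctures p, c ≠ a → z ≠ f c} = (punctures p \ {f a})ᶜ := by
    ext z
    simp only [Set.mem_ofPred_eq, Set.mem_compl_iff, Set.mem_sdiff, Set.mem_singleton_iff, not_and,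
      not_not]
    constructor
    · intro h hz
      by_contra hne
      have e : f (f.symm z) = z := f.apply_symm_apply z
      refine h (f.symm z) ((hf _).1 (e.symm ▸ hz)) (fun h' => hne ?_) e.symm
      rw [← h', e]
    · rintro h c hc hca rfl
      exact hca (f.injective (h ((hf c).2 hc)))
  rw [this]

namespace Par

variable {R R' : Set Disc} {f g : Disc ≃ₜ Disc} {a m : Disc}

theorem comp (h : Par R f a m) (h' : Par R' g (f a) (f m)) (hg : ∀ z, g z ∈ R' → z ∈ R) :
    Par R' (g * f) a m := by
  have h1 := HomotopicIn.map h g.continuous (V := (R' \ {g (f a)})ᶜ) (by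
    rintro z hz ⟨hz1, hz2⟩
    exact hz ⟨hg z hz1, fun e => hz2 (congrArg g e)⟩)
  exact h1.trans h'

theorem inv (h : Par R f a m) (hf : ∀ z ∈ R', f z ∈ R) : Par R' f⁻¹ (f a) (f m) := by
  have h1 := HomotopicIn.map h f.symm.continuous (V := (R' \ {a})ᶜ) (by
    rintro z hz ⟨hz1, hz2⟩
    have e : f (f.symm z) = z := f.apply_symm_apply z
    refine hz ⟨e ▸ hf _ hz1, fun e' => hz2 ?_⟩
    rw [Set.mem_singleton_iff.1 e', f.symm_apply_apply]; rfl)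
  have e : f.symm ∘ f ∘ seg m a = seg m a := by funext t; exact f.symm_apply_apply _
  rw [e] at h1
  have e1 : f⁻¹ (f a) = a := f.symm_apply_apply a
  have e2 : f⁻¹ (f m) = m := f.symm_apply_apply m
  unfold Par
  rw [e1, e2]
  exact h1.symm

theorem one (hR : ∀ z ∈ R, z.2 = half) (ha : a.2 = half) (hm : m.2 = 0) : Par R 1 a m :=
  HomotopicIn.refl (seg m a).continuous fun t =>
    lowerWith_subset (fun z hz => hR z hz.1) (fun h => h.2 rfl) (seg_mem_lowerWith hm ha t)

theorem congr (h : Par R f a m) {Z : Set Disc} (hfg : IsotopicRel Z f g) (hm : m ∈ Z)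
    (ha : a ∈ Z) (hm2 : m.2 = 0) (ha2 : a.2 = half) (hf : ∀ z, f z ∈ R → z ∈ Z ∧ z.2 = half) :
    Par R g a m := by
  have ea := hfg.apply_eq ha
  have em := hfg.apply_eq hm
  unfold Par at h ⊢
  rw [← ea, ← em]
  refine HomotopicIn.trans (HomotopicIn.symm ?_) h
  obtain ⟨F⟩ := hfg
  refine ⟨fun z => f (F.toFun z.1 (seg m a z.2)), f.continuous.comp (F.continuous_uncurry.comp
    (continuous_fst.prodMk ((seg m a).continuous.comp continuous_snd))), fun t => ?_, fun t => ?_,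
    fun s => ?_, fun s => ?_, fun z => ?_⟩
  · simp only [F.map_zero]; rfl
  · simp only [F.map_one]
    exact f.apply_symm_apply _
  · simp [F.fixes s m hm]
  · simp [F.fixes s a ha]
  · rintro ⟨h1, h2⟩
    obtain ⟨h3, h3'⟩ := hf _ h1
    have h4 := (F.toFun z.1).injective (F.fixes z.1 _ h3)
    rcases seg_mem_lowerWith hm2 ha2 z.2 with h5 | h5
    · rw [h4] at h3'
      exact h5.ne h3'
    · refine h2 ?_
      change f (F.toFun z.1 (seg m a z.2)) = f a
      rw [h5, F.fixes z.1 _ ha]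

end Par

/-- Slides transport homotopies between images of segments and segments. -/
theorem HomotopicIn.slide {f f' h k : Disc ≃ₜ Disc} (hh : IsSlide h) (hk : IsSlide k)
    (hcomm : ∀ z, f' (h z) = k (f z)) {a m : Disc} (hm : m.2 = 0) (ha : a.2 = half)
    (hfm : (f m).2 = 0) (hfa : (f a).2 = half) {R R' : Set Disc} (hR' : ∀ z ∈ R', z.2 = half)
    (hfR' : ∀ z, f' z ∈ R' → z.2 = half) (haR' : f' (h a) ∉ R') (hkR : ∀ z, k z ∈ R' → z ∈ R)
    (H : HomotopicIn Rᶜ (f ∘ seg m a) (seg (f m) (f a))) :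
    HomotopicIn R'ᶜ (f' ∘ seg (h m) (h a)) (seg (f' (h m)) (f' (h a))) := by
  have hmem : ∀ {l : Disc ≃ₜ Disc}, IsSlide l → ∀ {m a : Disc}, m.2 = 0 → a.2 = half → ∀ t,
      l (seg m a t) ∈ lowerWith (l a) := by
    intro l hl m a hm ha t
    rcases seg_mem_lowerWith hm ha t with h | h
    · left; rw [hl.height]; exact h
    · right; rw [h]
  have hm' : (h m).2 = 0 := (hh.height m).trans hm
  have ha' : (h a).2 = half := (hh.height a).trans ha
  have hL : HomotopicIn (lowerWith (h a)) (seg (h m) (h a)) (h ∘ seg m a) :=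
    (discConvex_lowerWith ha').homotopicIn (Path.continuous _) (by fun_prop) (by simp) (by simp)
      (seg_mem_lowerWith hm' ha') (hmem hh hm ha)
  have h1 := hL.map f'.continuous (V := R'ᶜ) (by
    rintro z (hz | rfl) hzR
    · exact hz.ne (hfR' z hzR)
    · exact haR' hzR)
  have h2 := H.map k.continuous (V := R'ᶜ) fun z hz hz' => hz (hkR z hz')
  have e : f' ∘ h ∘ seg m a = k ∘ f ∘ seg m a := by funext t; exact hcomm _
  rw [e] at h1
  have hfm' : (k (f m)).2 = 0 := (hk.height _).trans hfm
  have hfa' : (k (f a)).2 = half := (hk.height _).trans hfa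
  have h3 : HomotopicIn (lowerWith (k (f a))) (k ∘ seg (f m) (f a)) (seg (k (f m)) (k (f a))) :=
    (discConvex_lowerWith hfa').homotopicIn (by fun_prop) (Path.continuous _) (by simp) (by simp)
      (hmem hk hfm hfa) (seg_mem_lowerWith hfm' hfa')
  rw [hcomm] at haR'
  rw [hcomm, hcomm]
  exact (h1.trans h2).trans (h3.mono (lowerWith_subset hR' haR'))

end Chambord

namespace Chambord

open unitInterval Topology

variable {S : Type*} {P : SemigroupPresentation S} {w : List S}

/-! ### Addresses of vertices -/

theorem append_singleton_ne {a x : List ℕ} {i j : ℕ} (h : a ≠ x) : a ++ [i] ≠ x ++ [j] :=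
  fun e => h (List.append_inj' e rfl).1

theorem append_singleton_ne_self (a : List ℕ) (i : ℕ) : a ++ [i] ≠ a := by simp

theorem append_singleton_inj {a x : List ℕ} {i j : ℕ} (h : a ++ [i] = x ++ [j]) :
    a = x ∧ i = j := by
  obtain ⟨h1, h2⟩ := List.append_inj' h rfl
  exact ⟨h1, by simpa using h2⟩

theorem IsVertex.ne_nil {x : List ℕ} {s : S} (h : IsVertex P w x s) : x ≠ [] := by
  cases h <;> simp

theorem HasVertex.ne_nil {x : List ℕ} (h : HasVertex P w x) : x ≠ [] := by
  obtain ⟨s, h⟩ := h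
  exact h.ne_nil

theorem SemigroupPresentation.IsArboreal.right_unique (hP : P.IsArboreal) {u : S} {v v' : List S}
    (h : ([u], v) ∈ P.rels) (h' : ([u], v') ∈ P.rels) : v = v' :=
  (hP.2 _ h _ h').1 rfl

theorem isVertex_append_iff {x : List ℕ} (hx : x ≠ []) {i : ℕ} {s : S} :
    IsVertex P w (x ++ [i]) s ↔
      ∃ u v, IsVertex P w x u ∧ ([u], v) ∈ P.rels ∧ v[i]? = some s := by
  constructor
  · intro h
    generalize e : x ++ [i] = y at h
    cases h with
    | root j s h =>
      have := (append_singleton_inj (x := []) (e : x ++ [i] = [] ++ [j])).1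
      exact absurd this hx
    | child x' u v j s hx' huv h =>
      obtain ⟨rfl, rfl⟩ := append_singleton_inj e
      exact ⟨u, v, hx', huv, h⟩
  · rintro ⟨u, v, h1, h2, h3⟩
    exact .child x u v i s h1 h2 h3

theorem IsVertex.unique (hP : P.IsArboreal) {x : List ℕ} {s s' : S} (h : IsVertex P w x s)
    (h' : IsVertex P w x s') : s = s' := by
  induction h generalizing s' with
  | root i s h =>
    generalize e : [i] = y at h'
    cases h' with
    | root j s' h' =>
      obtain rfl : i = j := by simpa using e
      rw [h] at h'
      exact Option.some.inj h'
    | child x' u v j s hx' huv h =>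
      exact absurd (append_singleton_inj (a := []) (e : [] ++ [i] = x' ++ [j])).1 hx'.ne_nil.symm
  | child x u v i s hx huv h ih =>
    obtain ⟨u', v', h1, h2, h3⟩ := (isVertex_append_iff hx.ne_nil).1 h'
    obtain rfl := ih h1
    obtain rfl := hP.right_unique huv h2
    rw [h] at h3
    exact Option.some.inj h3

theorem IsVertex.isVertex_append_iff (hP : P.IsArboreal) {x y : List ℕ} {u : S}
    (hx : IsVertex P w x u) (hy : IsVertex P w y u) (i : ℕ) (s : S) :
    IsVertex P w (x ++ [i]) s ↔ IsVertex P w (y ++ [i]) s := by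
  rw [Chambord.isVertex_append_iff hx.ne_nil, Chambord.isVertex_append_iff hy.ne_nil]
  constructor
  · rintro ⟨u', v, h1, h2, h3⟩
    obtain rfl := hx.unique hP h1
    exact ⟨_, v, hy, h2, h3⟩
  · rintro ⟨u', v, h1, h2, h3⟩
    obtain rfl := hy.unique hP h1
    exact ⟨_, v, hx, h2, h3⟩

theorem IsVertex.hasVertex_append_iff (hP : P.IsArboreal) {x y : List ℕ} {u : S}
    (hx : IsVertex P w x u) (hy : IsVertex P w y u) (i : ℕ) :
    HasVertex P w (x ++ [i]) ↔ HasVertex P w (y ++ [i]) :=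
  exists_congr fun s => hx.isVertex_append_iff hP hy i s

theorem HasVertex.exists_children (hP : P.IsArboreal) {x : List ℕ} (hx : HasVertex P w x) :
    ∃ n, ∀ i, HasVertex P w (x ++ [i]) ↔ i < n := by
  obtain ⟨u, hu⟩ := hx
  by_cases h : ∃ v, ([u], v) ∈ P.rels
  · obtain ⟨v, hv⟩ := h
    refine ⟨v.length, fun i => ⟨?_, fun hi => ?_⟩⟩
    · rintro ⟨s, hs⟩
      obtain ⟨u', v', h1, h2, h3⟩ := (isVertex_append_iff hu.ne_nil).1 hs
      obtain rfl := hu.unique hP h1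
      obtain rfl := hP.right_unique hv h2
      exact (List.getElem?_eq_some_iff.1 h3).1
    · exact ⟨v[i], .child x u v i _ hu hv (List.getElem?_eq_getElem hi)⟩
  · refine ⟨0, fun i => ⟨?_, fun hi => absurd hi (Nat.not_lt_zero i)⟩⟩
    rintro ⟨s, hs⟩
    obtain ⟨u', v', h1, h2, h3⟩ := (isVertex_append_iff hu.ne_nil).1 hs
    obtain rfl := hu.unique hP h1
    exact absurd ⟨v', h2⟩ h

theorem HasVertex.append_zero (hP : P.IsArboreal) {x : List ℕ} (hx : HasVertex P w x)
    (h : ∃ i, HasVertex P w (x ++ [i])) : HasVertex P w (x ++ [0]) := by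
  obtain ⟨n, hn⟩ := hx.exists_children hP
  obtain ⟨i, hi⟩ := h
  exact (hn 0).2 (Nat.zero_lt_of_lt ((hn i).1 hi))

/-! ### The left-right order -/

theorem leftOf_irrefl (x : List ℕ) : ¬ leftOf x x := by
  induction x with
  | nil => exact id
  | cons i x ih => simp [leftOf, ih]

theorem leftOf_trichotomy (x y : List ℕ) : leftOf x y ∨ x = y ∨ leftOf y x := by
  induction x generalizing y with
  | nil => cases y <;> simp [leftOf]; omega
  | cons i x ih =>
    cases y with
    | nil => simp [leftOf]; omega
    | cons j y =>
      rcases lt_trichotomy i j with h | rfl | h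
      · exact Or.inl (Or.inl h)
      · rcases ih y with h | rfl | h
        · exact Or.inl (Or.inr ⟨rfl, h⟩)
        · exact Or.inr (Or.inl rfl)
        · exact Or.inr (Or.inr (Or.inr ⟨rfl, h⟩))
      · exact Or.inr (Or.inr (Or.inl h))

theorem leftOf_trans {x y z : List ℕ} (h : leftOf x y) (h' : leftOf y z) : leftOf x z := by
  induction x generalizing y z with
  | nil =>
    cases y with
    | nil => exact h.elim
    | cons j y =>
      cases z with
      | nil => exact absurd h' h
      | cons k z =>
        simp only [leftOf] at h h' ⊢
        omega
  | cons i x ih =>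
    cases y with
    | nil =>
      cases z with
      | nil => exact h
      | cons k z =>
        simp only [leftOf] at h h' ⊢
        omega
    | cons j y =>
      cases z with
      | nil =>
        simp only [leftOf] at h h' ⊢
        omega
      | cons k z =>
        rcases h with h | ⟨rfl, h⟩ <;> rcases h' with h' | ⟨rfl, h'⟩
        · exact Or.inl (h.trans h')
        · exact Or.inl h
        · exact Or.inl h'
        · exact Or.inr ⟨rfl, ih h h'⟩

theorem leftOf_asymm {x y : List ℕ} (h : leftOf x y) : ¬ leftOf y x :=
  fun h' => leftOf_irrefl x (leftOf_trans h h')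

theorem leftOf_append_append (a x y : List ℕ) : leftOf (a ++ x) (a ++ y) ↔ leftOf x y := by
  induction a with
  | nil => rfl
  | cons i a ih => simp [leftOf, ih]

theorem leftOf_append_singleton (a : List ℕ) (i j : ℕ) : leftOf (a ++ [i]) (a ++ [j]) ↔ i < j := by
  rw [leftOf_append_append]
  simp [leftOf]

theorem leftOf_append_right {a x : List ℕ} (h : ¬ a <+: x) (y : List ℕ) :
    leftOf x (a ++ y) ↔ leftOf x a := by
  induction a generalizing x with
  | nil => exact absurd List.nil_prefix h
  | cons i a ih =>
    cases x with
    | nil => simp [leftOf]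
    | cons j x =>
      simp only [List.cons_append, leftOf]
      refine or_congr Iff.rfl (and_congr_right fun e => ih fun h' => h ?_)
      rw [e]
      exact (List.prefix_cons_inj i).2 h'

theorem leftOf_append_left {a x : List ℕ} (h : ¬ a <+: x) (y : List ℕ) :
    leftOf (a ++ y) x ↔ leftOf a x := by
  induction a generalizing x with
  | nil => exact absurd List.nil_prefix h
  | cons i a ih =>
    cases x with
    | nil => simp [leftOf]
    | cons j x =>
      simp only [List.cons_append, leftOf]
      refine or_congr Iff.rfl (and_congr_right fun e => ih fun h' => h ?_)
      rw [e]
      exact (List.prefix_cons_inj j).2 h'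

theorem rank_lt_card {F : Finset (List ℕ)} {x : List ℕ} (hx : x ∈ F) : rank F x < F.card := by
  classical
  refine Finset.card_lt_card ⟨Finset.filter_subset _ _, fun h => ?_⟩
  exact leftOf_irrefl x (Finset.mem_filter.1 (h hx)).2

theorem rank_lt_rank {F : Finset (List ℕ)} {x y : List ℕ} (hx : x ∈ F) (h : leftOf x y) :
    rank F x < rank F y := by
  classical
  refine Finset.card_lt_card ⟨fun z hz => ?_, fun h' => ?_⟩
  · rw [Finset.mem_filter] at hz ⊢
    exact ⟨hz.1, leftOf_trans hz.2 h⟩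
  · exact leftOf_irrefl x (Finset.mem_filter.1 (h' (Finset.mem_filter.2 ⟨hx, h⟩))).2

theorem rank_lt_iff {F : Finset (List ℕ)} {x y : List ℕ} (hx : x ∈ F) (hy : y ∈ F) :
    rank F x < rank F y ↔ leftOf x y := by
  refine ⟨fun h => ?_, rank_lt_rank hx⟩
  rcases leftOf_trichotomy x y with h' | rfl | h'
  · exact h'
  · exact absurd h (lt_irrefl _)
  · exact absurd h (rank_lt_rank hy h').asymm

theorem exists_rank_eq {F : Finset (List ℕ)} {r : ℕ} (hr : r < F.card) : ∃ x ∈ F, rank F x = r := by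
  classical
  have hinj : Set.InjOn (rank F) F := fun x hx y hy e => by
    rcases leftOf_trichotomy x y with h | h | h
    · exact absurd e (rank_lt_rank hx h).ne
    · exact h
    · exact absurd e (rank_lt_rank hy h).ne'
  have h1 : F.image (rank F) = Finset.range F.card := by
    refine Finset.eq_of_subset_of_card_le (fun n hn => ?_) ?_
    · obtain ⟨x, hx, rfl⟩ := Finset.mem_image.1 hn
      exact Finset.mem_range.2 (rank_lt_card hx)
    · rw [Finset.card_range, Finset.card_image_of_injOn hinj]
  have h2 : r ∈ F.image (rank F) := by rw [h1]; exact Finset.mem_range.2 hr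
  obtain ⟨x, hx, e⟩ := Finset.mem_image.1 h2
  exact ⟨x, hx, e⟩

/-! ### Forests -/

namespace Forest

variable {A A' : Forest P w} {a x : List ℕ}

theorem mem_pLeaves : x ∈ A.pLeaves ↔
    x ∈ A.verts ∧ (∀ i, x ++ [i] ∉ A.verts) ∧ ∃ i, HasVertex P w (x ++ [i]) := by
  simp [pLeaves]

theorem mem_interior : x ∈ A.interior ↔ x ∈ A.verts ∧ x ∉ A.pLeaves := by
  simp [interior]

theorem ne_nil (hx : x ∈ A.verts) : x ≠ [] := (A.hasVertex x hx).ne_nil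

theorem mem_verts_of_pLeaves (hx : x ∈ A.pLeaves) : x ∈ A.verts := (mem_pLeaves.1 hx).1

theorem mem_verts_of_prefix (ha : a ≠ []) (h : a <+: x) (hx : x ∈ A.verts) :
    a ∈ A.verts := by
  obtain ⟨y, rfl⟩ := h
  induction y using List.reverseRecOn with
  | nil => simpa using hx
  | append_singleton y i ih =>
    rw [← List.append_assoc] at hx
    exact ih (A.parent _ i (by simp [ha]) hx)

theorem exists_child_prefix (h : a <+: x) (hne : a ≠ x) : ∃ i, a ++ [i] <+: x := by
  obtain ⟨y, rfl⟩ := h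
  cases y with
  | nil => simp at hne
  | cons i y => exact ⟨i, y, by simp⟩

theorem eq_of_pLeaves_prefix (ha : a ∈ A.pLeaves) (h : a <+: x) (hx : x ∈ A.verts) : a = x := by
  by_contra hne
  obtain ⟨i, hi⟩ := exists_child_prefix h hne
  exact (mem_pLeaves.1 ha).2.1 i (mem_verts_of_prefix (by simp) hi hx)

/-- All the children of `a` are `P`-leaves of `A`, and `A'` is obtained by removing them. -/
structure Prunes (A A' : Forest P w) (a : List ℕ) : Prop where
  mem : a ∈ A'.pLeaves
  children : ∀ i, HasVertex P w (a ++ [i]) → a ++ [i] ∈ A.pLeaves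
  mem_verts_iff : ∀ x, x ∈ A'.verts ↔ x ∈ A.verts ∧ ∀ i, x ≠ a ++ [i]

namespace Prunes

theorem mem_verts (h : A.Prunes A' a) : a ∈ A.verts :=
  ((h.mem_verts_iff a).1 (mem_verts_of_pLeaves h.mem)).1

theorem hasVertex (h : A.Prunes A' a) : HasVertex P w a := A.hasVertex a h.mem_verts

theorem exists_child (h : A.Prunes A' a) : ∃ i, HasVertex P w (a ++ [i]) :=
  (mem_pLeaves.1 h.mem).2.2

theorem hasVertex_zero (hP : P.IsArboreal) (h : A.Prunes A' a) : HasVertex P w (a ++ [0]) :=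
  h.hasVertex.append_zero hP h.exists_child

theorem zero_mem (hP : P.IsArboreal) (h : A.Prunes A' a) : a ++ [0] ∈ A.pLeaves :=
  h.children 0 (h.hasVertex_zero hP)

theorem mem_pLeaves_iff (h : A.Prunes A' a) :
    x ∈ A'.pLeaves ↔ x = a ∨ (x ∈ A.pLeaves ∧ ∀ i, x ≠ a ++ [i]) := by
  constructor
  · intro hx
    by_cases hxa : x = a
    · exact Or.inl hxa
    · rw [mem_pLeaves, h.mem_verts_iff] at hx
      refine Or.inr ⟨mem_pLeaves.2 ⟨hx.1.1, fun i hi => hx.2.1 i ?_, hx.2.2⟩, hx.1.2⟩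
      exact (h.mem_verts_iff _).2 ⟨hi, fun j => append_singleton_ne hxa⟩
  · rintro (rfl | ⟨h1, h2⟩)
    · exact h.mem
    · rw [mem_pLeaves] at h1 ⊢
      exact ⟨(h.mem_verts_iff x).2 ⟨h1.1, h2⟩, fun i hi =>
        h1.2.1 i ((h.mem_verts_iff _).1 hi).1, h1.2.2⟩

theorem not_mem_pLeaves (h : A.Prunes A' a) : a ∉ A.pLeaves := fun ha => by
  obtain ⟨i, hi⟩ := h.exists_child
  exact (mem_pLeaves.1 ha).2.1 i (mem_verts_of_pLeaves (h.children i hi))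

theorem mem_interior (h : A.Prunes A' a) : a ∈ A.interior :=
  Forest.mem_interior.2 ⟨h.mem_verts, h.not_mem_pLeaves⟩

theorem mem_interior_iff (h : A.Prunes A' a) : x ∈ A'.interior ↔ x ∈ A.interior ∧ x ≠ a := by
  rw [Forest.mem_interior, Forest.mem_interior, h.mem_verts_iff, h.mem_pLeaves_iff]
  constructor
  · rintro ⟨⟨h1, h2⟩, h3⟩
    exact ⟨⟨h1, fun h4 => h3 (Or.inr ⟨h4, h2⟩)⟩, fun h4 => h3 (Or.inl h4)⟩
  · rintro ⟨⟨h1, h2⟩, h3⟩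
    refine ⟨⟨h1, ?_⟩, ?_⟩
    · rintro i rfl
      exact h2 (h.children i (A.hasVertex _ h1))
    · rintro (h4 | h4)
      · exact h3 h4
      · exact h2 h4.1

theorem mem_pLeaves_iff_of_top (h : A.Prunes A' a) : x ∈ A.pLeaves ↔
    (x ∈ A'.pLeaves ∧ x ≠ a) ∨ ∃ i, HasVertex P w (a ++ [i]) ∧ x = a ++ [i] := by
  rw [h.mem_pLeaves_iff]
  constructor
  · intro hx
    by_cases hc : ∃ i, x = a ++ [i]
    · obtain ⟨i, rfl⟩ := hc
      exact Or.inr ⟨i, A.hasVertex _ (mem_verts_of_pLeaves hx), rfl⟩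
    · push Not at hc
      exact Or.inl ⟨Or.inr ⟨hx, hc⟩, fun e => h.not_mem_pLeaves (e ▸ hx)⟩
  · rintro (⟨h1 | h1, h2⟩ | ⟨i, h1, rfl⟩)
    · exact absurd h1 h2
    · exact h1.1
    · exact h.children i h1

theorem not_prefix (h : A.Prunes A' a) (hx : x ∈ A'.pLeaves) (hxa : x ≠ a) : ¬ a <+: x :=
  fun h' => hxa (eq_of_pLeaves_prefix h.mem h' (mem_verts_of_pLeaves hx)).symm

theorem card_lt (h : A.Prunes A' a) : A'.verts.card < A.verts.card := by
  refine Finset.card_lt_card ⟨fun x hx => ((h.mem_verts_iff x).1 hx).1, fun hs => ?_⟩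
  obtain ⟨i, hi⟩ := h.exists_child
  exact ((h.mem_verts_iff _).1 (hs (mem_verts_of_pLeaves (h.children i hi)))).2 i rfl

theorem subset (h : A.Prunes A' a) : A'.verts ⊆ A.verts :=
  fun x hx => ((h.mem_verts_iff x).1 hx).1

theorem top_unique {A₁ A₂ : Forest P w} (h₁ : A₁.Prunes A' a) (h₂ : A₂.Prunes A' a) : A₁ = A₂ := by
  have key : ∀ {A₁ A₂ : Forest P w}, A₁.Prunes A' a → A₂.Prunes A' a → A₁.verts ⊆ A₂.verts := by
    intro A₁ A₂ h₁ h₂ x hx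
    by_cases hc : ∃ i, x = a ++ [i]
    · obtain ⟨i, rfl⟩ := hc
      exact mem_verts_of_pLeaves (h₂.children i (A₁.hasVertex _ hx))
    · push Not at hc
      exact h₂.subset ((h₁.mem_verts_iff x).2 ⟨hx, hc⟩)
  exact Forest.ext ((key h₁ h₂).antisymm (key h₂ h₁))

theorem bot_unique {A₁ A₂ : Forest P w} (h₁ : A.Prunes A₁ a) (h₂ : A.Prunes A₂ a) : A₁ = A₂ :=
  Forest.ext (Finset.ext fun x => (h₁.mem_verts_iff x).trans (h₂.mem_verts_iff x).symm)

end Prunes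

open Classical in
theorem exists_prunes (ha : a ∈ A.verts) (hc : ∃ i, HasVertex P w (a ++ [i]))
    (h : ∀ i, HasVertex P w (a ++ [i]) → a ++ [i] ∈ A.pLeaves) :
    ∃ A' : Forest P w, A.Prunes A' a := by
  have hmem : ∀ x, x ∈ A.verts.filter (fun x => ∀ i, x ≠ a ++ [i]) ↔
      x ∈ A.verts ∧ ∀ i, x ≠ a ++ [i] := fun x => Finset.mem_filter
  let A' : Forest P w :=
    { verts := A.verts.filter (fun x => ∀ i, x ≠ a ++ [i])
      hasVertex := fun x hx => A.hasVertex x ((hmem x).1 hx).1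
      roots := fun i hi => (hmem _).2 ⟨A.roots i hi, fun j e => ne_nil ha
        (append_singleton_inj (a := []) (e : [] ++ [i] = a ++ [j])).1.symm⟩
      parent := fun x i hx hxi => by
        rw [hmem] at hxi ⊢
        refine ⟨A.parent x i hx hxi.1, ?_⟩
        rintro j rfl
        exact (mem_pLeaves.1 (h j (A.hasVertex _ (A.parent _ i hx hxi.1)))).2.1 i hxi.1
      siblings := fun x i j hxi hxj => by
        rw [hmem] at hxi ⊢
        refine ⟨A.siblings x i j hxi.1 hxj, fun l e => ?_⟩
        obtain ⟨rfl, rfl⟩ := append_singleton_inj e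
        exact hxi.2 i rfl }
  refine ⟨A', mem_pLeaves.2 ⟨(hmem a).2 ⟨ha, fun i => (append_singleton_ne_self a i).symm⟩,
    fun i hi => ((hmem _).1 hi).2 i rfl, hc⟩, h, hmem⟩

open Classical in
theorem exists_prunes_top (hP : P.IsArboreal) (hT : NoNonRootLeaf P w) (ha : a ∈ A'.pLeaves) :
    ∃ A : Forest P w, A.Prunes A' a := by
  have hav := mem_verts_of_pLeaves ha
  have han := ne_nil hav
  obtain ⟨n, hn⟩ := (A'.hasVertex a hav).exists_children hP
  have hmem : ∀ x, x ∈ A'.verts ∪ (Finset.range n).image (fun i => a ++ [i]) ↔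
      x ∈ A'.verts ∨ ∃ i, HasVertex P w (a ++ [i]) ∧ x = a ++ [i] := fun x => by
    simp only [Finset.mem_union, Finset.mem_image, Finset.mem_range, hn]
    refine or_congr Iff.rfl (exists_congr fun i => and_congr_right fun _ => eq_comm)
  let A : Forest P w :=
    { verts := A'.verts ∪ (Finset.range n).image (fun i => a ++ [i])
      hasVertex := fun x hx => by
        rcases (hmem x).1 hx with h | ⟨i, hi, rfl⟩
        · exact A'.hasVertex x h
        · exact hi
      roots := fun i hi => (hmem _).2 (Or.inl (A'.roots i hi))
      parent := fun x i hx hxi => by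
        rw [hmem] at hxi ⊢
        rcases hxi with h | ⟨j, -, e⟩
        · exact Or.inl (A'.parent x i hx h)
        · exact Or.inl ((append_singleton_inj e).1 ▸ hav)
      siblings := fun x i j hxi hxj => by
        rw [hmem] at hxi ⊢
        rcases hxi with h | ⟨l, -, e⟩
        · exact Or.inl (A'.siblings x i j h hxj)
        · obtain ⟨rfl, rfl⟩ := append_singleton_inj e
          exact Or.inr ⟨j, hxj, rfl⟩ }
  refine ⟨A, ha, fun i hi => mem_pLeaves.2 ⟨(hmem _).2 (Or.inr ⟨i, hi, rfl⟩), fun j hj => ?_, ?_⟩,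
    fun x => ?_⟩
  · rcases (hmem _).1 hj with h | ⟨l, -, e⟩
    · exact (mem_pLeaves.1 ha).2.1 i (A'.parent _ j (by simp) h)
    · exact append_singleton_ne_self a i (append_singleton_inj e).1
  · refine hT _ hi ?_
    have := List.length_pos_iff.2 han
    simp
    omega
  · change _ ↔ x ∈ A'.verts ∪ _ ∧ _
    rw [hmem]
    constructor
    · refine fun h => ⟨Or.inl h, ?_⟩
      rintro i rfl
      exact (mem_pLeaves.1 ha).2.1 i h
    · rintro ⟨h | ⟨i, -, e⟩, h'⟩
      · exact h
      · exact absurd e (h' i)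

theorem exists_pLeaf_of_subset {X : Forest P w} (h : A.verts ⊆ X.verts) (hne : A ≠ X) :
    ∃ a ∈ A.pLeaves, ∀ i, HasVertex P w (a ++ [i]) → a ++ [i] ∈ X.verts := by
  classical
  have hne' : (X.verts \ A.verts).Nonempty := by
    rw [Finset.sdiff_nonempty]
    exact fun h' => hne (Forest.ext (h.antisymm h'))
  obtain ⟨x, hx, hmin⟩ := Finset.exists_min_image _ List.length hne'
  rw [Finset.mem_sdiff] at hx
  rcases List.eq_nil_or_concat x with rfl | ⟨y, i, rfl⟩
  · exact absurd rfl (ne_nil hx.1)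
  rw [List.concat_eq_append] at *
  have hy : y ≠ [] := by
    rintro rfl
    exact hx.2 (A.roots i (X.hasVertex _ hx.1))
  have hyX := X.parent y i hy hx.1
  have hyA : y ∈ A.verts := by
    by_contra hyA
    have := hmin y (Finset.mem_sdiff.2 ⟨hyX, hyA⟩)
    simp at this
  exact ⟨y, mem_pLeaves.2 ⟨hyA, fun j hj => hx.2 (A.siblings y j i hj (X.hasVertex _ hx.1)),
    i, X.hasVertex _ hx.1⟩, fun j hj => X.siblings y i j hx.1 hj⟩

open Classical in
/-- The union of two forests. -/
def union (A B : Forest P w) : Forest P w where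
  verts := A.verts ∪ B.verts
  hasVertex x hx := (Finset.mem_union.1 hx).elim (A.hasVertex x) (B.hasVertex x)
  roots i hi := Finset.mem_union_left _ (A.roots i hi)
  parent x i hx h := by
    rw [Finset.mem_union] at *
    exact h.imp (A.parent x i hx) (B.parent x i hx)
  siblings x i j h hj := by
    rw [Finset.mem_union] at *
    exact h.imp (A.siblings x i j · hj) (B.siblings x i j · hj)

/-- The forest consisting of the roots. -/
def rootForest (P : SemigroupPresentation S) (w : List S) : Forest P w where
  verts := (Finset.range w.length).image fun i => [i]
  hasVertex x hx := by
    obtain ⟨i, hi, rfl⟩ := Finset.mem_image.1 hx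
    have hi := Finset.mem_range.1 hi
    exact ⟨w[i], .root i _ (List.getElem?_eq_getElem hi)⟩
  roots i hi := by
    obtain ⟨s, hs⟩ := hi
    generalize e : [i] = y at hs
    cases hs with
    | root j s h =>
      exact Finset.mem_image.2 ⟨j, Finset.mem_range.2 (List.getElem?_eq_some_iff.1 h).1, rfl⟩
    | child x u v j s hx huv h =>
      exact absurd (append_singleton_inj (a := []) (e : [] ++ [i] = x ++ [j])).1 hx.ne_nil.symm
  parent x i hx h := by
    obtain ⟨j, -, e⟩ := Finset.mem_image.1 h
    exact absurd (append_singleton_inj (a := []) (e : [] ++ [j] = x ++ [i])).1.symm hx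
  siblings x i j h hj := by
    obtain ⟨l, -, e⟩ := Finset.mem_image.1 h
    obtain ⟨rfl, rfl⟩ := append_singleton_inj (a := []) (e : [] ++ [l] = x ++ [i])
    obtain ⟨s, hs⟩ := hj
    generalize e : [] ++ [j] = y at hs
    cases hs with
    | root j' s h =>
      exact Finset.mem_image.2 ⟨j', Finset.mem_range.2 (List.getElem?_eq_some_iff.1 h).1, rfl⟩
    | child x u v j' s hx huv h =>
      exact absurd (append_singleton_inj e).1 hx.ne_nil.symm

theorem rootForest_subset (A : Forest P w) : (rootForest P w).verts ⊆ A.verts := fun x hx => by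
  obtain ⟨i, hi, rfl⟩ := Finset.mem_image.1 hx
  exact A.roots i ((rootForest P w).hasVertex _ hx)

end Forest

end Chambord

namespace Chambord

open unitInterval Topology

variable {S : Type*} {P : SemigroupPresentation S} {w : List S}

/-! ### Placements of the punctures and of the marked points -/

/-- Positions for the punctures and the marked points indexed by the vertices of a forest. -/
structure Placement where
  puncture : List ℕ → Disc
  mark : List ℕ → Disc

/-- The positions in the standard punctured disc. -/
noncomputable def Forest.grid (A : Forest P w) : Placement := ⟨A.puncture, A.mark⟩

namespace Placement

/-- The punctures are placed from left to right on the middle line and the marked points are placed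
from left to right on the bottom side. -/
structure Fits (c : Placement) (A : Forest P w) : Prop where
  puncture_snd : ∀ x ∈ A.interior, (c.puncture x).2 = half
  puncture_mem : ∀ x ∈ A.interior, 0 < (c.puncture x).1 ∧ (c.puncture x).1 < 1
  puncture_lt : ∀ x ∈ A.interior, ∀ y ∈ A.interior,
    (c.puncture x).1 < (c.puncture y).1 ↔ leftOf x y
  mark_snd : ∀ x ∈ A.pLeaves, (c.mark x).2 = 0
  mark_mem : ∀ x ∈ A.pLeaves, 0 < (c.mark x).1 ∧ (c.mark x).1 < 1
  mark_lt : ∀ x ∈ A.pLeaves, ∀ y ∈ A.pLeaves, (c.mark x).1 < (c.mark y).1 ↔ leftOf x y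

/-- The set of the positions of the punctures. -/
def punctures (c : Placement) (A : Forest P w) : Set Disc := c.puncture '' A.interior

/-- The set of the positions of the marked points. -/
def marks (c : Placement) (A : Forest P w) : Set Disc := c.mark '' A.pLeaves

/-- The slide `h` maps the positions of `c` to those of `d`. -/
structure Matches (A : Forest P w) (c d : Placement) (h : Disc ≃ₜ Disc) : Prop where
  isSlide : IsSlide h
  puncture : ∀ x ∈ A.interior, h (c.puncture x) = d.puncture x
  mark : ∀ x ∈ A.pLeaves, h (c.mark x) = d.mark x

/-- The positions after the removal of the children of `a`. -/
def prune (c : Placement) (a : List ℕ) : Placement where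
  puncture := c.puncture
  mark := Function.update c.mark a (c.mark (a ++ [0]))

variable {A A' B : Forest P w} {c d e : Placement} {a : List ℕ} {h k : Disc ≃ₜ Disc}

theorem Matches.one (A : Forest P w) (c : Placement) : Matches A c c 1 :=
  ⟨.one, fun _ _ => rfl, fun _ _ => rfl⟩

theorem Matches.inv (hh : Matches A c d h) : Matches A d c h⁻¹ where
  isSlide := hh.isSlide.inv
  puncture x hx := by rw [← hh.puncture x hx]; exact h.symm_apply_apply _
  mark x hx := by rw [← hh.mark x hx]; exact h.symm_apply_apply _

theorem Matches.mul (hk : Matches A d e k) (hh : Matches A c d h) : Matches A c e (k * h) where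
  isSlide := hk.isSlide.mul hh.isSlide
  puncture x hx := by rw [← hk.puncture x hx, ← hh.puncture x hx]; rfl
  mark x hx := by rw [← hk.mark x hx, ← hh.mark x hx]; rfl

theorem Matches.apply_mem (hh : Matches A c d h) {z : Disc} (hz : z ∈ c.punctures A ∪ c.marks A) :
    h z ∈ d.punctures A ∪ d.marks A := by
  rcases hz with ⟨x, hx, rfl⟩ | ⟨x, hx, rfl⟩
  · exact Or.inl ⟨x, hx, (hh.puncture x hx).symm⟩
  · exact Or.inr ⟨x, hx, (hh.mark x hx).symm⟩

theorem Matches.isotopicRel (hh : Matches A c d h) (hk : Matches A c d k) :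
    IsotopicRel (c.punctures A ∪ c.marks A) h k := by
  refine hh.isSlide.isotopicRel hk.isSlide ?_
  rintro _ (⟨x, hx, rfl⟩ | ⟨x, hx, rfl⟩)
  · rw [hh.puncture x hx, hk.puncture x hx]
  · rw [hh.mark x hx, hk.mark x hx]

theorem Fits.exists_matches (hc : c.Fits A) (hd : d.Fits A) : ∃ h, Matches A c d h := by
  obtain ⟨h, h1, h2, h3⟩ := exists_slide A.interior (fun x => (c.puncture x).1)
    (fun x => (d.puncture x).1) A.pLeaves (fun x => (c.mark x).1) (fun x => (d.mark x).1)
    hc.puncture_mem hd.puncture_mem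
    (fun x hx y hy => (hc.puncture_lt x hx y hy).trans (hd.puncture_lt x hx y hy).symm)
    hc.mark_mem hd.mark_mem
    (fun x hx y hy => (hc.mark_lt x hx y hy).trans (hd.mark_lt x hx y hy).symm)
  refine ⟨h, h1, fun x hx => ?_, fun x hx => ?_⟩
  · have := h2 x hx
    rw [← hc.puncture_snd x hx] at this
    exact this.trans (Prod.ext rfl ((hc.puncture_snd x hx).trans (hd.puncture_snd x hx).symm))
  · have := h3 x hx
    rw [← hc.mark_snd x hx] at this
    exact this.trans (Prod.ext rfl ((hc.mark_snd x hx).trans (hd.mark_snd x hx).symm))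

theorem Fits.puncture_injOn (hc : c.Fits A) : Set.InjOn c.puncture A.interior := by
  intro x hx y hy e
  rcases leftOf_trichotomy x y with h | h | h
  · have := (hc.puncture_lt x hx y hy).2 h
    rw [e] at this; exact absurd this (lt_irrefl _)
  · exact h
  · have := (hc.puncture_lt y hy x hx).2 h
    rw [e] at this; exact absurd this (lt_irrefl _)

theorem Fits.mark_injOn (hc : c.Fits A) : Set.InjOn c.mark A.pLeaves := by
  intro x hx y hy e
  rcases leftOf_trichotomy x y with h | h | h
  · have := (hc.mark_lt x hx y hy).2 h
    rw [e] at this; exact absurd this (lt_irrefl _)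
  · exact h
  · have := (hc.mark_lt y hy x hx).2 h
    rw [e] at this; exact absurd this (lt_irrefl _)

theorem Fits.snd_of_mem_punctures (hc : c.Fits A) {z : Disc} (hz : z ∈ c.punctures A) :
    z.2 = half := by
  obtain ⟨x, hx, rfl⟩ := hz
  exact hc.puncture_snd x hx

theorem Fits.snd_of_mem_marks (hc : c.Fits A) {z : Disc} (hz : z ∈ c.marks A) : z.2 = 0 := by
  obtain ⟨x, hx, rfl⟩ := hz
  exact hc.mark_snd x hx

theorem Fits.mem_boundary (hc : c.Fits A) {z : Disc} (hz : z ∈ c.marks A) : z ∈ boundary :=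
  mem_boundary_of_bottom (hc.snd_of_mem_marks hz)

theorem Fits.not_mem_boundary (hc : c.Fits A) {z : Disc} (hz : z ∈ c.punctures A) :
    z ∉ boundary := by
  obtain ⟨x, hx, rfl⟩ := hz
  refine Chambord.not_mem_boundary.2 ⟨hc.puncture_mem x hx, ?_⟩
  rw [hc.puncture_snd x hx]
  exact ⟨half_pos, half_lt_one⟩

theorem finite_punctures (c : Placement) (A : Forest P w) : (c.punctures A).Finite :=
  A.interior.finite_toSet.image _

theorem finite_marks (c : Placement) (A : Forest P w) : (c.marks A).Finite :=
  A.pLeaves.finite_toSet.image _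

/-! ### Homeomorphisms that map a placement to another one -/

/-- The homeomorphism `f` is isotopic to the identity, maps the punctures and the marked points to
punctures and marked points, and preserves the labels of the latter. -/
structure Carries (A : Forest P w) (c : Placement) (f : Disc ≃ₜ Disc) (B : Forest P w)
    (d : Placement) : Prop where
  isotopy : Nonempty (Isotopy ∅ f)
  punctures : f '' c.punctures A = d.punctures B
  marks : f '' c.marks A = d.marks B
  label : ∀ x ∈ A.pLeaves, ∀ y ∈ B.pLeaves, f (c.mark x) = d.mark y →
    ∀ s, IsVertex P w x s ↔ IsVertex P w y s

namespace Carries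

variable {f f' g : Disc ≃ₜ Disc}

theorem preservesBoundary (h : Carries A c f B d) : PreservesBoundary f := by
  obtain ⟨F⟩ := h.isotopy
  exact F.preservesBoundary

theorem apply_mem (h : Carries A c f B d) {z : Disc} (hz : z ∈ c.punctures A ∪ c.marks A) :
    f z ∈ d.punctures B ∪ d.marks B := by
  rw [← h.punctures, ← h.marks, ← Set.image_union]
  exact Set.mem_image_of_mem _ hz

theorem exists_mark (h : Carries A c f B d) {x : List ℕ} (hx : x ∈ A.pLeaves) :
    ∃ y ∈ B.pLeaves, f (c.mark x) = d.mark y := by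
  have : f (c.mark x) ∈ d.marks B :=
    h.marks ▸ Set.mem_image_of_mem _ (Set.mem_image_of_mem _ hx)
  obtain ⟨y, hy, e⟩ := this
  exact ⟨y, hy, e.symm⟩

theorem exists_mark' (h : Carries A c f B d) {y : List ℕ} (hy : y ∈ B.pLeaves) :
    ∃ x ∈ A.pLeaves, f (c.mark x) = d.mark y := by
  have : d.mark y ∈ f '' c.marks A := h.marks ▸ Set.mem_image_of_mem _ hy
  obtain ⟨_, ⟨x, hx, rfl⟩, e⟩ := this
  exact ⟨x, hx, e⟩

theorem card_interior (h : Carries A c f B d) (hc : c.Fits A) (hd : d.Fits B) :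
    A.interior.card = B.interior.card := by
  have h1 := congrArg Set.ncard h.punctures
  rwa [Set.ncard_image_of_injective _ f.injective, Placement.punctures, Placement.punctures,
    hc.puncture_injOn.ncard_image, hd.puncture_injOn.ncard_image,
    Set.ncard_coe_finset, Set.ncard_coe_finset] at h1

theorem card_pLeaves (h : Carries A c f B d) (hc : c.Fits A) (hd : d.Fits B) :
    A.pLeaves.card = B.pLeaves.card := by
  have h1 := congrArg Set.ncard h.marks
  rwa [Set.ncard_image_of_injective _ f.injective, Placement.marks, Placement.marks,
    hc.mark_injOn.ncard_image, hd.mark_injOn.ncard_image,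
    Set.ncard_coe_finset, Set.ncard_coe_finset] at h1

theorem _root_.Chambord.Placement.Matches.image_punctures (hh : Matches A c d h) :
    h '' c.punctures A = d.punctures A := by
  rw [Placement.punctures, Placement.punctures, Set.image_image]
  exact Set.image_congr hh.puncture

theorem _root_.Chambord.Placement.Matches.image_marks (hh : Matches A c d h) :
    h '' c.marks A = d.marks A := by
  rw [Placement.marks, Placement.marks, Set.image_image]
  exact Set.image_congr hh.mark

theorem matches_mul {c' d' : Placement} (H : Carries A c f B d) (hh : Matches A c' c h)
    (hk : Matches B d d' k) : Carries A c' (k * f * h) B d' where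
  isotopy := by
    obtain ⟨F⟩ := H.isotopy
    obtain ⟨G⟩ := hh.isSlide.isotopy
    obtain ⟨K⟩ := hk.isSlide.isotopy
    exact ⟨(K.mul F).mul G⟩
  punctures := by
    rw [← hk.image_punctures, ← H.punctures, ← hh.image_punctures, Set.image_image, Set.image_image]
    rfl
  marks := by
    rw [← hk.image_marks, ← H.marks, ← hh.image_marks, Set.image_image, Set.image_image]
    rfl
  label x hx y hy e := H.label x hx y hy (by
    rw [← hh.mark x hx]
    refine k.injective ?_
    rw [hk.mark y hy, ← e]
    rfl)

theorem congr (H : Carries A c f B d) (h : IsotopicRel (c.punctures A ∪ c.marks A) f f') :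
    Carries A c f' B d where
  isotopy := by
    obtain ⟨F⟩ := H.isotopy
    obtain ⟨G⟩ := h.mono (Set.empty_subset _)
    have := F.mul G
    rw [mul_inv_cancel_left] at this
    exact ⟨this⟩
  punctures := by
    rw [← H.punctures]
    exact Set.image_congr fun z hz => (h.apply_eq (Or.inl hz)).symm
  marks := by
    rw [← H.marks]
    exact Set.image_congr fun z hz => (h.apply_eq (Or.inr hz)).symm
  label x hx y hy e := H.label x hx y hy
    ((h.apply_eq (Or.inr (Set.mem_image_of_mem _ hx))).trans e)

theorem mul {C : Forest P w} (H : Carries A c f B d) (K : Carries B d g C e) :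
    Carries A c (g * f) C e where
  isotopy := by
    obtain ⟨F⟩ := H.isotopy
    obtain ⟨G⟩ := K.isotopy
    exact ⟨G.mul F⟩
  punctures := by
    rw [← K.punctures, ← H.punctures, Set.image_image]; rfl
  marks := by
    rw [← K.marks, ← H.marks, Set.image_image]; rfl
  label x hx z hz e' s := by
    obtain ⟨y, hy, e1⟩ := H.exists_mark hx
    exact (H.label x hx y hy e1 s).trans (K.label y hy z hz (by rw [← e1]; exact e') s)

theorem isotopicRel_matches {c' d' : Placement} (H : Carries A c f B d)
    (hff : IsotopicRel (c.punctures A ∪ c.marks A) f f') {h' k' : Disc ≃ₜ Disc}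
    (hh : Matches A c' c h) (hh' : Matches A c' c h') (hk : Matches B d d' k)
    (hk' : Matches B d d' k') :
    IsotopicRel (c'.punctures A ∪ c'.marks A) (k * f * h) (k' * f' * h') := by
  have H' := H.congr hff
  have h1 := ((hh.isotopicRel hh').mul_left (k * f))
  have h2 := (hff.mul_left k).mul_right hh'.isSlide.preservesBoundary fun _ hz => hh'.apply_mem hz
  have h3 := ((hk.isotopicRel hk').mul_right (h := f') H'.preservesBoundary
    fun _ hz => H'.apply_mem hz).mul_right hh'.isSlide.preservesBoundary fun _ hz => hh'.apply_mem hz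
  exact (h1.trans h2).trans h3

end Carries

end Placement

open Placement

namespace Forest

theorem fits_grid (A : Forest P w) : A.grid.Fits A where
  puncture_snd _ _ := rfl
  puncture_mem _ hx := gridPoint_mem_Ioo (rank_lt_card hx)
  puncture_lt _ hx _ hy :=
    (gridPoint_lt_iff (rank_lt_card hx) (rank_lt_card hy)).trans (rank_lt_iff hx hy)
  mark_snd _ _ := rfl
  mark_mem _ hx := gridPoint_mem_Ioo (rank_lt_card hx)
  mark_lt _ hx _ hy :=
    (gridPoint_lt_iff (rank_lt_card hx) (rank_lt_card hy)).trans (rank_lt_iff hx hy)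

theorem punctures_grid (A : Forest P w) : A.grid.punctures A = punctures A.interior.card := by
  ext z
  constructor
  · rintro ⟨x, hx, rfl⟩
    exact ⟨_, rank_lt_card hx, rfl⟩
  · rintro ⟨r, hr, rfl⟩
    obtain ⟨x, hx, rfl⟩ := exists_rank_eq hr
    exact ⟨x, hx, rfl⟩

theorem marks_grid (A : Forest P w) : A.grid.marks A = marks A.pLeaves.card := by
  ext z
  constructor
  · rintro ⟨x, hx, rfl⟩
    exact ⟨_, rank_lt_card hx, rfl⟩
  · rintro ⟨r, hr, rfl⟩
    obtain ⟨x, hx, rfl⟩ := exists_rank_eq hr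
    exact ⟨x, hx, rfl⟩

end Forest

namespace Diagram

variable {Δ Δ' : Diagram P w} {A B C : Forest P w} {c d e c' d' : Placement}
  {f f' g h k : Disc ≃ₜ Disc}

theorem punctures_top (Δ : Diagram P w) : Δ.top.grid.punctures Δ.top = punctures Δ.p := by
  rw [Δ.top.punctures_grid, Δ.isDiagram.interior_top]

theorem punctures_bot (Δ : Diagram P w) : Δ.bot.grid.punctures Δ.bot = punctures Δ.p := by
  rw [Δ.bot.punctures_grid, Δ.isDiagram.interior_bot]

theorem marks_top (Δ : Diagram P w) : Δ.top.grid.marks Δ.top = marks Δ.q := by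
  rw [Δ.top.marks_grid, Δ.isDiagram.pLeaves_top]

theorem marks_bot (Δ : Diagram P w) : Δ.bot.grid.marks Δ.bot = marks Δ.q := by
  rw [Δ.bot.marks_grid, Δ.isDiagram.pLeaves_bot]

theorem image_eq_of_iff {f : Disc ≃ₜ Disc} {X : Set Disc} (h : ∀ z, f z ∈ X ↔ z ∈ X) :
    f '' X = X := by
  ext z
  constructor
  · rintro ⟨y, hy, rfl⟩
    exact (h y).2 hy
  · intro hz
    exact ⟨f.symm z, (h _).1 (by rwa [f.apply_symm_apply]), f.apply_symm_apply z⟩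

theorem iff_of_image_eq {f : Disc ≃ₜ Disc} {X : Set Disc} (h : f '' X = X) (z : Disc) :
    f z ∈ X ↔ z ∈ X := by
  conv_lhs => rw [← h]
  exact f.injective.mem_set_image

/-- The homeomorphism `f` represents the braid of `Δ`, when the punctures and the marked points
are placed by means of `c` at the top and `d` at the bottom. -/
structure Presents (Δ : Diagram P w) (c : Placement) (f : Disc ≃ₜ Disc) (d : Placement) :
    Prop where
  fits_top : c.Fits Δ.top
  fits_bot : d.Fits Δ.bot
  exists_rep : ∃ (g : homeoGroup Δ.p Δ.q) (h k : Disc ≃ₜ Disc), braidClass g = Δ.braid ∧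
    Matches Δ.top c Δ.top.grid h ∧ Matches Δ.bot Δ.bot.grid d k ∧ f = k * g.1 * h

theorem carries_rep {g : homeoGroup Δ.p Δ.q} (hg : braidClass g = Δ.braid) :
    Carries Δ.top Δ.top.grid g.1 Δ.bot Δ.bot.grid where
  isotopy := g.2.1
  punctures := by
    rw [Δ.punctures_top, Δ.punctures_bot]; exact image_eq_of_iff g.2.2.1
  marks := by
    rw [Δ.marks_top, Δ.marks_bot]; exact image_eq_of_iff g.2.2.2
  label x hx y hy e := Δ.isDiagram.label g hg x hx y hy e

theorem exists_presents (Δ : Diagram P w) (hc : c.Fits Δ.top) (hd : d.Fits Δ.bot) :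
    ∃ f, Δ.Presents c f d := by
  obtain ⟨g, hg⟩ := QuotientGroup.mk_surjective Δ.braid
  obtain ⟨h, hh⟩ := hc.exists_matches Δ.top.fits_grid
  obtain ⟨k, hk⟩ := Δ.bot.fits_grid.exists_matches hd
  exact ⟨k * g.1 * h, hc, hd, g, h, k, hg, hh, hk, rfl⟩

theorem presents_grid {g : homeoGroup Δ.p Δ.q} (hg : braidClass g = Δ.braid) :
    Δ.Presents Δ.top.grid g.1 Δ.bot.grid :=
  ⟨Δ.top.fits_grid, Δ.bot.fits_grid, g, 1, 1, hg, .one _ _, .one _ _, by rw [one_mul, mul_one]⟩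

namespace Presents

theorem carries (H : Δ.Presents c f d) : Carries Δ.top c f Δ.bot d := by
  obtain ⟨g, h, k, hg, hh, hk, rfl⟩ := H.exists_rep
  exact (carries_rep hg).matches_mul hh hk

theorem isotopicRel_rep {g₁ g₂ : homeoGroup Δ.p Δ.q} (h₁ : braidClass g₁ = Δ.braid)
    (h₂ : braidClass g₂ = Δ.braid) :
    IsotopicRel (Δ.top.grid.punctures Δ.top ∪ Δ.top.grid.marks Δ.top) g₁.1 g₂.1 := by
  rw [Δ.punctures_top, Δ.marks_top]
  exact braidClass_eq_iff.1 (h₁.trans h₂.symm)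

theorem isotopicRel (H : Δ.Presents c f d) (H' : Δ.Presents c f' d) :
    IsotopicRel (c.punctures Δ.top ∪ c.marks Δ.top) f f' := by
  obtain ⟨g, h, k, hg, hh, hk, rfl⟩ := H.exists_rep
  obtain ⟨g', h', k', hg', hh', hk', rfl⟩ := H'.exists_rep
  exact (carries_rep hg).isotopicRel_matches (isotopicRel_rep hg hg') hh hh' hk hk'

theorem matches_mul (H : Δ.Presents c f d) (hh : Matches Δ.top c' c h) (hk : Matches Δ.bot d d' k)
    (hc : c'.Fits Δ.top) (hd : d'.Fits Δ.bot) : Δ.Presents c' (k * f * h) d' := by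
  obtain ⟨g, h', k', hg, hh', hk', rfl⟩ := H.exists_rep
  exact ⟨hc, hd, g, _, _, hg, hh'.mul hh, hk.mul hk', by simp only [mul_assoc]⟩

theorem congr (H : Δ.Presents c f d)
    (hff : IsotopicRel (c.punctures Δ.top ∪ c.marks Δ.top) f f') : Δ.Presents c f' d := by
  obtain ⟨g, h, k, hg, hh, hk, rfl⟩ := H.exists_rep
  have h1 := H.carries.isotopicRel_matches hff hh.inv hh.inv hk.inv hk.inv
  have h2 := (H.carries.congr hff).matches_mul hh.inv hk.inv
  rw [show k⁻¹ * (k * g.1 * h) * h⁻¹ = g.1 by group] at h1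
  let g' : homeoGroup Δ.p Δ.q := ⟨k⁻¹ * f' * h⁻¹, h2.isotopy, iff_of_image_eq (by
    have := h2.punctures
    rwa [Δ.punctures_top, Δ.punctures_bot] at this), iff_of_image_eq (by
    have := h2.marks
    rwa [Δ.marks_top, Δ.marks_bot] at this)⟩
  refine ⟨H.fits_top, H.fits_bot, g', h, k, ?_, hh, hk, ?_⟩
  · rw [← hg, eq_comm, braidClass_eq_iff, ← Δ.punctures_top, ← Δ.marks_top]
    exact h1
  · change f' = k * (k⁻¹ * f' * h⁻¹) * h
    group

theorem eq_of_presents (H : Δ.Presents c f d) (H' : Δ'.Presents c f d) (ht : Δ.top = Δ'.top)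
    (hb : Δ.bot = Δ'.bot) : Δ = Δ' := by
  obtain ⟨A, β, B, hΔ⟩ := Δ
  rename_i p q
  obtain ⟨A', β', B', hΔ'⟩ := Δ'
  rename_i p' q'
  obtain rfl : A = A' := ht
  obtain rfl : B = B' := hb
  obtain rfl : p = p' := hΔ.interior_top.symm.trans hΔ'.interior_top
  obtain rfl : q = q' := hΔ.pLeaves_top.symm.trans hΔ'.pLeaves_top
  obtain ⟨g, h, k, hg, hh, hk, rfl⟩ := H.exists_rep
  obtain ⟨g', h', k', hg', hh', hk', e⟩ := H'.exists_rep
  have h1 := H.carries.isotopicRel_matches (.refl _ _) hh.inv hh'.inv hk.inv hk'.inv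
  rw [show k⁻¹ * (k * g.1 * h) * h⁻¹ = g.1 by group, e,
    show k'⁻¹ * (k' * g'.1 * h') * h'⁻¹ = g'.1 by group, punctures_top, marks_top] at h1
  have h2 : braidClass g = braidClass g' := braidClass_eq_iff.2 h1
  obtain rfl : β = β' := hg.symm.trans (h2.trans hg')
  rfl

end Presents

theorem exists_of_carries (hc : c.Fits A) (hd : d.Fits B) (H : Carries A c f B d) :
    ∃ Δ : Diagram P w, Δ.top = A ∧ Δ.bot = B ∧ Δ.Presents c f d := by
  obtain ⟨h, hh⟩ := hc.exists_matches A.fits_grid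
  obtain ⟨k, hk⟩ := B.fits_grid.exists_matches hd
  have h2 := H.matches_mul hh.inv hk.inv
  have hp := H.card_interior hc hd
  have hq := H.card_pLeaves hc hd
  let g : homeoGroup A.interior.card A.pLeaves.card :=
    ⟨k⁻¹ * f * h⁻¹, h2.isotopy, iff_of_image_eq (by
      have := h2.punctures
      rwa [A.punctures_grid, B.punctures_grid, ← hp] at this), iff_of_image_eq (by
      have := h2.marks
      rwa [A.marks_grid, B.marks_grid, ← hq] at this)⟩
  let Δ : Diagram P w := ⟨A, braidClass g, B, ⟨rfl, hp.symm, rfl, hq.symm, by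
    intro g' hg' x hx y hy e
    refine h2.label x hx y hy ?_
    have h3 := braidClass_eq_iff.1 hg'
    exact (h3.apply_eq (Or.inr (A.marks_grid ▸ Set.mem_image_of_mem _ hx))).symm.trans e⟩⟩
  refine ⟨Δ, rfl, rfl, hc, hd, g, h, k, rfl, hh, hk, ?_⟩
  change f = k * (k⁻¹ * f * h⁻¹) * h
  group

end Diagram

end Chambord

namespace Chambord

open unitInterval Topology

variable {S : Type*} {P : SemigroupPresentation S} {w : List S}

theorem IsVertex.eq_of_children (hP : P.IsArboreal) {a b : List ℕ} {u u' : S}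
    (ha : IsVertex P w a u) (hb : IsVertex P w b u') (hc : ∃ i, HasVertex P w (a ++ [i]))
    (h : ∀ i s, IsVertex P w (a ++ [i]) s ↔ IsVertex P w (b ++ [i]) s) : u = u' := by
  have key : ∀ {a : List ℕ} {u : S}, IsVertex P w a u → (∃ i, HasVertex P w (a ++ [i])) →
      ∃ v, ([u], v) ∈ P.rels ∧ ∀ (i : ℕ) s, v[i]? = some s ↔ IsVertex P w (a ++ [i]) s := by
    rintro a u ha ⟨i, s, hs⟩
    obtain ⟨u', v, h1, h2, h3⟩ := (Chambord.isVertex_append_iff ha.ne_nil).1 hs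
    obtain rfl := ha.unique hP h1
    refine ⟨v, h2, fun j t => ⟨fun h => (Chambord.isVertex_append_iff ha.ne_nil).2 ⟨u, v, ha, h2, h⟩,
      fun h => ?_⟩⟩
    obtain ⟨u'', v', h1', h2', h3'⟩ := (Chambord.isVertex_append_iff ha.ne_nil).1 h
    obtain rfl := ha.unique hP h1'
    rwa [hP.right_unique h2 h2']
  obtain ⟨v, hv, hv'⟩ := key ha hc
  obtain ⟨i, s, hs⟩ := hc
  obtain ⟨v', hv1, hv1'⟩ := key hb ⟨i, s, (h i s).1 hs⟩
  have e : v = v' := List.ext_getElem? fun i => Option.ext fun s => by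
    rw [hv', hv1', h]
  have := (hP.2 _ hv _ hv1).2 e
  simpa using this

namespace Placement

variable {A A' B B' C C' : Forest P w} {c d e c' d' : Placement} {a b a' b' x : List ℕ}
  {f f' g h k : Disc ≃ₜ Disc}

theorem prune_mark_self (c : Placement) (a : List ℕ) : (c.prune a).mark a = c.mark (a ++ [0]) :=
  Function.update_self _ _ _

theorem prune_mark_of_ne (c : Placement) (h : x ≠ a) : (c.prune a).mark x = c.mark x :=
  Function.update_of_ne h _ _

theorem prune_comm (c : Placement) (hne : a ≠ a') (h : a' ++ [0] ≠ a) (h' : a ++ [0] ≠ a') :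
    (c.prune a).prune a' = (c.prune a').prune a := by
  simp only [prune, Placement.mk.injEq, true_and]
  rw [Function.update_of_ne h, Function.update_of_ne h', Function.update_comm hne]

theorem Fits.prune (hP : P.IsArboreal) (hc : c.Fits A) (h : A.Prunes A' a) :
    (c.prune a).Fits A' := by
  have h0 := h.zero_mem hP
  have hne : ∀ x ∈ A'.pLeaves, x ≠ a → x ∈ A.pLeaves := fun x hx hxa =>
    (((h.mem_pLeaves_iff).1 hx).resolve_left hxa).1
  refine ⟨fun x hx => hc.puncture_snd x (h.mem_interior_iff.1 hx).1,
    fun x hx => hc.puncture_mem x (h.mem_interior_iff.1 hx).1,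
    fun x hx y hy => hc.puncture_lt x (h.mem_interior_iff.1 hx).1 y (h.mem_interior_iff.1 hy).1,
    fun x hx => ?_, fun x hx => ?_, fun x hx y hy => ?_⟩
  · by_cases hxa : x = a
    · rw [hxa, prune_mark_self]; exact hc.mark_snd _ h0
    · rw [prune_mark_of_ne c hxa]; exact hc.mark_snd x (hne x hx hxa)
  · by_cases hxa : x = a
    · rw [hxa, prune_mark_self]; exact hc.mark_mem _ h0
    · rw [prune_mark_of_ne c hxa]; exact hc.mark_mem x (hne x hx hxa)
  · by_cases hxa : x = a
    · by_cases hya : y = a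
      · rw [hxa, hya]
        exact iff_of_false (lt_irrefl _) (leftOf_irrefl _)
      · rw [hxa, prune_mark_self, prune_mark_of_ne c hya, hc.mark_lt _ h0 y (hne y hy hya),
          leftOf_append_left (h.not_prefix hy hya)]
    · by_cases hya : y = a
      · rw [hya, prune_mark_self, prune_mark_of_ne c hxa, hc.mark_lt x (hne x hx hxa) _ h0,
          leftOf_append_right (h.not_prefix hx hxa)]
      · rw [prune_mark_of_ne c hxa, prune_mark_of_ne c hya,
          hc.mark_lt x (hne x hx hxa) y (hne y hy hya)]

theorem Matches.prune (hP : P.IsArboreal) (hh : Matches A c d h) (hA : A.Prunes A' a) :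
    Matches A' (c.prune a) (d.prune a) h where
  isSlide := hh.isSlide
  puncture x hx := hh.puncture x (hA.mem_interior_iff.1 hx).1
  mark x hx := by
    by_cases hxa : x = a
    · rw [hxa, prune_mark_self, prune_mark_self, hh.mark _ (hA.zero_mem hP)]
    · rw [prune_mark_of_ne c hxa, prune_mark_of_ne d hxa,
        hh.mark x ((hA.mem_pLeaves_iff.1 hx).resolve_left hxa).1]

theorem Fits.punctures_prune (hc : c.Fits A) (h : A.Prunes A' a) :
    (c.prune a).punctures A' = c.punctures A \ {c.puncture a} := by
  ext z
  constructor
  · rintro ⟨x, hx, rfl⟩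
    obtain ⟨h1, h2⟩ := h.mem_interior_iff.1 hx
    exact ⟨⟨x, h1, rfl⟩, fun e => h2 (hc.puncture_injOn h1 h.mem_interior e)⟩
  · rintro ⟨⟨x, hx, rfl⟩, hne⟩
    exact ⟨x, h.mem_interior_iff.2 ⟨hx, fun e => hne (by rw [e]; rfl)⟩, rfl⟩

theorem Fits.marks_prune (hP : P.IsArboreal) (hc : c.Fits A) (h : A.Prunes A' a) :
    (c.prune a).marks A' =
      c.marks A \ {z | ∃ i, HasVertex P w (a ++ [i]) ∧ i ≠ 0 ∧ c.mark (a ++ [i]) = z} := by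
  ext z
  constructor
  · rintro ⟨x, hx, rfl⟩
    by_cases hxa : x = a
    · rw [hxa, prune_mark_self]
      refine ⟨⟨_, h.zero_mem hP, rfl⟩, ?_⟩
      rintro ⟨i, h1, h2, h3⟩
      exact h2 (append_singleton_inj (hc.mark_injOn (h.children i h1) (h.zero_mem hP) h3)).2
    · obtain ⟨h1, h2⟩ := (h.mem_pLeaves_iff.1 hx).resolve_left hxa
      rw [prune_mark_of_ne c hxa]
      refine ⟨⟨x, h1, rfl⟩, ?_⟩
      rintro ⟨i, h3, -, h4⟩
      exact h2 i (hc.mark_injOn (h.children i h3) h1 h4).symm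
  · rintro ⟨⟨x, hx, rfl⟩, hne⟩
    rcases h.mem_pLeaves_iff_of_top.1 hx with ⟨h1, h2⟩ | ⟨i, h1, rfl⟩
    · exact ⟨x, h1, prune_mark_of_ne c h2⟩
    · by_cases hi : i = 0
      · exact ⟨a, h.mem, by rw [hi, prune_mark_self]⟩
      · exact absurd ⟨i, h1, hi, rfl⟩ hne

theorem Fits.prune_subset (hP : P.IsArboreal) (hc : c.Fits A) (h : A.Prunes A' a) :
    (c.prune a).punctures A' ∪ (c.prune a).marks A' ⊆ c.punctures A ∪ c.marks A := by
  rw [hc.punctures_prune h, hc.marks_prune hP h]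
  exact Set.union_subset_union Set.sdiff_subset Set.sdiff_subset

/-- The vertices `a` and `b` form a dipole, when the punctures and the marked points are placed by
means of `c` and `d`, and the braid is represented by `f`. -/
structure Dipole (A : Forest P w) (c : Placement) (f : Disc ≃ₜ Disc) (B : Forest P w)
    (d : Placement) (a b : List ℕ) : Prop where
  top_mem : a ∈ A.interior
  bot_mem : b ∈ B.interior
  exists_child : ∃ i, HasVertex P w (a ++ [i])
  top_children : ∀ i, HasVertex P w (a ++ [i]) → a ++ [i] ∈ A.pLeaves
  bot_children : ∀ i, HasVertex P w (b ++ [i]) → b ++ [i] ∈ B.pLeaves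
  child_iff : ∀ i, HasVertex P w (a ++ [i]) ↔ HasVertex P w (b ++ [i])
  puncture : f (c.puncture a) = d.puncture b
  mark : ∀ i, HasVertex P w (a ++ [i]) → f (c.mark (a ++ [i])) = d.mark (b ++ [i])
  par : ∀ i, HasVertex P w (a ++ [i]) →
    Par (d.punctures B) f (c.puncture a) (c.mark (a ++ [i]))

theorem Carries.mem_of_apply_mem (H : Carries A c f B d) {z : Disc} (hz : f z ∈ d.punctures B) :
    z ∈ c.punctures A := by
  rwa [← H.punctures, f.injective.mem_set_image] at hz

namespace Dipole

theorem hasVertex_top (D : Dipole A c f B d a b) : HasVertex P w a :=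
  A.hasVertex a (Forest.mem_interior.1 D.top_mem).1

theorem hasVertex_bot (D : Dipole A c f B d a b) : HasVertex P w b :=
  B.hasVertex b (Forest.mem_interior.1 D.bot_mem).1

theorem hasVertex_zero (hP : P.IsArboreal) (D : Dipole A c f B d a b) :
    HasVertex P w (a ++ [0]) := D.hasVertex_top.append_zero hP D.exists_child

theorem exists_child_bot (D : Dipole A c f B d a b) : ∃ i, HasVertex P w (b ++ [i]) := by
  obtain ⟨i, hi⟩ := D.exists_child
  exact ⟨i, (D.child_iff i).1 hi⟩

theorem exists_prunes_top (D : Dipole A c f B d a b) : ∃ A' : Forest P w, A.Prunes A' a :=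
  Forest.exists_prunes (Forest.mem_interior.1 D.top_mem).1 D.exists_child D.top_children

theorem exists_prunes_bot (D : Dipole A c f B d a b) : ∃ B' : Forest P w, B.Prunes B' b :=
  Forest.exists_prunes (Forest.mem_interior.1 D.bot_mem).1 D.exists_child_bot D.bot_children

theorem congr (D : Dipole A c f B d a b) (H : Carries A c f B d) (hc : c.Fits A)
    (h : IsotopicRel (c.punctures A ∪ c.marks A) f f') : Dipole A c f' B d a b := by
  have ha : c.puncture a ∈ c.punctures A := Set.mem_image_of_mem _ D.top_mem
  have hm : ∀ i, HasVertex P w (a ++ [i]) → c.mark (a ++ [i]) ∈ c.marks A :=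
    fun i hi => Set.mem_image_of_mem _ (D.top_children i hi)
  exact ⟨D.top_mem, D.bot_mem, D.exists_child, D.top_children, D.bot_children, D.child_iff,
    (h.apply_eq (Or.inl ha)).symm.trans D.puncture,
    fun i hi => (h.apply_eq (Or.inr (hm i hi))).symm.trans (D.mark i hi),
    fun i hi => (D.par i hi).congr h (Or.inr (hm i hi)) (Or.inl ha)
      (hc.snd_of_mem_marks (hm i hi)) (hc.snd_of_mem_punctures ha) fun z hz =>
      ⟨Or.inl (H.mem_of_apply_mem hz), hc.snd_of_mem_punctures (H.mem_of_apply_mem hz)⟩⟩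

theorem matches_mul (D : Dipole A c f B d a b) (H : Carries A c f B d) (hc : c.Fits A)
    (hd : d.Fits B) (hc' : c'.Fits A) (hd' : d'.Fits B) (hh : Matches A c' c h)
    (hk : Matches B d d' k) : Dipole A c' (k * f * h) B d' a b := by
  have hp : (k * f * h) (c'.puncture a) = d'.puncture b := by
    change k (f (h _)) = _
    rw [hh.puncture a D.top_mem, D.puncture, hk.puncture b D.bot_mem]
  have H' := H.matches_mul hh hk
  have hi : ∀ {x}, x ∈ A.interior → h⁻¹ (c.puncture x) = c'.puncture x :=
    fun {x} hx => hh.inv.puncture x hx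
  refine ⟨D.top_mem, D.bot_mem, D.exists_child, D.top_children, D.bot_children, D.child_iff, hp,
    fun i hi => ?_, fun i hi' => ?_⟩
  · change k (f (h _)) = _
    rw [hh.mark _ (D.top_children i hi), D.mark i hi,
      hk.mark _ (D.bot_children i ((D.child_iff i).1 hi))]
  · have hmi := D.top_children i hi'
    have key := HomotopicIn.slide (f := f) (f' := k * f * h) (h := h⁻¹) (k := k)
      (R := d.punctures B \ {f (c.puncture a)})
      (R' := d'.punctures B \ {(k * f * h) (c'.puncture a)}) hh.inv.isSlide hk.isSlide
      (fun z => by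
        change k (f (h (h.symm z))) = _
        rw [h.apply_symm_apply]) (hc.mark_snd _ hmi) (hc.puncture_snd _ D.top_mem)
      (by rw [D.mark i hi']; exact hd.mark_snd _ (D.bot_children i ((D.child_iff i).1 hi')))
      (by rw [D.puncture]; exact hd.puncture_snd _ D.bot_mem)
      (fun z hz => hd'.snd_of_mem_punctures hz.1)
      (fun z hz => hc'.snd_of_mem_punctures (H'.mem_of_apply_mem hz.1))
      (by rw [hi D.top_mem]; exact fun h => h.2 rfl)
      (fun z hz => by
        refine ⟨?_, fun e => hz.2 ?_⟩
        · have := hz.1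
          rwa [← hk.image_punctures, k.injective.mem_set_image] at this
        · change k z = k (f (h _))
          rw [hh.puncture a D.top_mem, Set.mem_singleton_iff.1 e])
      (D.par i hi')
    rw [hi D.top_mem, hh.inv.mark _ hmi] at key
    exact key

theorem prunes_mark (D : Dipole A c f B d a b) (hP : P.IsArboreal) :
    f ((c.prune a).mark a) = (d.prune b).mark b := by
  rw [prune_mark_self, prune_mark_self, D.mark 0 (D.hasVertex_zero hP)]

theorem isVertex_iff (D : Dipole A c f B d a b) (hP : P.IsArboreal) (H : Carries A c f B d)
    (s : S) : IsVertex P w a s ↔ IsVertex P w b s := by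
  obtain ⟨u, hu⟩ := D.hasVertex_top
  obtain ⟨u', hu'⟩ := D.hasVertex_bot
  have e : u = u' := hu.eq_of_children hP hu' D.exists_child fun i s => by
    by_cases hi : HasVertex P w (a ++ [i])
    · exact H.label _ (D.top_children i hi) _ (D.bot_children i ((D.child_iff i).1 hi))
        (D.mark i hi) s
    · exact iff_of_false (fun h => hi ⟨s, h⟩) fun h => hi ((D.child_iff i).2 ⟨s, h⟩)
  subst e
  exact ⟨fun h => hu.unique hP h ▸ hu', fun h => hu'.unique hP h ▸ hu⟩

theorem carries_prune (D : Dipole A c f B d a b) (hP : P.IsArboreal) (H : Carries A c f B d)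
    (hc : c.Fits A) (hd : d.Fits B) (hA : A.Prunes A' a) (hB : B.Prunes B' b) :
    Carries A' (c.prune a) f B' (d.prune b) where
  isotopy := H.isotopy
  punctures := by
    rw [hc.punctures_prune hA, hd.punctures_prune hB, Set.image_sdiff f.injective, H.punctures,
      Set.image_singleton, D.puncture]
  marks := by
    rw [hc.marks_prune hP hA, hd.marks_prune hP hB, Set.image_sdiff f.injective, H.marks]
    congr 1
    ext z
    constructor
    · rintro ⟨_, ⟨i, h1, h2, rfl⟩, rfl⟩
      exact ⟨i, (D.child_iff i).1 h1, h2, (D.mark i h1).symm⟩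
    · rintro ⟨i, h1, h2, rfl⟩
      have h1 := (D.child_iff i).2 h1
      exact ⟨_, ⟨i, h1, h2, rfl⟩, D.mark i h1⟩
  label x hx y hy e s := by
    have hd' := hd.prune hP hB
    by_cases hxa : x = a
    · subst hxa
      rw [D.prunes_mark hP] at e
      obtain rfl := hd'.mark_injOn hB.mem hy e
      exact D.isVertex_iff hP H s
    · have hyb : y ≠ b := by
        rintro rfl
        rw [← D.prunes_mark hP] at e
        exact hxa ((hc.prune hP hA).mark_injOn hx hA.mem (f.injective e))
      rw [prune_mark_of_ne c hxa, prune_mark_of_ne d hyb] at e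
      exact H.label x ((hA.mem_pLeaves_iff.1 hx).resolve_left hxa).1 y
        ((hB.mem_pLeaves_iff.1 hy).resolve_left hyb).1 e s

theorem bot_unique (D : Dipole A c f B d a b) (D' : Dipole A c f B d a b') (hd : d.Fits B) :
    b = b' := hd.puncture_injOn D.bot_mem D'.bot_mem (D.puncture.symm.trans D'.puncture)

theorem top_unique (D : Dipole A c f B d a b) (D' : Dipole A c f B d a' b) (hc : c.Fits A) :
    a = a' :=
  hc.puncture_injOn D.top_mem D'.top_mem (f.injective (D.puncture.trans D'.puncture.symm))

/-- Another dipole is still there after the reduction of a dipole. -/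
theorem prune (D : Dipole A c f B d a b) (D' : Dipole A c f B d a' b') (hc : c.Fits A)
    (hd : d.Fits B) (hne : a' ≠ a) (hA : A.Prunes A' a) (hB : B.Prunes B' b) :
    Dipole A' (c.prune a) f B' (d.prune b) a' b' := by
  have hne' : b' ≠ b := by
    rintro rfl
    exact hne (D'.top_unique D hc)
  have ht : ∀ i, HasVertex P w (a' ++ [i]) → a' ++ [i] ≠ a := fun i hi e =>
    hA.not_mem_pLeaves (e ▸ D'.top_children i hi)
  have hb : ∀ i, HasVertex P w (b' ++ [i]) → b' ++ [i] ≠ b := fun i hi e =>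
    hB.not_mem_pLeaves (e ▸ D'.bot_children i hi)
  refine ⟨hA.mem_interior_iff.2 ⟨D'.top_mem, hne⟩, hB.mem_interior_iff.2 ⟨D'.bot_mem, hne'⟩,
    D'.exists_child, fun i hi => hA.mem_pLeaves_iff.2 (Or.inr ⟨D'.top_children i hi, fun j =>
      append_singleton_ne hne⟩), fun i hi => hB.mem_pLeaves_iff.2
      (Or.inr ⟨D'.bot_children i hi, fun j => append_singleton_ne hne'⟩), D'.child_iff,
    D'.puncture, fun i hi => ?_, fun i hi => ?_⟩
  · rw [prune_mark_of_ne c (ht i hi), prune_mark_of_ne d (hb i ((D'.child_iff i).1 hi))]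
    exact D'.mark i hi
  · rw [prune_mark_of_ne c (ht i hi), hd.punctures_prune hB]
    exact HomotopicIn.mono (D'.par i hi) (Set.compl_subset_compl.2
      (Set.sdiff_subset_sdiff_left Set.sdiff_subset))

theorem inv (D : Dipole A c f B d a b) (H : Carries A c f B d) : Dipole B d f⁻¹ A c b a := by
  have e1 : f⁻¹ (d.puncture b) = c.puncture a := by
    rw [← D.puncture]; exact f.symm_apply_apply _
  have e2 : ∀ i, HasVertex P w (b ++ [i]) → f⁻¹ (d.mark (b ++ [i])) = c.mark (a ++ [i]) := by
    intro i hi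
    rw [← D.mark i ((D.child_iff i).2 hi)]; exact f.symm_apply_apply _
  refine ⟨D.bot_mem, D.top_mem, D.exists_child_bot, D.bot_children, D.top_children,
    fun i => (D.child_iff i).symm, e1, e2, fun i hi => ?_⟩
  have hi' := (D.child_iff i).2 hi
  have := (D.par i hi').inv (R' := c.punctures A) fun z hz => by
    rw [← H.punctures]; exact Set.mem_image_of_mem _ hz
  rwa [D.puncture, D.mark i hi'] at this

theorem mul {b₁ : List ℕ} (D : Dipole A c f B d a b) (D' : Dipole B d g C e b b₁)
    (K : Carries B d g C e) : Dipole A c (g * f) C e a b₁ := by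
  refine ⟨D.top_mem, D'.bot_mem, D.exists_child, D.top_children, D'.bot_children,
    fun i => (D.child_iff i).trans (D'.child_iff i), ?_, fun i hi => ?_, fun i hi => ?_⟩
  · change g (f _) = _
    rw [D.puncture, D'.puncture]
  · change g (f _) = _
    rw [D.mark i hi, D'.mark i ((D.child_iff i).1 hi)]
  · refine (D.par i hi).comp ?_ fun z hz => K.mem_of_apply_mem hz
    rw [D.puncture, D.mark i hi]
    exact D'.par i ((D.child_iff i).1 hi)

theorem one (hc : c.Fits A) (hA : A.Prunes A' a) : Dipole A c 1 A c a a :=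
  ⟨hA.mem_interior, hA.mem_interior, hA.exists_child, hA.children, hA.children, fun _ => Iff.rfl,
    rfl, fun _ _ => rfl, fun i hi => .one (fun _ hz => hc.snd_of_mem_punctures hz)
      (hc.puncture_snd a hA.mem_interior) (hc.mark_snd _ (hA.children i hi))⟩

end Dipole

end Placement

open Placement

namespace Diagram

variable {Δ Δ' Δ₁ Δ₂ Δ₁' Δ₂' : Diagram P w} {a b a' b' : List ℕ} {c d e c' d' : Placement}
  {f f' g h k : Disc ≃ₜ Disc}

theorem isDipole_iff_grid {g : homeoGroup Δ.p Δ.q} (hg : braidClass g = Δ.braid) :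
    IsDipole Δ a b ↔ Dipole Δ.top Δ.top.grid g.1 Δ.bot Δ.bot.grid a b := by
  constructor
  · intro D
    obtain ⟨f, hf, F, h1, h2⟩ := D.parallel
    have D' : Dipole Δ.top Δ.top.grid f.1 Δ.bot Δ.bot.grid a b :=
      ⟨D.top_mem, D.bot_mem, D.exists_child, D.top_children, D.bot_children, D.child_iff, h1,
        fun i hi => (h2 i hi).1, fun i hi => by
          rw [Δ.punctures_bot]
          exact (isParallel_iff_par f.2.2.1 F _ _).1 (h2 i hi).2⟩
    exact D'.congr (carries_rep hf) Δ.top.fits_grid (Presents.isotopicRel_rep hf hg)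
  · intro D
    obtain ⟨G⟩ := g.2.1
    refine ⟨D.top_mem, D.bot_mem, D.exists_child, D.top_children, D.bot_children, D.child_iff,
      g, hg, G, D.puncture, fun i hi => ⟨D.mark i hi, (isParallel_iff_par g.2.2.1 G _ _).2 ?_⟩⟩
    have := D.par i hi
    rwa [Δ.punctures_bot] at this

theorem Presents.isDipole_iff (H : Δ.Presents c f d) :
    IsDipole Δ a b ↔ Dipole Δ.top c f Δ.bot d a b := by
  obtain ⟨g, h, k, hg, hh, hk, rfl⟩ := H.exists_rep
  rw [isDipole_iff_grid hg]
  refine ⟨fun D => D.matches_mul (carries_rep hg) Δ.top.fits_grid Δ.bot.fits_grid H.fits_top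
    H.fits_bot hh hk, fun D => ?_⟩
  have := D.matches_mul H.carries H.fits_top H.fits_bot Δ.top.fits_grid Δ.bot.fits_grid
    hh.inv hk.inv
  rwa [show k⁻¹ * (k * g.1 * h) * h⁻¹ = g.1 by group] at this

/-- The diagram `Δ'` is obtained from `Δ` by reducing the dipole `a`, `b`. -/
def ReducesAt (a b : List ℕ) (Δ Δ' : Diagram P w) : Prop :=
  Δ.top.Prunes Δ'.top a ∧ Δ.bot.Prunes Δ'.bot b ∧ ∃ c f d, Δ.Presents c f d ∧
    Dipole Δ.top c f Δ.bot d a b ∧ Δ'.Presents (c.prune a) f (d.prune b)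

theorem ReducesAt.isDipole (R : ReducesAt a b Δ Δ') : IsDipole Δ a b := by
  obtain ⟨-, -, c, f, d, H, D, -⟩ := R
  exact H.isDipole_iff.2 D

theorem ReducesAt.presents (hP : P.IsArboreal) (R : ReducesAt a b Δ Δ') (H : Δ.Presents c f d) :
    Δ'.Presents (c.prune a) f (d.prune b) := by
  obtain ⟨hA, hB, c₀, f₀, d₀, H₀, D, H'⟩ := R
  obtain ⟨h, hh⟩ := H.fits_top.exists_matches H₀.fits_top
  obtain ⟨k, hk⟩ := H₀.fits_bot.exists_matches H.fits_bot
  have h1 := H₀.matches_mul hh hk H.fits_top H.fits_bot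
  have h2 := H'.matches_mul (hh.prune hP hA) (hk.prune hP hB) (H.fits_top.prune hP hA)
    (H.fits_bot.prune hP hB)
  exact h2.congr ((h1.isotopicRel H).mono (H.fits_top.prune_subset hP hA))

theorem reduces_iff (hP : P.IsArboreal) : Reduces Δ Δ' ↔ ∃ a b, ReducesAt a b Δ Δ' := by
  refine exists_congr fun a => exists_congr fun b => ?_
  constructor
  · rintro ⟨D, ht, hb, f, f', h, k, hf, hf', hh, hk, e⟩
    have prunes : ∀ {A A' : Forest P w} {a : List ℕ}, a ∈ A.interior →
        (∃ i, HasVertex P w (a ++ [i])) → (∀ i, HasVertex P w (a ++ [i]) → a ++ [i] ∈ A.pLeaves) →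
        (∀ x, x ∈ A'.verts ↔ x ∈ A.verts ∧ ∀ i, x ≠ a ++ [i]) → A.Prunes A' a := by
      intro A A' a h1 h2 h3 h4
      obtain ⟨A'', hA⟩ := Forest.exists_prunes (Forest.mem_interior.1 h1).1 h2 h3
      have : A'' = A' := Forest.ext (Finset.ext fun x => (hA.mem_verts_iff x).trans (h4 x).symm)
      exact this ▸ hA
    have hA := prunes D.top_mem D.exists_child D.top_children ht
    have hB := prunes D.bot_mem (by
      obtain ⟨i, hi⟩ := D.exists_child
      exact ⟨i, (D.child_iff i).1 hi⟩) D.bot_children hb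
    have mt : ∀ {A A' : Forest P w} {a : List ℕ} {h : Disc ≃ₜ Disc}, A.Prunes A' a →
        IsRenumbering A A' a h → Matches A' (A.grid.prune a) A'.grid h := by
      intro A A' a h hA hh
      refine ⟨hh.isSlide, fun x hx => ?_, fun x hx => ?_⟩
      · obtain ⟨h1, h2⟩ := hA.mem_interior_iff.1 hx
        exact hh.puncture_eq x h1 h2
      · by_cases hxa : x = a
        · rw [hxa, prune_mark_self]
          exact hh.mark_child
        · obtain ⟨h1, h2⟩ := (hA.mem_pLeaves_iff.1 hx).resolve_left hxa
          rw [prune_mark_of_ne _ hxa]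
          exact hh.mark_eq x h1 h2
    refine ⟨hA, hB, _, _, _, presents_grid hf, (isDipole_iff_grid hf).1 D,
      Δ.top.fits_grid.prune hP hA, Δ.bot.fits_grid.prune hP hB, f', h, k⁻¹, hf', mt hA hh,
      (mt hB hk).inv, ?_⟩
    ext1 z
    change f.1 z = k.symm (f'.1 (h z))
    rw [e, k.symm_apply_apply]
  · intro R
    obtain ⟨hA, hB, -⟩ := id R
    obtain ⟨g, hg⟩ := QuotientGroup.mk_surjective Δ.braid
    obtain ⟨g', h, k, hg', hh, hk, e⟩ := (R.presents hP (presents_grid hg)).exists_rep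
    have rn : ∀ {A A' : Forest P w} {a : List ℕ} {h : Disc ≃ₜ Disc}, A.Prunes A' a →
        Matches A' (A.grid.prune a) A'.grid h → IsRenumbering A A' a h := by
      intro A A' a h hA hh
      refine ⟨hh.isSlide, fun x h1 h2 => hh.puncture x (hA.mem_interior_iff.2 ⟨h1, h2⟩),
        fun x h1 h2 => ?_, ?_⟩
      · have := hh.mark x (hA.mem_pLeaves_iff.2 (Or.inr ⟨h1, h2⟩))
        rwa [prune_mark_of_ne _ (show x ≠ a from fun e => hA.not_mem_pLeaves (e ▸ h1))] at this
      · have := hh.mark a hA.mem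
        rwa [prune_mark_self] at this
    refine ⟨R.isDipole, hA.mem_verts_iff, hB.mem_verts_iff, g, g', h, k⁻¹, hg, hg', rn hA hh,
      rn hB hk.inv, fun z => ?_⟩
    rw [e]
    change _ = k.symm (k (g'.1 (h z)))
    rw [k.symm_apply_apply]

theorem exists_reducesAt (hP : P.IsArboreal) (D : IsDipole Δ a b) : ∃ Δ', ReducesAt a b Δ Δ' := by
  obtain ⟨f, H⟩ := Δ.exists_presents Δ.top.fits_grid Δ.bot.fits_grid
  have D := H.isDipole_iff.1 D
  obtain ⟨A', hA⟩ := D.exists_prunes_top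
  obtain ⟨B', hB⟩ := D.exists_prunes_bot
  obtain ⟨Δ', rfl, rfl, H'⟩ := exists_of_carries (H.fits_top.prune hP hA) (H.fits_bot.prune hP hB)
    (D.carries_prune hP H.carries H.fits_top H.fits_bot hA hB)
  exact ⟨Δ', hA, hB, _, _, _, H, D, H'⟩

theorem ReducesAt.unique (hP : P.IsArboreal) (R₁ : ReducesAt a b Δ Δ₁) (R₂ : ReducesAt a b Δ Δ₂) :
    Δ₁ = Δ₂ := by
  obtain ⟨f, H⟩ := Δ.exists_presents Δ.top.fits_grid Δ.bot.fits_grid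
  exact (R₁.presents hP H).eq_of_presents (R₂.presents hP H) (R₁.1.bot_unique R₂.1)
    (R₁.2.1.bot_unique R₂.2.1)

/-- Distinct dipoles have distinct vertices. -/
theorem ReducesAt.eq_or_ne (R₁ : ReducesAt a b Δ Δ₁) (R₂ : ReducesAt a' b' Δ Δ₂) :
    (a = a' ∧ b = b') ∨ (a ≠ a' ∧ b ≠ b') := by
  obtain ⟨f, H⟩ := Δ.exists_presents Δ.top.fits_grid Δ.bot.fits_grid
  have D₁ := H.isDipole_iff.1 R₁.isDipole
  have D₂ := H.isDipole_iff.1 R₂.isDipole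
  by_cases h : a = a'
  · subst h
    exact Or.inl ⟨rfl, D₁.bot_unique D₂ H.fits_bot⟩
  · refine Or.inr ⟨h, ?_⟩
    rintro rfl
    exact h (D₁.top_unique D₂ H.fits_top)

/-- The reductions of distinct dipoles commute. -/
theorem ReducesAt.commute (hP : P.IsArboreal) (R₁ : ReducesAt a b Δ Δ₁)
    (R₂ : ReducesAt a' b' Δ Δ₂) (hne : a ≠ a') :
    ∃ Δ', ReducesAt a' b' Δ₁ Δ' ∧ ReducesAt a b Δ₂ Δ' := by
  obtain ⟨f, H⟩ := Δ.exists_presents Δ.top.fits_grid Δ.bot.fits_grid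
  have D₁ := H.isDipole_iff.1 R₁.isDipole
  have D₂ := H.isDipole_iff.1 R₂.isDipole
  have hne' : b ≠ b' := by
    rintro rfl
    exact hne (D₁.top_unique D₂ H.fits_top)
  have H₁ := R₁.presents hP H
  have H₂ := R₂.presents hP H
  have D₁' := D₁.prune D₂ H.fits_top H.fits_bot hne.symm R₁.1 R₁.2.1
  have D₂' := D₂.prune D₁ H.fits_top H.fits_bot hne R₂.1 R₂.2.1
  obtain ⟨Δ', R₁'⟩ := exists_reducesAt hP (H₁.isDipole_iff.2 D₁')
  obtain ⟨Δ'', R₂'⟩ := exists_reducesAt hP (H₂.isDipole_iff.2 D₂')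
  have h1 := R₁'.presents hP H₁
  have h2 := R₂'.presents hP H₂
  rw [prune_comm _ hne.symm (fun e => R₂.1.not_mem_pLeaves (e ▸ R₁.1.zero_mem hP))
    (fun e => R₁.1.not_mem_pLeaves (e ▸ R₂.1.zero_mem hP)), prune_comm _ hne'.symm
    (fun e => R₂.2.1.not_mem_pLeaves (e ▸ R₁.2.1.zero_mem hP))
    (fun e => R₁.2.1.not_mem_pLeaves (e ▸ R₂.2.1.zero_mem hP))] at h2
  have key : ∀ {A A₁ A₂ A' A'' : Forest P w} {a a' : List ℕ}, A.Prunes A₁ a → A.Prunes A₂ a' →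
      A₁.Prunes A' a' → A₂.Prunes A'' a → A' = A'' := by
    intro A A₁ A₂ A' A'' a a' h1 h2 h3 h4
    refine Forest.ext (Finset.ext fun x => ?_)
    rw [h3.mem_verts_iff, h4.mem_verts_iff, h1.mem_verts_iff, h2.mem_verts_iff]
    tauto
  have e : Δ' = Δ'' := h1.eq_of_presents h2 (key R₁.1 R₂.1 R₁'.1 R₂'.1)
    (key R₁.2.1 R₂.2.1 R₁'.2.1 R₂'.2.1)
  exact ⟨Δ', R₁', e ▸ R₂'⟩

end Diagram

end Chambord

namespace Chambord

open unitInterval Topology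

variable {S : Type*} {P : SemigroupPresentation S} {w : List S}

theorem HomotopicIn.reverse {X : Type*} [TopologicalSpace X] {U : Set X} {γ δ : I → X}
    (h : HomotopicIn U γ δ) : HomotopicIn U (γ ∘ σ) (δ ∘ σ) := by
  have e0 := h.zero_eq
  have e1 := h.one_eq
  obtain ⟨K, h1, h2, h3, h4, h5, h6⟩ := h
  refine ⟨fun z => K (z.1, σ z.2), h1.comp (by fun_prop), fun t => h2 _, fun t => h3 _,
    fun s => ?_, fun s => ?_, fun z => h6 _⟩
  · simpa using h5 s
  · simpa using h4 s

theorem seg_comp_symm (x y : Disc) : ⇑(seg x y) ∘ σ = seg y x := by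
  rw [← seg_symm x y]; rfl

/-- If the image of a segment is homotopic to a segment, then the same holds for the segments from
a point that is close to its foot. -/
theorem HomotopicIn.change_foot {g : Disc ≃ₜ Disc} {R : Set Disc} {m y x : Disc} (hm : m.2 = 0)
    (hy : y.2 = 0) (hx : x.2 = half) (hgm : (g m).2 = 0) (hgy : (g y).2 = 0)
    (hgx : (g x).2 = half) (hR : ∀ z ∈ R, z.2 = half) (hgR : ∀ z, g z ∈ R → z.2 = half)
    (hRb : ∀ z ∈ R, z ∉ boundary) (hxR : g x ∉ R)
    (h₁ : HomotopicIn Rᶜ (g ∘ seg m x) (seg (g m) (g x)))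
    (h₂ : HomotopicIn boundary (g ∘ seg m y) (seg (g m) (g y))) :
    HomotopicIn Rᶜ (g ∘ seg y x) (seg (g y) (g x)) := by
  have low : ∀ {m y x : Disc}, m.2 = 0 → y.2 = 0 → x.2 = half →
      HomotopicIn (lowerWith x) (seg y x) ((seg y m).trans (seg m x)) := by
    intro m y x hm hy hx
    exact (discConvex_lowerWith hx).homotopicIn (Path.continuous _) (Path.continuous _) (by simp)
      (by simp) (seg_mem_lowerWith hy hx) (HomotopicIn.trans_mem
        ((discConvex_lowerWith hx).seg_mem (Or.inl (hy ▸ half_pos)) (Or.inl (hm ▸ half_pos)))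
        (seg_mem_lowerWith hm hx))
  have a := (low hm hy hx).map g.continuous (V := Rᶜ) (by
    rintro z (hz | rfl) hzR
    · exact hz.ne (hgR z hzR)
    · exact hxR hzR)
  have e : g ∘ ((seg y m).trans (seg m x)) =
      ((seg y m).map g.continuous).trans ((seg m x).map g.continuous) := by
    rw [← Path.map_trans]; rfl
  rw [e] at a
  have b := h₂.reverse
  rw [seg_comp_symm, Function.comp_assoc, seg_comp_symm] at b
  have b' := b.mono (V := Rᶜ) fun z hz hzR => hRb z hzR hz
  have c := HomotopicIn.hcomp (γ := (seg y m).map g.continuous) (δ := (seg m x).map g.continuous)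
    b' h₁
  exact (a.trans c).trans ((low hgm hgy hgx).mono (lowerWith_subset hR hxR)).symm

theorem exists_small_gap {s : Finset I} (m : I) (hm : m < 1) : ∃ δ : ℝ, 0 < δ ∧ (m : ℝ) + δ ≤ 1 ∧
    ∀ z ∈ s, m < z → (m : ℝ) + δ ≤ z := by
  have key : ∀ z : I, m < z → ∀ᶠ δ in 𝓝[>] (0 : ℝ), (m : ℝ) + δ ≤ z := fun z hz => by
    have hz : (m : ℝ) < z := hz
    filter_upwards [Ioo_mem_nhdsGT (sub_pos.2 hz)] with δ hδ
    linarith [hδ.2]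
  have h := (self_mem_nhdsWithin (a := (0 : ℝ)) (s := Set.Ioi 0) |> fun h =>
    (Filter.eventually_of_mem h fun _ hx => hx : ∀ᶠ δ in 𝓝[>] (0 : ℝ), δ ∈ Set.Ioi (0 : ℝ)))
  have h2 : ∀ᶠ δ in 𝓝[>] (0 : ℝ), ∀ z ∈ s, m < z → (m : ℝ) + δ ≤ z :=
    (Finset.eventually_all s).2 fun z _ => by
      by_cases hz : m < z
      · exact (key z hz).mono fun _ h _ => h
      · exact Filter.Eventually.of_forall fun _ h => absurd h hz
  obtain ⟨δ, h3, h4, h5⟩ := (h.and ((key 1 hm).and h2)).exists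
  exact ⟨δ, h3, h4, h5⟩

namespace Placement

variable {A A' B B' C C' : Forest P w} {c d e c' d' : Placement} {a b a' b' x : List ℕ}
  {f f' g h k : Disc ≃ₜ Disc}

theorem Fits.exists_gap (hc : c.Fits A) (a : List ℕ) (ha : a ∉ A.interior) :
    ∃ ξ : I, 0 < ξ ∧ ξ < 1 ∧ ∀ x ∈ A.interior,
      ((c.puncture x).1 < ξ ↔ leftOf x a) ∧ (ξ < (c.puncture x).1 ↔ leftOf a x) := by
  classical
  let Lt : Finset I := insert 0 ((A.interior.filter fun x => leftOf x a).image
    fun x => (c.puncture x).1)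
  let Rt : Finset I := insert 1 ((A.interior.filter fun x => leftOf a x).image
    fun x => (c.puncture x).1)
  have hlr : ∀ l ∈ Lt, ∀ r ∈ Rt, l < r := by
    intro l hl r hr
    rcases Finset.mem_insert.1 hl with rfl | hl <;> rcases Finset.mem_insert.1 hr with rfl | hr
    · exact zero_lt_one
    · obtain ⟨x, hx, rfl⟩ := Finset.mem_image.1 hr
      exact (hc.puncture_mem x (Finset.mem_filter.1 hx).1).1
    · obtain ⟨x, hx, rfl⟩ := Finset.mem_image.1 hl
      exact (hc.puncture_mem x (Finset.mem_filter.1 hx).1).2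
    · obtain ⟨x, hx, rfl⟩ := Finset.mem_image.1 hl
      obtain ⟨y, hy, rfl⟩ := Finset.mem_image.1 hr
      rw [Finset.mem_filter] at hx hy
      exact (hc.puncture_lt x hx.1 y hy.1).2 (leftOf_trans hx.2 hy.2)
  have hLt : Lt.Nonempty := ⟨0, Finset.mem_insert_self _ _⟩
  have hRt : Rt.Nonempty := ⟨1, Finset.mem_insert_self _ _⟩
  obtain ⟨ξ, h1', h2'⟩ := exists_between (hlr _ (Lt.max'_mem hLt) _ (Rt.min'_mem hRt))
  have h1 : ∀ l ∈ Lt, l < ξ := fun l hl => (Lt.le_max' l hl).trans_lt h1'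
  have h2 : ∀ r ∈ Rt, ξ < r := fun r hr => h2'.trans_le (Rt.min'_le r hr)
  have hl : ∀ x ∈ A.interior, leftOf x a → (c.puncture x).1 < ξ := fun x hx hxa =>
    h1 _ (Finset.mem_insert_of_mem (Finset.mem_image.2 ⟨x, Finset.mem_filter.2 ⟨hx, hxa⟩, rfl⟩))
  have hr : ∀ x ∈ A.interior, leftOf a x → ξ < (c.puncture x).1 := fun x hx hxa =>
    h2 _ (Finset.mem_insert_of_mem (Finset.mem_image.2 ⟨x, Finset.mem_filter.2 ⟨hx, hxa⟩, rfl⟩))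
  refine ⟨ξ, h1 _ (Finset.mem_insert_self _ _), h2 _ (Finset.mem_insert_self _ _), fun x hx => ?_⟩
  rcases leftOf_trichotomy x a with h | rfl | h
  · exact ⟨iff_of_true (hl x hx h) h, iff_of_false (hl x hx h).asymm (leftOf_asymm h)⟩
  · exact absurd hx ha
  · exact ⟨iff_of_false (hr x hx h).asymm (leftOf_asymm h), iff_of_true (hr x hx h) h⟩

/-- Add a puncture `x` for `a` and marked points `y i` for its children. -/
def grow (c : Placement) (a : List ℕ) (x : Disc) (y : ℕ → Disc) : Placement where
  puncture := Function.update c.puncture a x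
  mark z := if z ≠ [] ∧ z.dropLast = a then y (z.getLastD 0) else c.mark z

variable {p : Disc} {y : ℕ → Disc}

theorem grow_puncture_self (c : Placement) (a : List ℕ) (p : Disc) (y : ℕ → Disc) :
    (c.grow a p y).puncture a = p := Function.update_self _ _ _

theorem grow_puncture_of_ne (c : Placement) (h : x ≠ a) :
    (c.grow a p y).puncture x = c.puncture x := Function.update_of_ne h _ _

theorem grow_mark_child (c : Placement) (a : List ℕ) (p : Disc) (y : ℕ → Disc) (i : ℕ) :
    (c.grow a p y).mark (a ++ [i]) = y i := by
  simp [grow]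

theorem grow_mark_of_ne (c : Placement) (h : ∀ i, x ≠ a ++ [i]) :
    (c.grow a p y).mark x = c.mark x := by
  refine if_neg ?_
  rintro ⟨h1, rfl⟩
  exact h _ (List.dropLast_append_getLast h1).symm

/-- The conditions on the position of the new puncture and of the new marked points. -/
structure CanGrow (c : Placement) (A' : Forest P w) (a : List ℕ) (p : Disc) (y : ℕ → Disc) :
    Prop where
  puncture_snd : p.2 = half
  puncture_mem : 0 < p.1 ∧ p.1 < 1
  puncture_lt : ∀ x ∈ A'.interior,
    ((c.puncture x).1 < p.1 ↔ leftOf x a) ∧ (p.1 < (c.puncture x).1 ↔ leftOf a x)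
  mark_zero : y 0 = c.mark a
  mark_snd : ∀ i, HasVertex P w (a ++ [i]) → (y i).2 = 0
  mark_lt_one : ∀ i, HasVertex P w (a ++ [i]) → (y i).1 < 1
  mark_lt : ∀ i, HasVertex P w (a ++ [i]) → ∀ x ∈ A'.pLeaves,
    (c.mark a).1 < (c.mark x).1 → (y i).1 < (c.mark x).1
  mark_mono : ∀ i j, i < j → HasVertex P w (a ++ [j]) → (y i).1 < (y j).1

namespace CanGrow

theorem le (G : CanGrow c A' a p y) {i : ℕ} (hi : HasVertex P w (a ++ [i])) :
    (c.mark a).1 ≤ (y i).1 := by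
  rw [← G.mark_zero]
  rcases Nat.eq_zero_or_pos i with rfl | h
  · exact le_rfl
  · exact (G.mark_mono 0 i h hi).le

theorem mark_iff (G : CanGrow c A' a p y) (hc : c.Fits A') (ha : a ∈ A'.pLeaves) {i : ℕ}
    (hi : HasVertex P w (a ++ [i])) {x : List ℕ} (hx : x ∈ A'.pLeaves) (hxa : x ≠ a) :
    ((c.mark x).1 < (y i).1 ↔ leftOf x a) ∧ ((y i).1 < (c.mark x).1 ↔ leftOf a x) := by
  rcases leftOf_trichotomy x a with h | h | h
  · have h1 := ((hc.mark_lt x hx a ha).2 h).trans_le (G.le hi)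
    exact ⟨iff_of_true h1 h, iff_of_false h1.asymm (leftOf_asymm h)⟩
  · exact absurd h hxa
  · have h1 := G.mark_lt i hi x hx ((hc.mark_lt a ha x hx).2 h)
    exact ⟨iff_of_false h1.asymm (leftOf_asymm h), iff_of_true h1 h⟩

theorem fits (G : CanGrow c A' a p y) (hc : c.Fits A') (hA : A.Prunes A' a) :
    (c.grow a p y).Fits A := by
  have hint : ∀ {x}, x ∈ A.interior → x ≠ a → x ∈ A'.interior := fun h1 h2 =>
    hA.mem_interior_iff.2 ⟨h1, h2⟩
  have hnc : ∀ {x}, x ∈ A'.pLeaves → ∀ i, x ≠ a ++ [i] := by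
    rintro x hx i rfl
    exact ((hA.mem_verts_iff _).1 (Forest.mem_verts_of_pLeaves hx)).2 i rfl
  refine ⟨fun x hx => ?_, fun x hx => ?_, fun x hx z hz => ?_, fun x hx => ?_, fun x hx => ?_,
    fun x hx z hz => ?_⟩
  · by_cases hxa : x = a
    · rw [hxa, grow_puncture_self]; exact G.puncture_snd
    · rw [grow_puncture_of_ne c hxa]; exact hc.puncture_snd x (hint hx hxa)
  · by_cases hxa : x = a
    · rw [hxa, grow_puncture_self]; exact G.puncture_mem
    · rw [grow_puncture_of_ne c hxa]; exact hc.puncture_mem x (hint hx hxa)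
  · by_cases hxa : x = a
    · by_cases hza : z = a
      · rw [hxa, hza]
        exact iff_of_false (lt_irrefl _) (leftOf_irrefl _)
      · rw [hxa, grow_puncture_self, grow_puncture_of_ne c hza]
        exact (G.puncture_lt z (hint hz hza)).2
    · by_cases hza : z = a
      · rw [hza, grow_puncture_self, grow_puncture_of_ne c hxa]
        exact (G.puncture_lt x (hint hx hxa)).1
      · rw [grow_puncture_of_ne c hxa, grow_puncture_of_ne c hza]
        exact hc.puncture_lt x (hint hx hxa) z (hint hz hza)
  · rcases hA.mem_pLeaves_iff_of_top.1 hx with ⟨h1, h2⟩ | ⟨i, hi, rfl⟩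
    · rw [grow_mark_of_ne c (hnc h1)]; exact hc.mark_snd x h1
    · rw [grow_mark_child]; exact G.mark_snd i hi
  · rcases hA.mem_pLeaves_iff_of_top.1 hx with ⟨h1, h2⟩ | ⟨i, hi, rfl⟩
    · rw [grow_mark_of_ne c (hnc h1)]; exact hc.mark_mem x h1
    · rw [grow_mark_child]
      exact ⟨(hc.mark_mem a hA.mem).1.trans_le (G.le hi), G.mark_lt_one i hi⟩
  · rcases hA.mem_pLeaves_iff_of_top.1 hx with ⟨h1, h2⟩ | ⟨i, hi, rfl⟩ <;>
      rcases hA.mem_pLeaves_iff_of_top.1 hz with ⟨h3, h4⟩ | ⟨j, hj, rfl⟩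
    · rw [grow_mark_of_ne c (hnc h1), grow_mark_of_ne c (hnc h3)]
      exact hc.mark_lt x h1 z h3
    · rw [grow_mark_of_ne c (hnc h1), grow_mark_child, leftOf_append_right (hA.not_prefix h1 h2)]
      exact (G.mark_iff hc hA.mem hj h1 h2).1
    · rw [grow_mark_of_ne c (hnc h3), grow_mark_child, leftOf_append_left (hA.not_prefix h3 h4)]
      exact (G.mark_iff hc hA.mem hi h3 h4).2
    · rw [grow_mark_child, grow_mark_child, leftOf_append_singleton]
      refine ⟨fun h => ?_, fun h => G.mark_mono i j h hj⟩
      by_contra hn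
      rcases (not_lt.1 hn).lt_or_eq with h' | rfl
      · exact h.asymm (G.mark_mono j i h' hi)
      · exact lt_irrefl _ h

theorem matches_prune (G : CanGrow c A' a p y) (hA : A.Prunes A' a) :
    Matches A' ((c.grow a p y).prune a) c 1 where
  isSlide := .one
  puncture x hx := grow_puncture_of_ne (p := p) (y := y) c (hA.mem_interior_iff.1 hx).2
  mark x hx := by
    by_cases hxa : x = a
    · rw [hxa, prune_mark_self, grow_mark_child]
      exact G.mark_zero
    · rw [prune_mark_of_ne _ hxa]
      exact grow_mark_of_ne (p := p) (y := y) c fun i e => ((hA.mem_verts_iff _).1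
        (Forest.mem_verts_of_pLeaves hx)).2 i e

end CanGrow

theorem punctures_grow (hA : A.Prunes A' a) :
    (c.grow a p y).punctures A = insert p (c.punctures A') := by
  ext z
  constructor
  · rintro ⟨x, hx, rfl⟩
    by_cases hxa : x = a
    · rw [hxa, grow_puncture_self]; exact Or.inl rfl
    · rw [grow_puncture_of_ne c hxa]
      exact Or.inr ⟨x, hA.mem_interior_iff.2 ⟨hx, hxa⟩, rfl⟩
  · rintro (rfl | ⟨x, hx, rfl⟩)
    · exact ⟨a, hA.mem_interior, grow_puncture_self _ _ _ _⟩
    · obtain ⟨h1, h2⟩ := hA.mem_interior_iff.1 hx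
      exact ⟨x, h1, grow_puncture_of_ne c h2⟩

theorem CanGrow.marks_grow (hP : P.IsArboreal) (G : CanGrow c A' a p y) (hA : A.Prunes A' a) :
    (c.grow a p y).marks A = c.marks A' ∪ {z | ∃ i, HasVertex P w (a ++ [i]) ∧ y i = z} := by
  have hnc : ∀ {x}, x ∈ A'.pLeaves → ∀ i, x ≠ a ++ [i] := by
    rintro x hx i rfl
    exact ((hA.mem_verts_iff _).1 (Forest.mem_verts_of_pLeaves hx)).2 i rfl
  ext z
  constructor
  · rintro ⟨x, hx, rfl⟩
    rcases hA.mem_pLeaves_iff_of_top.1 hx with ⟨h1, h2⟩ | ⟨i, hi, rfl⟩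
    · rw [grow_mark_of_ne c (hnc h1)]
      exact Or.inl ⟨x, h1, rfl⟩
    · rw [grow_mark_child]
      exact Or.inr ⟨i, hi, rfl⟩
  · rintro (⟨x, hx, rfl⟩ | ⟨i, hi, rfl⟩)
    · by_cases hxa : x = a
      · subst hxa
        exact ⟨x ++ [0], hA.zero_mem hP, by rw [grow_mark_child, G.mark_zero]⟩
      · exact ⟨x, hA.mem_pLeaves_iff_of_top.2 (Or.inl ⟨hx, hxa⟩), grow_mark_of_ne c (hnc hx)⟩
    · exact ⟨_, hA.children i hi, grow_mark_child _ _ _ _ _⟩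

end Placement

open Placement

/-- An isotopy can be made to fix a finite set of fixed points on the boundary. -/
theorem Isotopy.union_boundary {Z : Set Disc} (hZ : IsClosed Z) {g : Disc ≃ₜ Disc}
    (G : Isotopy Z g) {m : Disc} (hm : m ∈ Z) (hmb : m ∈ boundary) {T : Set Disc} (hT : T.Finite)
    (hTb : T ⊆ boundary) (hgT : ∀ z ∈ T, g z = z) : Nonempty (Isotopy (T ∪ Z) g) := by
  induction T, hT using Set.Finite.induction_on with
  | empty => rw [Set.empty_union]; exact ⟨G⟩
  | @insert x T _ hT ih =>
    obtain ⟨G'⟩ := ih (fun z hz => hTb (Or.inr hz)) fun z hz => hgT z (Or.inr hz)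
    rw [Set.insert_union]
    exact G'.insert_boundary (hT.isClosed.union hZ) (Or.inr hm) hmb (hTb (Or.inl rfl))
      (hgT x (Or.inl rfl))

namespace Diagram

variable {Δ Δ' Δ₁ Δ₂ : Diagram P w} {a b a₁ a₂ : List ℕ} {c d c' d' : Placement}
  {f f' : Disc ≃ₜ Disc}

theorem ReducesAt.mark_eq (hP : P.IsArboreal) (R : ReducesAt a b Δ Δ') (H' : Δ'.Presents c' f' d') :
    f' (c'.mark a) = d'.mark b := by
  obtain ⟨hA, hB, c, f, d, H, D, H''⟩ := R
  obtain ⟨h, hh⟩ := H'.fits_top.exists_matches H''.fits_top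
  obtain ⟨k, hk⟩ := H''.fits_bot.exists_matches H'.fits_bot
  have h1 := H''.matches_mul hh hk H'.fits_top H'.fits_bot
  rw [← (h1.isotopicRel H').apply_eq (Or.inr (Set.mem_image_of_mem _ hA.mem))]
  change k (f (h _)) = _
  rw [hh.mark a hA.mem, D.prunes_mark hP, hk.mark b hB.mem]

theorem isotopicRel_of_prune (hP : P.IsArboreal) {A A' B : Forest P w} (hA : A.Prunes A' a)
    (hc : c.Fits A) (H : Carries A c f B d)
    (D : Dipole A c f B d a b) (D' : Dipole A c f' B d a b)
    (h : IsotopicRel ((c.prune a).punctures A' ∪ (c.prune a).marks A') f f') :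
    IsotopicRel (c.punctures A ∪ c.marks A) f f' := by
  obtain ⟨G⟩ := h
  have h0 := D.hasVertex_zero hP
  have hc' := hc.prune hP hA
  have hp : (f⁻¹ * f') (c.puncture a) = c.puncture a := by
    change f.symm (f' _) = _
    rw [D'.puncture, ← D.puncture, f.symm_apply_apply]
  have hm : ∀ i, HasVertex P w (a ++ [i]) →
      (f⁻¹ * f') (c.mark (a ++ [i])) = c.mark (a ++ [i]) := fun i hi => by
    change f.symm (f' _) = _
    rw [D'.mark i hi, ← D.mark i hi, f.symm_apply_apply]
  have hmem : c.mark (a ++ [0]) ∈ (c.prune a).punctures A' ∪ (c.prune a).marks A' :=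
    Or.inr ⟨a, hA.mem, prune_mark_self _ _⟩
  have hmb : c.mark (a ++ [0]) ∈ boundary :=
    hc.mem_boundary (Set.mem_image_of_mem _ (hA.zero_mem hP))
  have hhom : HomotopicIn ((c.prune a).punctures A')ᶜ
      ((f⁻¹ * f') ∘ seg (c.mark (a ++ [0])) (c.puncture a))
      (seg (c.mark (a ++ [0])) (c.puncture a)) := by
    have p1 := D.par 0 h0
    have p2 := D'.par 0 h0
    unfold Par at p1 p2
    rw [D.puncture, D.mark 0 h0] at p1
    rw [D'.puncture, D'.mark 0 h0] at p2
    have p3 := (p2.trans p1.symm).map f.symm.continuous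
      (V := ((c.prune a).punctures A')ᶜ) (by
      rintro z hz hz'
      rw [hc.punctures_prune hA] at hz'
      refine hz ⟨?_, fun e => hz'.2 ?_⟩
      · rw [← H.punctures]
        exact ⟨_, hz'.1, f.apply_symm_apply z⟩
      · rw [Set.mem_singleton_iff.1 e, ← D.puncture, f.symm_apply_apply]; rfl)
    have e : f.symm ∘ f ∘ seg (c.mark (a ++ [0])) (c.puncture a) =
        seg (c.mark (a ++ [0])) (c.puncture a) := by
      funext t; exact f.symm_apply_apply _
    rwa [e] at p3
  have hcl : IsClosed ((c.prune a).punctures A' ∪ (c.prune a).marks A') :=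
    ((Placement.finite_punctures _ _).union (Placement.finite_marks _ _)).isClosed
  obtain ⟨G₁⟩ := G.insert_interior hcl (Placement.finite_punctures _ _).isClosed Set.subset_union_left
    (fun z hz => hz.imp id fun h => hc'.mem_boundary h) hmem
    (hc.not_mem_boundary (Set.mem_image_of_mem _ hA.mem_interior)) hp _ hhom
  have hfin : {z | ∃ i, HasVertex P w (a ++ [i]) ∧ c.mark (a ++ [i]) = z}.Finite := by
    refine (Placement.finite_marks c A).subset ?_
    rintro _ ⟨i, hi, rfl⟩
    exact Set.mem_image_of_mem _ (hA.children i hi)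
  obtain ⟨G₂⟩ := G₁.union_boundary
    (by rw [Set.insert_eq]; exact isClosed_singleton.union hcl) (Or.inr hmem) hmb hfin (by
    rintro _ ⟨i, hi, rfl⟩
    exact hc.mem_boundary (Set.mem_image_of_mem _ (hA.children i hi))) (by
    rintro _ ⟨i, hi, rfl⟩
    exact hm i hi)
  refine ⟨G₂.restrict ?_⟩
  rw [hc.punctures_prune hA, hc.marks_prune hP hA]
  rintro z (hz | hz)
  · by_cases e : z = c.puncture a
    · exact Or.inr (Or.inl e)
    · exact Or.inr (Or.inr (Or.inl ⟨hz, e⟩))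
  · by_cases e : ∃ i, HasVertex P w (a ++ [i]) ∧ i ≠ 0 ∧ c.mark (a ++ [i]) = z
    · obtain ⟨i, h1, -, h2⟩ := e
      exact Or.inl ⟨i, h1, h2⟩
    · exact Or.inr (Or.inr (Or.inr ⟨hz, e⟩))

/-- A diagram is determined by the result of a reduction and the place where it is performed. -/
theorem ReducesAt.eq_of_eq (hP : P.IsArboreal) (R₁ : ReducesAt a₁ b Δ₁ Δ')
    (R₂ : ReducesAt a₂ b Δ₂ Δ') : Δ₁ = Δ₂ := by
  obtain ⟨f', H'⟩ := Δ'.exists_presents Δ'.top.fits_grid Δ'.bot.fits_grid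
  obtain rfl : a₁ = a₂ := Δ'.top.fits_grid.mark_injOn R₁.1.mem R₂.1.mem
    (f'.injective ((R₁.mark_eq hP H').trans (R₂.mark_eq hP H').symm))
  have ht := R₁.1.top_unique R₂.1
  have hb := R₁.2.1.top_unique R₂.2.1
  obtain ⟨f₁, H₁⟩ := Δ₁.exists_presents Δ₁.top.fits_grid Δ₁.bot.fits_grid
  obtain ⟨f₂, H₂⟩ := Δ₂.exists_presents (c := Δ₁.top.grid) (d := Δ₁.bot.grid)
    (by rw [← ht]; exact Δ₁.top.fits_grid) (by rw [← hb]; exact Δ₁.bot.fits_grid)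
  have D₁ := H₁.isDipole_iff.1 R₁.isDipole
  have D₂ := H₂.isDipole_iff.1 R₂.isDipole
  rw [← ht, ← hb] at D₂
  have h := isotopicRel_of_prune hP R₁.1 H₁.fits_top H₁.carries D₁ D₂
    ((R₁.presents hP H₁).isotopicRel (R₂.presents hP H₂))
  exact (H₁.congr h).eq_of_presents H₂ ht hb

end Diagram

end Chambord

namespace Chambord

open unitInterval Topology

variable {S : Type*} {P : SemigroupPresentation S} {w : List S}

namespace Placement

variable {A A' B B' : Forest P w} {c d : Placement} {a b a' b' : List ℕ}
  {f : Disc ≃ₜ Disc} {p p' : Disc} {y y' : ℕ → Disc}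

theorem canGrow_of_lt (hp2 : p.2 = half)
    (hp : 0 < p.1 ∧ p.1 < 1) (hpA : ∀ x ∈ A'.interior,
      ((c.puncture x).1 < p.1 ↔ leftOf x a) ∧ (p.1 < (c.puncture x).1 ↔ leftOf a x))
    {n : ℕ} (hn : ∀ i, HasVertex P w (a ++ [i]) ↔ i < n) {δ : ℝ}
    (hδ1 : ((c.mark a).1 : ℝ) + δ ≤ 1)
    (hδ : ∀ x ∈ A'.pLeaves, (c.mark a).1 < (c.mark x).1 → ((c.mark a).1 : ℝ) + δ ≤ (c.mark x).1)
    (hy0 : y 0 = c.mark a) (hy : ∀ i < n, (y i).2 = 0 ∧ ((y i).1 : ℝ) < (c.mark a).1 + δ)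
    (hym : ∀ i j, i < j → j < n → (y i).1 < (y j).1) : CanGrow c A' a p y where
  puncture_snd := hp2
  puncture_mem := hp
  puncture_lt := hpA
  mark_zero := hy0
  mark_snd i hi := (hy i ((hn i).1 hi)).1
  mark_lt_one i hi := (hy i ((hn i).1 hi)).2.trans_le hδ1
  mark_lt i hi x hx hlt := (hy i ((hn i).1 hi)).2.trans_le (hδ x hx hlt)
  mark_mono i j hij hj := hym i j hij ((hn j).1 hj)

theorem Carries.hasVertex_iff (hP : P.IsArboreal) (H : Carries A' c f B' d) (ha : a ∈ A'.pLeaves)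
    (hb : b ∈ B'.pLeaves) (hab : f (c.mark a) = d.mark b) (i : ℕ) :
    (HasVertex P w (a ++ [i]) ↔ HasVertex P w (b ++ [i])) ∧
      ∀ s, IsVertex P w (a ++ [i]) s ↔ IsVertex P w (b ++ [i]) s := by
  obtain ⟨u, hu⟩ := A'.hasVertex a (Forest.mem_verts_of_pLeaves ha)
  have hu' := (H.label a ha b hb hab u).1 hu
  exact ⟨hu.hasVertex_append_iff hP hu' i, fun s => hu.isVertex_append_iff hP hu' i s⟩

theorem Carries.grow (hP : P.IsArboreal) (H : Carries A' c f B' d) (hc : c.Fits A')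
    (hd : d.Fits B') (hA : A.Prunes A' a) (hB : B.Prunes B' b) (G : CanGrow c A' a p y) (G' : CanGrow d B' b p' y')
    (hab : f (c.mark a) = d.mark b) (hp : f p = p')
    (hy : ∀ i, HasVertex P w (a ++ [i]) → f (y i) = y' i) :
    Carries A (c.grow a p y) f B (d.grow b p' y') where
  isotopy := H.isotopy
  punctures := by
    rw [punctures_grow hA, punctures_grow hB, Set.image_insert_eq, H.punctures, hp]
  marks := by
    rw [G.marks_grow hP hA, G'.marks_grow hP hB, Set.image_union, H.marks]
    congr 1
    ext z
    constructor
    · rintro ⟨_, ⟨i, h1, rfl⟩, rfl⟩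
      exact ⟨i, ((H.hasVertex_iff hP hA.mem hB.mem hab i).1).1 h1, (hy i h1).symm⟩
    · rintro ⟨i, h1, rfl⟩
      have h1 := ((H.hasVertex_iff hP hA.mem hB.mem hab i).1).2 h1
      exact ⟨_, ⟨i, h1, rfl⟩, hy i h1⟩
  label x hx z hz e s := by
    have hfit := G'.fits hd hB
    rcases hA.mem_pLeaves_iff_of_top.1 hx with ⟨h1, h2⟩ | ⟨i, hi, rfl⟩
    · rw [grow_mark_of_ne c (by
        rintro i rfl
        exact ((hA.mem_verts_iff _).1 (Forest.mem_verts_of_pLeaves h1)).2 i rfl)] at e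
      obtain ⟨z', hz', e'⟩ := H.exists_mark h1
      have hzb : z' ≠ b := by
        rintro rfl
        exact h2 (hc.mark_injOn h1 hA.mem (f.injective (e'.trans hab.symm)))
      have hzB : z' ∈ B.pLeaves := hB.mem_pLeaves_iff_of_top.2 (Or.inl ⟨hz', hzb⟩)
      have e2 : (d.grow b p' y').mark z' = d.mark z' := grow_mark_of_ne d (by
        rintro i rfl
        exact ((hB.mem_verts_iff _).1 (Forest.mem_verts_of_pLeaves hz')).2 i rfl)
      obtain rfl := hfit.mark_injOn hzB hz (e2.trans (e'.symm.trans e))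
      exact H.label x h1 z' hz' e' s
    · obtain ⟨h1, h2⟩ := H.hasVertex_iff hP hA.mem hB.mem hab i
      rw [grow_mark_child, hy i hi, ← grow_mark_child d b p' y'] at e
      obtain rfl := hfit.mark_injOn (hB.children i (h1.1 hi)) hz e
      exact h2 s

theorem dipole_grow_self (hP : P.IsArboreal) (H : Carries A' c f B' d) (hA : A.Prunes A' a)
    (hB : B.Prunes B' b) (hab : f (c.mark a) = d.mark b) (hp : f p = p')
    (hy : ∀ i, HasVertex P w (a ++ [i]) → f (y i) = y' i)
    (h : ∀ i, HasVertex P w (a ++ [i]) →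
      HomotopicIn (d.punctures B')ᶜ (f ∘ seg (y i) p) (seg (f (y i)) (f p))) :
    Dipole A (c.grow a p y) f B (d.grow b p' y') a b := by
  refine ⟨hA.mem_interior, hB.mem_interior, hA.exists_child, hA.children, hB.children,
    fun i => (H.hasVertex_iff hP hA.mem hB.mem hab i).1, ?_, fun i hi => ?_, fun i hi => ?_⟩
  · rw [grow_puncture_self, grow_puncture_self, hp]
  · rw [grow_mark_child, grow_mark_child, hy i hi]
  · rw [grow_puncture_self, grow_mark_child, punctures_grow hB, Par]
    refine (h i hi).mono (Set.compl_subset_compl.2 ?_)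
    rintro z ⟨rfl | hz, hz'⟩
    · exact absurd hp.symm hz'
    · exact hz

theorem Dipole.grow (D : Dipole A' c f B' d a' b') (hd : d.Fits B') (hA : A.Prunes A' a)
    (hB : B.Prunes B' b) (hab : f (c.mark a) = d.mark b) (hb : ∀ i, b ≠ b' ++ [i])
    (h : ∀ i, HasVertex P w (a' ++ [i]) →
      HomotopicIn (insert p' (d.punctures B' \ {f (c.puncture a')}))ᶜ
        (f ∘ seg (c.mark (a' ++ [i])) (c.puncture a'))
        (seg (f (c.mark (a' ++ [i]))) (f (c.puncture a')))) :
    Dipole A (c.grow a p y) f B (d.grow b p' y') a' b' := by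
  have ha' : a' ≠ a := by
    rintro rfl
    exact (Forest.mem_interior.1 D.top_mem).2 hA.mem
  have hb' : b' ≠ b := by
    rintro rfl
    exact (Forest.mem_interior.1 D.bot_mem).2 hB.mem
  have hac : ∀ i, HasVertex P w (a' ++ [i]) → a' ++ [i] ≠ a := by
    rintro i hi rfl
    exact hb i (hd.mark_injOn hB.mem (D.bot_children i ((D.child_iff i).1 hi))
      (hab.symm.trans (D.mark i hi)))
  have e1 : ∀ i, (c.grow a p y).mark (a' ++ [i]) = c.mark (a' ++ [i]) := fun i =>
    grow_mark_of_ne c fun j => append_singleton_ne ha'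
  have e2 : ∀ i, (d.grow b p' y').mark (b' ++ [i]) = d.mark (b' ++ [i]) := fun i =>
    grow_mark_of_ne d fun j => append_singleton_ne hb'
  refine ⟨(hA.mem_interior_iff.1 D.top_mem).1, (hB.mem_interior_iff.1 D.bot_mem).1,
    D.exists_child, fun i hi => hA.mem_pLeaves_iff_of_top.2 (Or.inl ⟨D.top_children i hi, hac i hi⟩),
    fun i hi => hB.mem_pLeaves_iff_of_top.2 (Or.inl ⟨D.bot_children i hi, (hb i).symm⟩),
    D.child_iff, ?_, fun i hi => ?_, fun i hi => ?_⟩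
  · rw [grow_puncture_of_ne c ha', grow_puncture_of_ne d hb', D.puncture]
  · rw [e1, e2, D.mark i hi]
  · rw [grow_puncture_of_ne c ha', e1, punctures_grow hB, Par]
    refine (h i hi).mono (Set.compl_subset_compl.2 ?_)
    rintro z ⟨rfl | hz, hz'⟩
    · exact Or.inl rfl
    · exact Or.inr ⟨hz, hz'⟩

theorem Fits.exists_room (hc : c.Fits A) (ha : a ∈ A.pLeaves) : ∃ δ : ℝ, 0 < δ ∧
    ((c.mark a).1 : ℝ) + δ ≤ 1 ∧
    ∀ x ∈ A.pLeaves, (c.mark a).1 < (c.mark x).1 → ((c.mark a).1 : ℝ) + δ ≤ (c.mark x).1 := by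
  classical
  obtain ⟨δ, h1, h2, h3⟩ := exists_small_gap (s := A.pLeaves.image fun x => (c.mark x).1)
    (c.mark a).1 (hc.mark_mem a ha).2
  exact ⟨δ, h1, h2, fun x hx => h3 _ (Finset.mem_image_of_mem _ hx)⟩

end Placement

open Placement

namespace Diagram

variable {Δ Δ' : Diagram P w} {a b a' b' : List ℕ}

/-- A dipole can be inserted at each `P`-leaf of the bottom forest, and this preserves the dipoles
that do not involve this leaf. -/
theorem exists_reducesAt_of_mem (hP : P.IsArboreal) (hT : NoNonRootLeaf P w)
    (hb : b ∈ Δ'.bot.pLeaves) : ∃ a Δ, ReducesAt a b Δ Δ' ∧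
      ∀ a' b', IsDipole Δ' a' b' → (∀ i, b ≠ b' ++ [i]) → IsDipole Δ a' b' := by
  set A' := Δ'.top with hA'
  set B' := Δ'.bot with hB'
  have hc : A'.grid.Fits A' := A'.fits_grid
  have hd : B'.grid.Fits B' := B'.fits_grid
  set c := A'.grid with hcdef
  set d := B'.grid with hddef
  clear_value c d
  obtain ⟨f₀, H₀⟩ := Δ'.exists_presents hc hd
  have C₀ := H₀.carries
  obtain ⟨F₀⟩ := C₀.isotopy
  obtain ⟨a, ha, hab₀⟩ := C₀.exists_mark' hb
  obtain ⟨A, hA⟩ := Forest.exists_prunes_top hP hT ha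
  obtain ⟨B, hB⟩ := Forest.exists_prunes_top hP hT hb
  obtain ⟨n, hn⟩ := (A'.hasVertex a (Forest.mem_verts_of_pLeaves ha)).exists_children hP
  have hn' : ∀ i, HasVertex P w (b ++ [i]) ↔ i < n := fun i =>
    ((C₀.hasVertex_iff hP ha hb hab₀ i).1).symm.trans (hn i)
  obtain ⟨δ₁, hδ₁, hδ₁1, hδ₁m⟩ := hc.exists_room ha
  obtain ⟨δ₂, hδ₂, hδ₂1, hδ₂m⟩ := hd.exists_room hb
  obtain ⟨f₁, y, y', ⟨F₁⟩, hf₁, hy0, hy'0, hy, hym⟩ := exists_split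
    ((Placement.finite_punctures c A').union (Placement.finite_marks c A')) F₀
    (Or.inr (Set.mem_image_of_mem _ ha)) (hc.mark_snd a ha) (hc.mark_mem a ha).1
    (hc.mark_mem a ha).2 (by rw [hab₀]; exact hd.mark_snd b hb)
    (by rw [hab₀]; exact (hd.mark_mem b hb).1) (by rw [hab₀]; exact (hd.mark_mem b hb).2) n
    (lt_min hδ₁ hδ₂)
  rw [hab₀] at hy'0 hy
  have H₁ := H₀.congr hf₁
  have C₁ := H₁.carries
  have hab₁ : f₁ (c.mark a) = d.mark b :=
    (IsotopicRel.apply_eq hf₁ (Or.inr (Set.mem_image_of_mem _ ha))).symm.trans hab₀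
  have haI : a ∉ A'.interior := fun h => (Forest.mem_interior.1 h).2 ha
  have hbI : b ∉ B'.interior := fun h => (Forest.mem_interior.1 h).2 hb
  obtain ⟨ξ, hξ0, hξ1, hξ⟩ := hc.exists_gap a haI
  obtain ⟨ξ', hξ'0, hξ'1, hξ'⟩ := hd.exists_gap b hbI
  have hxQ : (ξ, half) ∉ c.punctures A' := by
    rintro ⟨x, hx, e⟩
    have h1 := hξ x hx
    rw [e] at h1
    rcases leftOf_trichotomy x a with h | rfl | h
    · exact lt_irrefl _ (h1.1.2 h)
    · exact haI hx
    · exact lt_irrefl _ (h1.2.2 h)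
  have hxQ' : (ξ', half) ∉ d.punctures B' := by
    rintro ⟨x, hx, e⟩
    have h1 := hξ' x hx
    rw [e] at h1
    rcases leftOf_trichotomy x b with h | rfl | h
    · exact lt_irrefl _ (h1.1.2 h)
    · exact hbI hx
    · exact lt_irrefl _ (h1.2.2 h)
  have hxb : ((ξ, half) : Disc) ∉ boundary :=
    Chambord.not_mem_boundary.2 ⟨⟨hξ0, hξ1⟩, half_pos, half_lt_one⟩
  have hxb' : ((ξ', half) : Disc) ∉ boundary :=
    Chambord.not_mem_boundary.2 ⟨⟨hξ'0, hξ'1⟩, half_pos, half_lt_one⟩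
  let Λ : Set (Disc × Disc) := {l | ∃ a' b' i, Dipole A' c f₁ B' d a' b' ∧ (∀ i, b ≠ b' ++ [i]) ∧
    HasVertex P w (a' ++ [i]) ∧ l = (c.puncture a', c.mark (a' ++ [i]))}
  have hΛ : Λ.Finite := by
    refine ((Placement.finite_punctures c A').prod (Placement.finite_marks c A')).subset ?_
    rintro _ ⟨a', b', i, D, -, hi, rfl⟩
    exact ⟨Set.mem_image_of_mem _ D.top_mem, Set.mem_image_of_mem _ (D.top_children i hi)⟩
  have hac : ∀ {a' b' i}, Dipole A' c f₁ B' d a' b' → (∀ i, b ≠ b' ++ [i]) →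
      HasVertex P w (a' ++ [i]) → a' ++ [i] ≠ a := by
    rintro a' b' i D h1 hi rfl
    exact h1 i (hd.mark_injOn hb (D.bot_children i ((D.child_iff i).1 hi))
      (hab₁.symm.trans (D.mark i hi)))
  have npre : ∀ {A : Forest P w} {a a' : List ℕ}, a' ∈ A.interior → a ∈ A.pLeaves →
      (∀ i, HasVertex P w (a' ++ [i]) → a' ++ [i] ∈ A.pLeaves) → (∀ i, a ≠ a' ++ [i]) →
      ¬ a' <+: a := by
    intro A a a' h1 h2 h3 h4 h5
    obtain ⟨i, hi⟩ := Forest.exists_child_prefix h5 (by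
      rintro rfl; exact (Forest.mem_interior.1 h1).2 h2)
    have h6 := Forest.mem_verts_of_prefix (by simp) hi (Forest.mem_verts_of_pLeaves h2)
    exact h4 i (Forest.eq_of_pLeaves_prefix (h3 i (A.hasVertex _ h6)) hi
      (Forest.mem_verts_of_pLeaves h2)).symm
  obtain ⟨g, hg, hgx, hgpar, hgΛ⟩ := exists_insert F₁ (Placement.finite_punctures c A')
    C₁.punctures (fun z hz => hc.snd_of_mem_punctures hz) (fun z hz => hd.snd_of_mem_punctures hz)
    (fun z hz => hc.not_mem_boundary hz) (hc.mark_snd a ha) (hd.mark_snd b hb) hab₁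
    (x := (ξ, half)) (x' := (ξ', half)) rfl rfl hxb hxb' hxQ hxQ' hΛ (by
      rintro _ ⟨a', b', i, D, h1, hi, rfl⟩
      refine ⟨Set.mem_image_of_mem _ D.top_mem, hc.mark_snd _ (D.top_children i hi), ?_,
        fun e => hac D h1 hi (hc.mark_injOn (D.top_children i hi) ha e)⟩
      rw [D.mark i hi]
      exact hd.mark_snd _ (D.bot_children i ((D.child_iff i).1 hi))) (by
      rintro _ ⟨a', b', i, D, h1, hi, rfl⟩
      have hi' := (D.child_iff i).1 hi
      have k1 : ∀ j, a ≠ a' ++ [j] := by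
        rintro j rfl
        exact hac D h1 (A'.hasVertex _ (Forest.mem_verts_of_pLeaves ha)) rfl
      refine ⟨?_, ?_⟩
      · rw [(hξ a' D.top_mem).1, hc.mark_lt _ (D.top_children i hi) _ ha,
          leftOf_append_left (npre D.top_mem ha D.top_children k1)]
      · rw [D.puncture, D.mark i hi, (hξ' b' D.bot_mem).1,
          hd.mark_lt _ (D.bot_children i hi') _ hb,
          leftOf_append_left (npre D.bot_mem hb D.bot_children h1)]) (by
      rintro _ ⟨a', b', i, D, h1, hi, rfl⟩
      exact D.par i hi)
  have hfg : IsotopicRel (c.punctures A' ∪ c.marks A') f₁ g :=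
    IsotopicRel.mono hg (Set.union_subset_union le_rfl fun z hz => hc.mem_boundary hz)
  have H := H₁.congr hfg
  have C := H.carries
  have hgb : ∀ z ∈ boundary, g z = f₁ z := fun z hz => (IsotopicRel.apply_eq hg (Or.inr hz)).symm
  have hmb := hc.mem_boundary (Set.mem_image_of_mem _ ha)
  have hab : g (c.mark a) = d.mark b := (hgb _ hmb).trans hab₁
  have hgy : ∀ i, HasVertex P w (a ++ [i]) → g (y i) = y' i := fun i hi => by
    obtain ⟨h1, -, -, -, h2, -⟩ := hy i ((hn i).1 hi)
    rw [hgb _ (mem_boundary_of_bottom h1), h2]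
  have G : CanGrow c A' a (ξ, half) y := canGrow_of_lt rfl ⟨hξ0, hξ1⟩ hξ hn hδ₁1 hδ₁m hy0
    (fun i hi => ⟨(hy i hi).1, (hy i hi).2.2.1.trans_le (by gcongr; exact min_le_left _ _)⟩)
    fun i j hij hj => (hym i j hij hj).1
  have G' : CanGrow d B' b (ξ', half) y' := canGrow_of_lt rfl ⟨hξ'0, hξ'1⟩ hξ' hn' hδ₂1 hδ₂m hy'0
    (fun i hi => ⟨(hy i hi).2.1, (hy i hi).2.2.2.1.trans_le (by gcongr; exact min_le_right _ _)⟩)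
    fun i j hij hj => (hym i j hij hj).2
  obtain ⟨Δ, hΔA, hΔB, HΔ⟩ := exists_of_carries (G.fits hc hA) (G'.fits hd hB)
    (C.grow hP hc hd hA hB G G' hab hgx hgy)
  have D : Dipole A (c.grow a (ξ, half) y) g B (d.grow b (ξ', half) y') a b := by
    refine dipole_grow_self hP C hA hB hab hgx hgy fun i hi => ?_
    obtain ⟨h1, h2, -, -, h3, h4⟩ := hy i ((hn i).1 hi)
    refine HomotopicIn.change_foot (hc.mark_snd a ha) h1 rfl ?_ ?_ ?_
      (fun z hz => hd.snd_of_mem_punctures hz)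
      (fun z hz => hc.snd_of_mem_punctures (C.mem_of_apply_mem hz))
      (fun z hz => hd.not_mem_boundary hz) ?_ ?_ ?_
    · rw [hab]; exact hd.mark_snd b hb
    · rw [hgy i hi]; exact h2
    · rw [hgx]
    · rw [hgx]; exact hxQ'
    · rw [hab, hgx]; exact hgpar
    · rw [hab, hgy i hi]
      have e : ⇑g ∘ seg (c.mark a) (y i) = ⇑f₁ ∘ seg (c.mark a) (y i) := by
        funext t
        exact hgb _ (mem_boundary_of_bottom (discConvex_bottom.seg_mem (hc.mark_snd a ha) h1 t))
      rw [e]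
      exact h4
  refine ⟨a, Δ, ⟨?_, ?_, _, _, _, HΔ, ?_, ?_⟩, fun a' b' D' h1 => ?_⟩
  · rw [hΔA]; exact hA
  · rw [hΔB]; exact hB
  · rw [hΔA, hΔB]; exact D
  · have := H.matches_mul (G.matches_prune hA) (G'.matches_prune hB).inv
      ((G.fits hc hA).prune hP hA) ((G'.fits hd hB).prune hP hB)
    rwa [inv_one, one_mul, mul_one] at this
  · rw [HΔ.isDipole_iff, hΔA, hΔB]
    have D₁ := H₁.isDipole_iff.1 D'
    have D₂ := H.isDipole_iff.1 D'
    refine D₂.grow hd hA hB hab h1 fun i hi => ?_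
    have h2 := hgΛ _ ⟨a', b', i, D₁, h1, hi, rfl⟩
    have e : f₁ (c.puncture a') = g (c.puncture a') :=
      hfg.apply_eq (Or.inl (Set.mem_image_of_mem _ D₁.top_mem))
    simp only [e] at h2
    exact h2

end Diagram

end Chambord

namespace Chambord

open Placement

variable {S : Type*} {P : SemigroupPresentation S} {w : List S}

theorem Forest.growth_induction (hP : P.IsArboreal) (hT : NoNonRootLeaf P w) {X : Forest P w}
    {motive : Forest P w → Prop} (hX : motive X)
    (step : ∀ A A' : Forest P w, ∀ a, A.Prunes A' a → motive A → motive A')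
    {A : Forest P w} (h : A.verts ⊆ X.verts) : motive A := by
  induction hk : X.verts.card - A.verts.card using Nat.strong_induction_on generalizing A with
  | _ k ih =>
    by_cases hne : A = X
    · exact hne ▸ hX
    · obtain ⟨a, ha, hc⟩ := exists_pLeaf_of_subset h hne
      obtain ⟨A₁, hA₁⟩ := exists_prunes_top hP hT ha
      have h1 : A₁.verts ⊆ X.verts := fun x hx => by
        by_cases hxa : ∃ i, x = a ++ [i]
        · obtain ⟨i, rfl⟩ := hxa
          exact hc i (A₁.hasVertex _ hx)
        · push Not at hxa
          exact h ((hA₁.mem_verts_iff x).2 ⟨hx, hxa⟩)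
      refine step A₁ A a hA₁ (ih _ ?_ h1 rfl)
      have := hA₁.card_lt
      have := Finset.card_le_card h1
      omega

namespace Diagram

variable {Δ Δ' Δ₁ Δ₂ Δ₃ Δ₁' Δ₂' E N : Diagram P w} {a b a' b' : List ℕ} {c d e : Placement}
  {f g : Disc ≃ₜ Disc}

/-! ### Reduced forms -/

/-- `Δ'` is obtained from `Δ` by successive reductions of dipoles. -/
def ReducesTo : Diagram P w → Diagram P w → Prop :=
  Relation.ReflTransGen fun Δ Δ' => ∃ a b, ReducesAt a b Δ Δ'

theorem ReducesTo.equipotent (hP : P.IsArboreal) (h : ReducesTo Δ Δ') : Equipotent Δ Δ' := by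
  induction h with
  | refl => exact .refl
  | tail _ h ih => exact ih.tail (Or.inl ((reduces_iff hP).2 h))

theorem equipotent_symm (h : Equipotent Δ Δ') : Equipotent Δ' Δ := by
  induction h with
  | refl => exact .refl
  | tail _ h ih => exact .head h.symm ih

theorem equipotent_trans (h : Equipotent Δ Δ') (h' : Equipotent Δ' E) : Equipotent Δ E :=
  Relation.ReflTransGen.trans h h'

theorem ReducesTo.join (hP : P.IsArboreal) (h₁ : ReducesTo Δ Δ₁) (h₂ : ReducesTo Δ Δ₂) :
    ∃ N, ReducesTo Δ₁ N ∧ ReducesTo Δ₂ N := by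
  refine Relation.church_rosser (fun Δ Δ₁ Δ₂ => ?_) h₁ h₂
  rintro ⟨a, b, R₁⟩ ⟨a', b', R₂⟩
  rcases R₁.eq_or_ne R₂ with ⟨rfl, rfl⟩ | ⟨h, -⟩
  · obtain rfl := R₁.unique hP R₂
    exact ⟨Δ₁, .refl, .refl⟩
  · obtain ⟨Δ', h1, h2⟩ := R₁.commute hP R₂ h
    exact ⟨Δ', .single ⟨_, _, h1⟩, .single ⟨_, _, h2⟩⟩

theorem join_of_equipotent (hP : P.IsArboreal) (h : Equipotent Δ Δ') :
    ∃ N, ReducesTo Δ N ∧ ReducesTo Δ' N := by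
  induction h with
  | refl => exact ⟨Δ, .refl, .refl⟩
  | tail _ h ih =>
    obtain ⟨N, h1, h2⟩ := ih
    rcases h with h | h
    · obtain ⟨N', h3, h4⟩ := h2.join hP (.single ((reduces_iff hP).1 h))
      exact ⟨N', h1.trans h3, h4⟩
    · exact ⟨N, h1, .head ((reduces_iff hP).1 h) h2⟩

theorem ReducesTo.eq_of_isReduced (h : ReducesTo Δ Δ') (hΔ : IsReduced Δ) : Δ = Δ' := by
  rcases Relation.ReflTransGen.cases_head h with h | ⟨E, ⟨a, b, R⟩, -⟩
  · exact h
  · exact absurd R.isDipole (hΔ a b)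

theorem exists_reduced (hP : P.IsArboreal) (Δ : Diagram P w) :
    ∃ N, IsReduced N ∧ ReducesTo Δ N := by
  induction hk : Δ.bot.verts.card using Nat.strong_induction_on generalizing Δ with
  | _ k ih =>
    by_cases h : IsReduced Δ
    · exact ⟨Δ, h, .refl⟩
    · unfold IsReduced at h
      push Not at h
      obtain ⟨a, b, D⟩ := h
      obtain ⟨Δ', R⟩ := exists_reducesAt hP D
      obtain ⟨N, h1, h2⟩ := ih _ (hk ▸ R.2.1.card_lt) Δ' rfl
      exact ⟨N, h1, .head ⟨a, b, R⟩ h2⟩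

theorem eq_of_equipotent (hP : P.IsArboreal) (hΔ : IsReduced Δ) (hΔ' : IsReduced Δ')
    (h : Equipotent Δ Δ') : Δ = Δ' := by
  obtain ⟨N, h1, h2⟩ := join_of_equipotent hP h
  rw [h1.eq_of_isReduced hΔ, h2.eq_of_isReduced hΔ']

theorem existsUnique_reduced (hP : P.IsArboreal) (Δ : Diagram P w) :
    ∃! Δ', IsReduced Δ' ∧ Equipotent Δ Δ' := by
  obtain ⟨N, h1, h2⟩ := exists_reduced hP Δ
  refine ⟨N, ⟨h1, h2.equipotent hP⟩, ?_⟩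
  rintro N' ⟨h3, h4⟩
  exact eq_of_equipotent hP h3 h1 (equipotent_trans (equipotent_symm h4) (h2.equipotent hP))

/-! ### Diagrams with the same reduced form and the same bottom forest -/

theorem ReducesTo.bot_subset (h : ReducesTo Δ Δ') : Δ'.bot.verts ⊆ Δ.bot.verts := by
  induction h with
  | refl => exact subset_rfl
  | tail _ h ih =>
    obtain ⟨a, b, R⟩ := h
    exact R.2.1.subset.trans ih

theorem exists_reducesTo_of_subset (hP : P.IsArboreal) (hT : NoNonRootLeaf P w) {X : Forest P w}
    (h : Δ.bot.verts ⊆ X.verts) : ∃ Δ', ReducesTo Δ' Δ ∧ Δ'.bot = X := by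
  refine Forest.growth_induction hP hT
    (motive := fun A => ∀ Δ : Diagram P w, Δ.bot = A → ∃ Δ', ReducesTo Δ' Δ ∧ Δ'.bot = X)
    (fun Δ hΔ => ⟨Δ, .refl, hΔ⟩) (fun A A' a hA ih Δ hΔ => ?_) h Δ rfl
  subst hΔ
  obtain ⟨b, E, R, -⟩ := exists_reducesAt_of_mem hP hT hA.mem
  obtain ⟨Δ', h1, h2⟩ := ih E (R.2.1.top_unique hA)
  exact ⟨Δ', h1.tail ⟨_, _, R⟩, h2⟩

theorem ReducesTo.eq_of_bot_eq (hP : P.IsArboreal) (hT : NoNonRootLeaf P w) (h : ReducesTo Δ N)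
    (h' : ReducesTo Δ' N) (hb : Δ.bot = Δ'.bot) : Δ = Δ' := by
  induction hk : Δ.bot.verts.card - N.bot.verts.card using Nat.strong_induction_on
    generalizing Δ Δ' N with
  | _ k ih =>
    have htail : ∀ {Δ Δ' N : Diagram P w}, ReducesTo Δ' N → Δ.bot = Δ'.bot → Δ = N → Δ' = N := by
      rintro Δ Δ' N h' hb rfl
      rcases Relation.ReflTransGen.cases_tail h' with h' | ⟨M, h1, a, b, R⟩
      · exact h'.symm
      · have h2 := Finset.card_le_card (ReducesTo.bot_subset h1)
        have h3 := R.2.1.card_lt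
        rw [hb] at h3
        omega
    rcases Relation.ReflTransGen.cases_tail h with h0 | ⟨M, hM, a₁, b₁, R₁⟩
    · rw [htail h' hb h0.symm, h0]
    rcases Relation.ReflTransGen.cases_tail h' with h0 | ⟨M', hM', a₂, b₂, R₂⟩
    · rw [htail h hb.symm h0.symm, h0]
    have hlt : ∀ {M : Diagram P w} {a b : List ℕ}, M.bot.verts ⊆ Δ.bot.verts →
        ReducesAt a b M N → Δ.bot.verts.card - M.bot.verts.card < k := by
      intro M a b hM R
      have := Finset.card_le_card hM
      have := R.2.1.card_lt
      omega
    by_cases hbb : b₁ = b₂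
    · subst hbb
      obtain rfl := R₁.eq_of_eq hP R₂
      exact ih _ (hlt (ReducesTo.bot_subset hM) R₁) hM hM' hb rfl
    · have hb₂ : b₂ ∈ M.bot.pLeaves :=
        R₁.2.1.mem_pLeaves_iff_of_top.2 (Or.inl ⟨R₂.2.1.mem, Ne.symm hbb⟩)
      obtain ⟨a₃, E, R₃, hE⟩ := exists_reducesAt_of_mem hP hT hb₂
      have D := hE a₁ b₁ R₁.isDipole fun i e => ((R₁.2.1.mem_verts_iff _).1
        (Forest.mem_verts_of_pLeaves R₂.2.1.mem)).2 i e
      obtain ⟨M'', R₄⟩ := exists_reducesAt hP D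
      have hne : a₃ ≠ a₁ := by
        rcases R₃.eq_or_ne R₄ with h | h
        · exact absurd h.2.symm hbb
        · exact h.1
      obtain ⟨N', h1, h2⟩ := R₃.commute hP R₄ hne
      obtain rfl := R₁.unique hP h1
      obtain rfl := R₂.eq_of_eq hP h2
      have hE' : E.bot.verts ⊆ Δ.bot.verts := fun x hx => by
        by_cases hxb : ∃ i, x = b₂ ++ [i]
        · obtain ⟨i, rfl⟩ := hxb
          rw [hb]
          exact ReducesTo.bot_subset hM' (Forest.mem_verts_of_pLeaves
            (R₂.2.1.children i (E.bot.hasVertex _ hx)))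
        · push Not at hxb
          exact ReducesTo.bot_subset hM ((R₃.2.1.mem_verts_iff x).2 ⟨hx, hxb⟩)
      obtain ⟨G, hG, hGb⟩ := exists_reducesTo_of_subset hP hT hE'
      have e1 := ih _ (hlt (ReducesTo.bot_subset hM) R₁) hM (hG.tail ⟨_, _, R₃⟩) hGb.symm rfl
      have e2 := ih _ (by rw [hGb]; exact hlt (hb ▸ ReducesTo.bot_subset hM') R₂)
        (hG.tail ⟨_, _, R₄⟩) hM' (hGb.trans hb) rfl
      exact e1.trans e2

theorem eq_of_equipotent_of_bot_eq (hP : P.IsArboreal) (hT : NoNonRootLeaf P w)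
    (h : Equipotent Δ Δ') (hb : Δ.bot = Δ'.bot) : Δ = Δ' := by
  obtain ⟨N, h1, h2⟩ := join_of_equipotent hP h
  exact h1.eq_of_bot_eq hP hT h2 hb

/-! ### Inverses -/

/-- The inverse diagram. -/
def inv (Δ : Diagram P w) : Diagram P w where
  top := Δ.bot
  braid := Δ.braid⁻¹
  bot := Δ.top
  isDiagram := ⟨Δ.isDiagram.interior_bot, Δ.isDiagram.interior_top, Δ.isDiagram.pLeaves_bot,
    Δ.isDiagram.pLeaves_top, fun f hf x hx y hy e s => by
      have h1 : braidClass f⁻¹ = Δ.braid := by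
        rw [← inv_inv Δ.braid, ← hf]; rfl
      refine (Δ.isDiagram.label f⁻¹ h1 y hy x hx ?_ s).symm
      rw [← e]
      exact f.1.symm_apply_apply _⟩

theorem mk_congr {p q : ℕ} {A B : Forest P w} {β β' : BraidGroup p q} (e : β = β')
    (h : IsDiagram A β B) (h' : IsDiagram A β' B) :
    (⟨A, β, B, h⟩ : Diagram P w) = ⟨A, β', B, h'⟩ := by
  subst e; rfl

theorem inv_inv (Δ : Diagram P w) : Δ.inv.inv = Δ := by
  obtain ⟨A, β, B, h⟩ := Δ
  exact mk_congr (_root_.inv_inv β) _ _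

theorem Presents.inv (H : Δ.Presents c f d) : Δ.inv.Presents d f⁻¹ c := by
  obtain ⟨g, h, k, hg, hh, hk, rfl⟩ := H.exists_rep
  refine ⟨H.fits_bot, H.fits_top, g⁻¹, k⁻¹, h⁻¹, ?_, hk.inv, hh.inv, ?_⟩
  · change (braidClass g)⁻¹ = Δ.braid⁻¹
    rw [hg]
  · simp only [mul_inv_rev, mul_assoc]
    rfl

theorem ReducesAt.inv (R : ReducesAt a b Δ Δ') : ReducesAt b a Δ.inv Δ'.inv := by
  obtain ⟨hA, hB, c, f, d, H, D, H'⟩ := R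
  exact ⟨hB, hA, d, f⁻¹, c, H.inv, D.inv H.carries, H'.inv⟩

theorem ReducesTo.inv (h : ReducesTo Δ Δ') : ReducesTo Δ.inv Δ'.inv := by
  induction h with
  | refl => exact .refl
  | tail _ h ih =>
    obtain ⟨a, b, R⟩ := h
    exact ih.tail ⟨b, a, R.inv⟩

theorem isDipole_inv (D : IsDipole Δ a b) : IsDipole Δ.inv b a := by
  obtain ⟨f, H⟩ := Δ.exists_presents Δ.top.fits_grid Δ.bot.fits_grid
  exact H.inv.isDipole_iff.2 ((H.isDipole_iff.1 D).inv H.carries)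

theorem IsReduced.inv (h : IsReduced Δ) : IsReduced Δ.inv := fun a b D => by
  have := isDipole_inv D
  rw [inv_inv] at this
  exact h b a this

theorem eq_of_equipotent_of_top_eq (hP : P.IsArboreal) (hT : NoNonRootLeaf P w)
    (h : Equipotent Δ Δ') (ht : Δ.top = Δ'.top) : Δ = Δ' := by
  obtain ⟨N, h1, h2⟩ := join_of_equipotent hP h
  have := h1.inv.eq_of_bot_eq hP hT h2.inv ht
  rw [← inv_inv Δ, this, inv_inv]

theorem exists_reducesAt_of_mem_top (hP : P.IsArboreal) (hT : NoNonRootLeaf P w)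
    (ha : a ∈ Δ'.top.pLeaves) : ∃ b Δ, ReducesAt a b Δ Δ' := by
  obtain ⟨b, Δ, R, -⟩ := exists_reducesAt_of_mem (Δ' := Δ'.inv) hP hT ha
  have := R.inv
  rw [inv_inv] at this
  exact ⟨b, _, this⟩

/-! ### Products of diagrams -/

/-- The diagram `(A, β₂ β₁, C)` is the product of `(A, β₁, B)` and `(B, β₂, C)`. -/
inductive IsProduct : Diagram P w → Diagram P w → Diagram P w → Prop
  | mk {p q : ℕ} {A B C : Forest P w} {β₁ β₂ : BraidGroup p q} (h₁ : IsDiagram A β₁ B)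
      (h₂ : IsDiagram B β₂ C) (h : IsDiagram A (β₂ * β₁) C) :
      IsProduct ⟨A, β₁, B, h₁⟩ ⟨B, β₂, C, h₂⟩ ⟨A, β₂ * β₁, C, h⟩

namespace IsProduct

theorem mid_eq (h : IsProduct Δ₁ Δ₂ Δ) : Δ₁.bot = Δ₂.top := by
  cases h; rfl

theorem top_eq (h : IsProduct Δ₁ Δ₂ Δ) : Δ.top = Δ₁.top := by
  cases h; rfl

theorem bot_eq (h : IsProduct Δ₁ Δ₂ Δ) : Δ.bot = Δ₂.bot := by
  cases h; rfl

theorem unique (h : IsProduct Δ₁ Δ₂ Δ) (h' : IsProduct Δ₁ Δ₂ Δ') : Δ = Δ' := by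
  cases h; cases h'; rfl

theorem assoc {Δ₁₂ Δ₂₃ : Diagram P w} (h₁₂ : IsProduct Δ₁ Δ₂ Δ₁₂) (h₂₃ : IsProduct Δ₂ Δ₃ Δ₂₃)
    (h : IsProduct Δ₁₂ Δ₃ Δ) : IsProduct Δ₁ Δ₂₃ Δ := by
  cases h₁₂ with | mk h₁ h₂ h₁₂
  cases h₂₃ with | mk _ h₃ h₂₃
  cases h with | mk _ _ h
  simp only [← mul_assoc]
  exact .mk h₁ h₂₃ _

end IsProduct

theorem exists_isProduct (h : Δ₁.bot = Δ₂.top) : ∃ Δ, IsProduct Δ₁ Δ₂ Δ := by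
  obtain ⟨A, β₁, B, h₁⟩ := Δ₁
  rename_i p q
  obtain ⟨B', β₂, C, h₂⟩ := Δ₂
  rename_i p' q'
  obtain rfl : B = B' := h
  obtain rfl : p = p' := h₁.interior_bot.symm.trans h₂.interior_top
  obtain rfl : q = q' := h₁.pLeaves_bot.symm.trans h₂.pLeaves_top
  refine ⟨_, .mk h₁ h₂ ⟨h₁.interior_top, h₂.interior_bot, h₁.pLeaves_top, h₂.pLeaves_bot, ?_⟩⟩
  intro f hf x hx z hz e s
  obtain ⟨g₁, hg₁⟩ := QuotientGroup.mk_surjective β₁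
  obtain ⟨g₂, hg₂⟩ := QuotientGroup.mk_surjective β₂
  have h3 : braidClass (g₂ * g₁) = braidClass f := by
    rw [hf, ← hg₁, ← hg₂]; rfl
  have h4 := (braidClass_eq_iff.1 h3).apply_eq (z := A.mark x) (Or.inr (by
    rw [← h₁.pLeaves_top, ← A.marks_grid]
    exact Set.mem_image_of_mem _ hx))
  exact ((carries_rep (Δ := ⟨A, β₁, B, h₁⟩) hg₁).mul
    (carries_rep (Δ := ⟨B, β₂, C, h₂⟩) hg₂)).label x hx z hz (h4.trans e) s

theorem IsProduct.presents (h : IsProduct Δ₁ Δ₂ Δ) (H₁ : Δ₁.Presents c f d)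
    (H₂ : Δ₂.Presents d g e) : Δ.Presents c (g * f) e := by
  cases h with | mk h₁ h₂ h
  obtain ⟨g₁, u, k, hg₁, hu, hk, rfl⟩ := H₁.exists_rep
  obtain ⟨g₂, k', v, hg₂, hk', hv, rfl⟩ := H₂.exists_rep
  rename_i p q A B C β₁ β₂
  have hg : braidClass (g₂ * g₁) = β₂ * β₁ :=
    (congrArg₂ (· * ·) hg₂ hg₁ : braidClass g₂ * braidClass g₁ = β₂ * β₁)
  have H : Presents ⟨A, β₂ * β₁, C, h⟩ c (v * (g₂ * g₁ : homeoGroup p q).1 * u) e :=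
    ⟨H₁.fits_top, H₂.fits_bot, g₂ * g₁, u, v, hg, hu, hv, rfl⟩
  refine H.congr ?_
  have h3 : IsotopicRel (B.grid.punctures B ∪ B.grid.marks B) 1 (k' * k) :=
    (Matches.one B B.grid).isotopicRel (hk'.mul hk)
  have h4 := (h3.mul_left (v * g₂.1)).mul_right (h := g₁.1 * u)
    (Z' := c.punctures A ∪ c.marks A) ?_ ?_
  · rw [show v * (g₂ * g₁ : homeoGroup p q).1 * u = v * g₂.1 * 1 * (g₁.1 * u) by
      simp only [Subgroup.coe_mul, mul_assoc, one_mul],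
      show v * g₂.1 * k' * (k * g₁.1 * u) = v * g₂.1 * (k' * k) * (g₁.1 * u) by
      simp only [mul_assoc]]
    exact h4
  · exact fun z => (homeoGroup.preservesBoundary g₁ _).trans (hu.isSlide.preservesBoundary z)
  · exact fun z hz => (carries_rep (Δ := ⟨A, β₁, B, h₁⟩) hg₁).apply_mem (hu.apply_mem hz)

theorem IsProduct.reducesAt (hP : P.IsArboreal) {E₁ E₂ : Diagram P w} {x : List ℕ}
    (h : IsProduct Δ₁ Δ₂ Δ) (h' : IsProduct E₁ E₂ E) (R₁ : ReducesAt a x Δ₁ E₁)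
    (R₂ : ReducesAt x b Δ₂ E₂) : ReducesAt a b Δ E := by
  obtain ⟨f, H₁⟩ := Δ₁.exists_presents Δ₁.top.fits_grid Δ₁.bot.fits_grid
  obtain ⟨g, H₂⟩ := Δ₂.exists_presents (c := Δ₁.bot.grid) (by
    rw [← h.mid_eq]; exact Δ₁.bot.fits_grid) Δ₂.bot.fits_grid
  have D₁ := H₁.isDipole_iff.1 R₁.isDipole
  have D₂ := H₂.isDipole_iff.1 R₂.isDipole
  have C₂ := H₂.carries
  rw [← h.mid_eq] at D₂ C₂
  refine ⟨?_, ?_, _, _, _, h.presents H₁ H₂, ?_,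
    h'.presents (R₁.presents hP H₁) (R₂.presents hP H₂)⟩
  · rw [h.top_eq, h'.top_eq]; exact R₁.1
  · rw [h.bot_eq, h'.bot_eq]; exact R₂.2.1
  · rw [h.top_eq, h.bot_eq]
    exact D₁.mul D₂ C₂

theorem IsProduct.exists_of_subset (hP : P.IsArboreal) (hT : NoNonRootLeaf P w) {X : Forest P w}
    (h : IsProduct Δ₁ Δ₂ Δ) (hX : Δ₁.bot.verts ⊆ X.verts) : ∃ E₁ E₂ E : Diagram P w,
      ReducesTo E₁ Δ₁ ∧ ReducesTo E₂ Δ₂ ∧ ReducesTo E Δ ∧ IsProduct E₁ E₂ E ∧ E₁.bot = X := by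
  refine Forest.growth_induction hP hT
    (motive := fun A => ∀ Δ₁ Δ₂ Δ : Diagram P w, Δ₁.bot = A → IsProduct Δ₁ Δ₂ Δ →
      ∃ E₁ E₂ E : Diagram P w, ReducesTo E₁ Δ₁ ∧ ReducesTo E₂ Δ₂ ∧ ReducesTo E Δ ∧
        IsProduct E₁ E₂ E ∧ E₁.bot = X)
    (fun Δ₁ Δ₂ Δ hΔ h => ⟨Δ₁, Δ₂, Δ, .refl, .refl, .refl, h, hΔ⟩)
    (fun A A' a hA ih Δ₁ Δ₂ Δ hΔ h => ?_) hX Δ₁ Δ₂ Δ rfl h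
  subst hΔ
  obtain ⟨a₁, G₁, R₁, -⟩ := exists_reducesAt_of_mem hP hT hA.mem
  obtain ⟨a₂, G₂, R₂⟩ := exists_reducesAt_of_mem_top hP hT (h.mid_eq ▸ hA.mem)
  have h1 := R₁.2.1.top_unique hA
  have h2 := R₂.1
  rw [← h.mid_eq] at h2
  obtain ⟨G, hG⟩ := exists_isProduct (h1.trans (hA.top_unique h2))
  obtain ⟨E₁, E₂, E, e1, e2, e3, e4, e5⟩ := ih G₁ G₂ G h1 hG
  exact ⟨E₁, E₂, E, e1.tail ⟨_, _, R₁⟩, e2.tail ⟨_, _, R₂⟩,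
    e3.tail ⟨_, _, hG.reducesAt hP h R₁ R₂⟩, e4, e5⟩

/-- The product is compatible with equipotency. -/
theorem IsProduct.equipotent (hP : P.IsArboreal) (hT : NoNonRootLeaf P w)
    (h : IsProduct Δ₁ Δ₂ Δ) (h' : IsProduct Δ₁' Δ₂' Δ') (e₁ : Equipotent Δ₁ Δ₁')
    (e₂ : Equipotent Δ₂ Δ₂') : Equipotent Δ Δ' := by
  classical
  obtain ⟨E₁, E₂, E, r1, r2, r3, hE, hb⟩ := h.exists_of_subset hP hT
    (X := Δ₁.bot.union Δ₁'.bot) Finset.subset_union_left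
  obtain ⟨E₁', E₂', E', r1', r2', r3', hE', hb'⟩ := h'.exists_of_subset hP hT
    (X := Δ₁.bot.union Δ₁'.bot) Finset.subset_union_right
  have key : ∀ {E E' Δ Δ' : Diagram P w}, ReducesTo E Δ → ReducesTo E' Δ' → Equipotent Δ Δ' →
      Equipotent E E' := fun h1 h2 h3 => equipotent_trans (h1.equipotent hP)
    (equipotent_trans h3 (equipotent_symm (h2.equipotent hP)))
  obtain rfl := eq_of_equipotent_of_bot_eq hP hT (key r1 r1' e₁) (hb.trans hb'.symm)
  obtain rfl := eq_of_equipotent_of_top_eq hP hT (key r2 r2' e₂)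
    (hE.mid_eq.symm.trans hE'.mid_eq)
  obtain rfl := hE.unique hE'
  exact equipotent_trans (equipotent_symm (r3.equipotent hP)) (r3'.equipotent hP)

theorem exists_composable (hP : P.IsArboreal) (hT : NoNonRootLeaf P w) (Δ₁ Δ₂ : Diagram P w) :
    ∃ E₁ E₂ : Diagram P w, ReducesTo E₁ Δ₁ ∧ ReducesTo E₂ Δ₂ ∧ E₁.bot = E₂.top := by
  classical
  obtain ⟨E₁, h1, h2⟩ := exists_reducesTo_of_subset (Δ := Δ₁) hP hT
    (X := Δ₁.bot.union Δ₂.top) Finset.subset_union_left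
  obtain ⟨E₂, h3, h4⟩ := exists_reducesTo_of_subset (Δ := Δ₂.inv) hP hT
    (X := Δ₁.bot.union Δ₂.top) Finset.subset_union_right
  have h5 := h3.inv
  rw [inv_inv] at h5
  exact ⟨E₁, E₂.inv, h1, h5, h2.trans h4.symm⟩

/-! ### Identity diagrams -/

/-- The diagram `(A, 1, A)`. -/
noncomputable def one (A : Forest P w) : Diagram P w where
  p := A.interior.card
  q := A.pLeaves.card
  top := A
  braid := 1
  bot := A
  isDiagram := ⟨rfl, rfl, rfl, rfl, fun f hf x hx y hy e s => by
    have h1 : braidClass f = braidClass 1 := hf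
    have h2 := (braidClass_eq_iff.1 h1).apply_eq (z := A.mark x)
      (Or.inr (A.marks_grid ▸ Set.mem_image_of_mem _ hx))
    rw [A.fits_grid.mark_injOn hx hy (h2.symm.trans e)]⟩

theorem presents_one {A : Forest P w} (hc : c.Fits A) : (one A).Presents c 1 c := by
  obtain ⟨h, hh⟩ := hc.exists_matches A.fits_grid
  exact ⟨hc, hc, 1, h, h⁻¹, rfl, hh, hh.inv, by simp⟩

theorem one_reducesTo (hP : P.IsArboreal) (hT : NoNonRootLeaf P w) {A X : Forest P w}
    (h : A.verts ⊆ X.verts) : ReducesTo (one X) (one A) := by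
  refine Forest.growth_induction hP hT (motive := fun A => ReducesTo (one X) (one A)) .refl
    (fun A A' a hA ih => ih.tail ⟨a, a, hA, hA, _, _, _, presents_one A.fits_grid,
      .one A.fits_grid hA, presents_one (A.fits_grid.prune hP hA)⟩) h

theorem isProduct_one_left (Δ : Diagram P w) : IsProduct (one Δ.top) Δ Δ := by
  obtain ⟨A, β, B, h⟩ := Δ
  rename_i p q
  obtain rfl := h.interior_top
  obtain rfl := h.pLeaves_top
  have := IsProduct.mk (one A).isDiagram h (β₁ := 1) (β₂ := β) (by rw [mul_one]; exact h)
  simp only [mul_one] at this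
  exact this

theorem isProduct_inv_left (Δ : Diagram P w) : IsProduct Δ.inv Δ (one Δ.bot) := by
  obtain ⟨A, β, B, h⟩ := Δ
  rename_i p q
  obtain rfl := h.interior_bot
  obtain rfl := h.pLeaves_bot
  have := IsProduct.mk (inv ⟨A, β, B, h⟩).isDiagram h (β₁ := β⁻¹) (β₂ := β)
    (by rw [mul_inv_cancel]; exact (one B).isDiagram)
  simp only [mul_inv_cancel] at this
  exact this

/-! ### Concatenation -/

theorem isConcatenation_iff : IsConcatenation Δ₁ Δ₂ Δ ↔ ∃ E₁ E₂ E, Equipotent Δ₁ E₁ ∧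
    Equipotent Δ₂ E₂ ∧ IsProduct E₁ E₂ E ∧ Equipotent E Δ ∧ IsReduced Δ := by
  constructor
  · rintro ⟨p, q, A, B, C, β₁, β₂, h₁, h₂, h, e1, e2, e3, e4⟩
    exact ⟨_, _, _, e1, e2, .mk h₁ h₂ h, e3, e4⟩
  · rintro ⟨_, _, _, e1, e2, ⟨h₁, h₂, h⟩, e3, e4⟩
    exact ⟨_, _, _, _, _, _, _, h₁, h₂, h, e1, e2, e3, e4⟩

theorem isConcatenation_unique (hP : P.IsArboreal) (hT : NoNonRootLeaf P w)
    (h : IsConcatenation Δ₁ Δ₂ Δ) (h' : IsConcatenation Δ₁ Δ₂ Δ') : Δ = Δ' := by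
  obtain ⟨E₁, E₂, E, e1, e2, e3, e4, e5⟩ := isConcatenation_iff.1 h
  obtain ⟨E₁', E₂', E', e1', e2', e3', e4', e5'⟩ := isConcatenation_iff.1 h'
  refine eq_of_equipotent hP e5 e5' (equipotent_trans (equipotent_symm e4) (equipotent_trans ?_ e4'))
  exact e3.equipotent hP hT e3' (equipotent_trans (equipotent_symm e1) e1')
    (equipotent_trans (equipotent_symm e2) e2')

theorem existsUnique_isConcatenation (hP : P.IsArboreal) (hT : NoNonRootLeaf P w)
    (Δ₁ Δ₂ : Diagram P w) : ∃! Δ, IsConcatenation Δ₁ Δ₂ Δ := by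
  obtain ⟨E₁, E₂, r1, r2, h⟩ := exists_composable hP hT Δ₁ Δ₂
  obtain ⟨E, hE⟩ := exists_isProduct h
  obtain ⟨N, hN, r⟩ := exists_reduced hP E
  exact ⟨N, isConcatenation_iff.2 ⟨E₁, E₂, E, equipotent_symm (r1.equipotent hP),
    equipotent_symm (r2.equipotent hP), hE, r.equipotent hP, hN⟩,
    fun N' h' => isConcatenation_unique hP hT h' (isConcatenation_iff.2
      ⟨E₁, E₂, E, equipotent_symm (r1.equipotent hP), equipotent_symm (r2.equipotent hP), hE,
        r.equipotent hP, hN⟩)⟩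

theorem isConcatenation_assoc (hP : P.IsArboreal) (hT : NoNonRootLeaf P w)
    {Δ₁₂ Δ₂₃ : Diagram P w} (h₁₂ : IsConcatenation Δ₁ Δ₂ Δ₁₂) (h₂₃ : IsConcatenation Δ₂ Δ₃ Δ₂₃)
    (h : IsConcatenation Δ₁₂ Δ₃ Δ) : IsConcatenation Δ₁ Δ₂₃ Δ := by
  obtain ⟨E₁, E₂, r1, r2, hb⟩ := exists_composable hP hT Δ₁ Δ₂
  obtain ⟨F₂, F₃, s2, s3, hb'⟩ := exists_composable hP hT E₂ Δ₃
  have hsub : E₁.bot.verts ⊆ F₂.top.verts := hb ▸ ReducesTo.bot_subset s2.inv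
  obtain ⟨F₁, s1, hb''⟩ := exists_reducesTo_of_subset hP hT hsub
  have e1 := equipotent_symm (ReducesTo.equipotent hP (s1.trans r1))
  have e2 := equipotent_symm (ReducesTo.equipotent hP (s2.trans r2))
  have e3 := equipotent_symm (s3.equipotent hP)
  obtain ⟨F₁₂, p₁₂⟩ := exists_isProduct hb''
  obtain ⟨F₂₃, p₂₃⟩ := exists_isProduct hb'
  obtain ⟨F, p⟩ := exists_isProduct (p₁₂.bot_eq.trans hb')
  obtain ⟨N₁₂, n1, n2⟩ := exists_reduced hP F₁₂
  obtain ⟨N₂₃, m1, m2⟩ := exists_reduced hP F₂₃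
  obtain ⟨N, l1, l2⟩ := exists_reduced hP F
  obtain rfl := isConcatenation_unique hP hT h₁₂
    (isConcatenation_iff.2 ⟨_, _, _, e1, e2, p₁₂, n2.equipotent hP, n1⟩)
  obtain rfl := isConcatenation_unique hP hT h₂₃
    (isConcatenation_iff.2 ⟨_, _, _, e2, e3, p₂₃, m2.equipotent hP, m1⟩)
  obtain rfl := isConcatenation_unique hP hT h (isConcatenation_iff.2
    ⟨_, _, _, equipotent_symm (n2.equipotent hP), e3, p, l2.equipotent hP, l1⟩)
  exact isConcatenation_iff.2 ⟨_, _, _, e1, equipotent_symm (m2.equipotent hP),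
    p₁₂.assoc p₂₃ p, l2.equipotent hP, l1⟩

theorem exists_group (hP : P.IsArboreal) (hT : NoNonRootLeaf P w) :
    ∃ _G : Group {Δ : Diagram P w // IsReduced Δ}, ∀ g h k : {Δ : Diagram P w // IsReduced Δ},
      g * h = k ↔ IsConcatenation g.1 h.1 k.1 := by
  choose m hm using fun Δ₁ Δ₂ : Diagram P w => (existsUnique_isConcatenation hP hT Δ₁ Δ₂).exists
  have hred : ∀ {Δ₁ Δ₂ Δ : Diagram P w}, IsConcatenation Δ₁ Δ₂ Δ → IsReduced Δ := fun h => by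
    obtain ⟨_, _, _, _, _, _, _, h⟩ := isConcatenation_iff.1 h
    exact h
  obtain ⟨e, he, e'⟩ := exists_reduced hP (one (Forest.rootForest P w))
  have hone : ∀ A : Forest P w, Equipotent (one A) e := fun A =>
    ReducesTo.equipotent hP ((one_reducesTo hP hT A.rootForest_subset).trans e')
  let _ : Mul {Δ : Diagram P w // IsReduced Δ} := ⟨fun g h => ⟨m g.1 h.1, hred (hm g.1 h.1)⟩⟩
  let _ : One {Δ : Diagram P w // IsReduced Δ} := ⟨⟨e, he⟩⟩
  let _ : Inv {Δ : Diagram P w // IsReduced Δ} := ⟨fun g => ⟨g.1.inv, IsReduced.inv g.2⟩⟩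
  have hmul : ∀ g h k : {Δ : Diagram P w // IsReduced Δ},
      g * h = k ↔ IsConcatenation g.1 h.1 k.1 := fun g h k => by
    constructor
    · rintro rfl
      exact hm g.1 h.1
    · exact fun hk => Subtype.ext (isConcatenation_unique hP hT (hm g.1 h.1) hk)
  refine ⟨Group.ofLeftAxioms (fun g h k => ?_) (fun g => ?_) (fun g => ?_), hmul⟩
  · refine ((hmul _ _ _).2 (isConcatenation_assoc hP hT ((hmul g h _).1 rfl)
      ((hmul h k _).1 rfl) ((hmul (g * h) k _).1 rfl))).symm
  · exact (hmul _ _ _).2 (isConcatenation_iff.2 ⟨_, _, _, equipotent_symm (hone _), .refl,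
      isProduct_one_left g.1, .refl, g.2⟩)
  · exact (hmul _ _ _).2 (isConcatenation_iff.2 ⟨_, _, _, .refl, .refl,
      isProduct_inv_left g.1, hone _, he⟩)

end Diagram

end Chambord

theorem proposition2p6 {S : Type*} (P : Chambord.SemigroupPresentation S) (hP : P.IsArboreal)
    (w : List S) (hw : w ≠ []) :
    (∀ Δ : Chambord.Diagram P w,
      ∃! Δ' : Chambord.Diagram P w, Chambord.IsReduced Δ' ∧ Chambord.Equipotent Δ Δ') ∧
    (Chambord.NoNonRootLeaf P w →
      (∀ Δ₁ Δ₂ : Chambord.Diagram P w,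
        ∃! Δ : Chambord.Diagram P w, Chambord.IsConcatenation Δ₁ Δ₂ Δ) ∧
      ∃ _G : Group {Δ : Chambord.Diagram P w // Chambord.IsReduced Δ},
        ∀ g h k : {Δ : Chambord.Diagram P w // Chambord.IsReduced Δ},
          g * h = k ↔ Chambord.IsConcatenation g.1 h.1 k.1) :=
  ⟨Chambord.Diagram.existsUnique_reduced hP, fun hT =>
    ⟨Chambord.Diagram.existsUnique_isConcatenation hP hT, Chambord.Diagram.exists_group hP hT⟩⟩
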